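/- Let $\mathbb{T}=\mathbb{R}/2\pi\mathbb{Z}$ and let $\varphi:[0,1]\to\mathbb{R}_{<0}$ be a (Lebesgue) integrable negative function. For $y\in\mathbb{T}$, $\varepsilon>0$ let $$V_{y,\varepsilon}(x)=\begin{cases}1+\varepsilon\,\varphi\!\left(\frac{x-y}{\varepsilon}\right) & \text{if } y\le x\le y+\varepsilon,\\ 1 & \text{otherwise,}\end{cases}$$ where $x-y$ is represented in $[0,2\pi)$. Let $\lambda_1\le\lambda_2\le\dots$ be the eigenvalues of $-\Delta+V_{y,\varepsilon}$ on $\mathbb{T}$, listed with multiplicity, and let $\phi_1,\phi_2,\dots$ be corresponding linearly independent real eigenfunctions. Then there are numbers $N_\varepsilon\in\mathbb{R}$ ($\varepsilon>0$), depending only on $\varphi$ and $\varepsilon$, with $N_\varepsilon\to\infty$ as $\varepsilon\to0^+$, such that for every $\varepsilon>0$, every $y\in\mathbb{T}$, every such choice of eigenfunctions and every integer $N$ with $3\le N\le N_\varepsilon$, the eigenvalues $\lambda_1,\dots,\lambda_N$ are positive and the function $$x\mapsto\sum_{k=1}^{N}\frac{1}{\sqrt{\lambda_k}}\,\frac{|\phi_k(x)|}{\|\phi_k\|_{L^\infty(\mathbb{T})}}$$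 has a strict local minimum at some point $x_0$ of the arc $[y,y+\varepsilon]$. -/

import Mathlib

open Real Set Filter Topology MeasureTheory

instance instFactTwoPiPos : Fact ((0 : ℝ) < 2 * π) := ⟨Real.two_pi_pos⟩

/-- The circle `𝕋 = ℝ / 2πℤ`. -/
abbrev Torus : Type := AddCircle (2 * π)

/-- The representative in `[0, 2π)` of the displacement from `y` to `x`, measured along the
positive direction of the circle. -/
noncomputable def displacement (y x : Torus) : ℝ :=
  (AddCircle.equivIco (2 * π) 0 (x - y) : ℝ)

/-- The potential `V_{y,ε}` on the circle: it equals `1 + ε φ((x - y)/ε)` on the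
arc `[y, y + ε]` and `1` elsewhere. -/
noncomputable def bumpPotential (φ : ℝ → ℝ) (y : Torus) (ε : ℝ) (x : Torus) : ℝ :=
  if displacement y x ≤ ε then 1 + ε * φ (displacement y x / ε) else 1

/-- `u` is a (real, nonzero) eigenfunction of `-Δ + V` on the circle with eigenvalue `μ`.
The lift of `u` to `ℝ` is differentiable, its derivative `u'` is locally absolutely continuous,
and `u'' = (V - μ) u` almost everywhere; the last two conditions are written in integrated form. -/
def IsEigenfunction (V : Torus → ℝ) (μ : ℝ) (u : C(Torus, ℝ)) : Prop :=
  u ≠ 0 ∧ ∃ u' : ℝ → ℝ,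
    (∀ t : ℝ, HasDerivAt (fun s : ℝ => u (s : Torus)) (u' t) t) ∧
    ∀ a b : ℝ,
      IntervalIntegrable (fun t : ℝ => (V (t : Torus) - μ) * u (t : Torus)) volume a b ∧
      u' b - u' a = ∫ t in a..b, (V (t : Torus) - μ) * u (t : Torus)

/-- `lam 0 ≤ lam 1 ≤ …` is the list of all eigenvalues of `-Δ + V`, repeated according to
multiplicity, and `u k` is an eigenfunction for `lam k`, so chosen that the `u k` with
`lam k = μ` form a basis of the eigenspace of `μ`, for every eigenvalue `μ`. -/
structure IsEigenSystem (V : Torus → ℝ) (lam : ℕ → ℝ) (u : ℕ → C(Torus, ℝ)) : Prop where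
  monotone : Monotone lam
  eigen : ∀ k, IsEigenfunction V (lam k) (u k)
  linearIndependent : LinearIndependent ℝ u
  complete : ∀ (μ : ℝ) (w : C(Torus, ℝ)), IsEigenfunction V μ w →
    w ∈ Submodule.span ℝ (u '' {k | lam k = μ})

/-- The sum of `|u_k(x)| / (√λ_k ‖u_k‖_∞)` over the first `N` eigenfunctions. The norm on
`C(Torus, ℝ)` is the supremum norm. -/
noncomputable def eigenSum (lam : ℕ → ℝ) (u : ℕ → C(Torus, ℝ)) (N : ℕ) (x : Torus) : ℝ :=
  ∑ k ∈ Finset.range N, 1 / √(lam k) * (|u k x| / ‖u k‖)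

/-- `f` has a strict local minimum at `x₀`. -/
def IsStrictLocalMin (f : Torus → ℝ) (x₀ : Torus) : Prop :=
  ∀ᶠ x in 𝓝[≠] x₀, f x₀ < f x

/-! By translation one may take `y = 0`. As `ε → 0` the operator tends to `-Δ + 1`, whose
eigenvalues are `1 + m²` with eigenspaces spanned by `cos (m t)` and `sin (m t)`. The bump at the
origin has mass of order `ε²` and splits each double eigenvalue: the cosine level drops by about `ε²
* mass φ / π`, while the sine level moves by `o(ε²)`. Consequently every sup-normalised
eigenfunction of bounded eigenvalue is, up to sign, `C¹`-close to a pure cosine or a pure sine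
(`exists_forall_isCloseTo`, by compactness and testing against trigonometric functions), and the low
eigenvalues are simple.

A sine-like eigenfunction has a zero in `[0, ε]` (`IsCloseTo.exists_zero`) and slope at least `1/2`
around it, so its absolute value is V-shaped there. A cosine-like one is nearly flat and bounded
away from zero. As soon as one sine is present, the weighted sum decreases before `0` and increases
after `ε`, so it has a minimum in `[0, ε]`.

For strictness, away from the zeros of the `u k` the sum of absolute values has second derivative
`-∑ c k (λ k - V) |u k|` in the integrated sense. This is negative, because `V ≤ 1`, no `λ k` is
much below `1`, and the cosine of frequency one contributes a fixed amount. Minimisers are therefore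
zeros of some `u k` (`not_isLocalMin_sum_abs`), so there are finitely many of them and the minimum
is strict (`exists_strict_min`).

It remains to show that the first `N` eigenvalues of an abstract `IsEigenSystem` are bounded and
include both types of frequency one (`exists_forall_eigenSystem`). Eigenvalues near `1 + m²` are
found by a continuity argument for the monodromy matrix (`trace_dichotomy`). For `N ≥ 3` a
pigeonhole on types suffices, since the lowest types are the constant and the two of frequency one.

All this holds for fixed `N` and `ε` below a threshold depending on `N`;
`exists_tendsto_atTop_forall_le` converts the thresholds into a range of `N` that grows as `ε → 0`.
-/

/-! ### The potential on one period -/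

/-- The perturbation `ε φ(t / ε)` on `[0, ε]`, extended by zero to the line. -/
noncomputable def bump (φ : ℝ → ℝ) (ε t : ℝ) : ℝ := ε * (Icc (0 : ℝ) 1).indicator φ (t / ε)

theorem displacement_zero_coe {t : ℝ} (ht : t ∈ Ico 0 (2 * π)) :
    displacement 0 (t : Torus) = t := by
  unfold displacement
  rw [sub_zero, AddCircle.equivIco_coe_eq (by simpa using ht)]

theorem displacement_nonneg (y x : Torus) : 0 ≤ displacement y x := by
  unfold displacement
  generalize AddCircle.equivIco (2 * π) 0 (x - y) = z
  exact z.2.1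

theorem bumpPotential_zero_coe {φ : ℝ → ℝ} {ε t : ℝ} (hε : 0 < ε) (ht : t ∈ Ico 0 (2 * π)) :
    bumpPotential φ 0 ε (t : Torus) = 1 + bump φ ε t := by
  unfold bumpPotential bump
  rw [displacement_zero_coe ht]
  by_cases h : t ≤ ε
  · have hm : t / ε ∈ Icc (0 : ℝ) 1 := ⟨div_nonneg ht.1 hε.le, (div_le_one hε).2 h⟩
    rw [if_pos h, indicator_of_mem hm]
  · rw [if_neg h, indicator_of_notMem]
    · simp
    · rintro ⟨-, h2⟩
      exact h ((div_le_one hε).1 h2)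

theorem bumpPotential_le_one {φ : ℝ → ℝ} (hφ_neg : ∀ t ∈ Icc (0 : ℝ) 1, φ t < 0) {ε : ℝ}
    (hε : 0 < ε) (y x : Torus) : bumpPotential φ y ε x ≤ 1 := by
  unfold bumpPotential
  split_ifs with h
  · have := hφ_neg (displacement y x / ε)
      ⟨div_nonneg (displacement_nonneg y x) hε.le, (div_le_one hε).2 h⟩
    nlinarith
  · exact le_rfl

theorem bump_nonpos {φ : ℝ → ℝ} (hφ_neg : ∀ t ∈ Icc (0 : ℝ) 1, φ t < 0) {ε : ℝ}
    (hε : 0 < ε) (t : ℝ) : bump φ ε t ≤ 0 := by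
  unfold bump
  refine mul_nonpos_of_nonneg_of_nonpos hε.le ?_
  exact indicator_nonpos (fun x hx => (hφ_neg x hx).le) _

theorem integrable_bump {φ : ℝ → ℝ} (hφ : IntegrableOn φ (Icc 0 1) volume) {ε : ℝ} (hε : 0 < ε) :
    Integrable (bump φ ε) := by
  unfold bump
  exact ((hφ.integrable_indicator measurableSet_Icc).comp_div hε.ne').const_mul ε

/-- The total mass of the perturbing profile. -/
noncomputable def mass (φ : ℝ → ℝ) : ℝ := -∫ s in (0 : ℝ)..1, φ s

theorem mass_pos {φ : ℝ → ℝ} (hφ : IntegrableOn φ (Icc 0 1) volume)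
    (hφ_neg : ∀ t ∈ Icc (0 : ℝ) 1, φ t < 0) : 0 < mass φ := by
  have hi : IntervalIntegrable φ volume 0 1 :=
    (intervalIntegrable_iff_integrableOn_Icc_of_le zero_le_one).2 hφ
  have := intervalIntegral.intervalIntegral_pos_of_pos_on (f := fun s => -φ s) (a := 0) (b := 1)
    hi.neg (fun s hs => by have := hφ_neg s ⟨hs.1.le, hs.2.le⟩; linarith) zero_lt_one
  rw [intervalIntegral.integral_neg] at this
  exact this

/-- One factor `ε` is the height of the bump and the other its width; `ε < 2 * π` keeps the support
inside the period. -/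
theorem integral_bump_mul {φ : ℝ → ℝ} {ε : ℝ} (hε : 0 < ε) (h2 : ε < 2 * π) (h : ℝ → ℝ) :
    ∫ t in (0 : ℝ)..2 * π, bump φ ε t * h t = ε ^ 2 * ∫ s in (0 : ℝ)..1, φ s * h (ε * s) := by
  have h1 : ∫ t in (0 : ℝ)..2 * π, bump φ ε t * h t = ∫ t, bump φ ε t * h t := by
    rw [intervalIntegral.integral_of_le (by positivity), ← integral_Icc_eq_integral_Ioc]
    apply setIntegral_eq_integral_of_forall_compl_eq_zero
    intro t ht
    have : bump φ ε t = 0 := by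
      unfold bump
      rw [indicator_of_notMem, mul_zero]
      rintro ⟨h3, h4⟩
      refine ht ⟨?_, ?_⟩
      · by_contra hc
        exact absurd h3 (not_le.2 (div_neg_of_neg_of_pos (not_le.1 hc) hε))
      · have := (div_le_one hε).1 h4
        linarith
    rw [this, zero_mul]
  have h3 : ∀ t, bump φ ε t * h t =
      (fun s => ε * ((Icc (0 : ℝ) 1).indicator (fun s => φ s * h (ε * s)) s)) (t / ε) := by
    intro t
    simp only [bump, mul_assoc]
    congr 1
    by_cases hs : t / ε ∈ Icc (0 : ℝ) 1
    · rw [indicator_of_mem hs, indicator_of_mem hs, mul_div_cancel₀ _ hε.ne']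
    · rw [indicator_of_notMem hs, indicator_of_notMem hs, zero_mul]
  rw [h1, integral_congr_ae (Eventually.of_forall h3),
    Measure.integral_comp_div (fun s => ε * ((Icc (0 : ℝ) 1).indicator (fun s => φ s * h (ε * s)) s)),
    integral_const_mul, integral_indicator measurableSet_Icc, integral_Icc_eq_integral_Ioc,
    ← intervalIntegral.integral_of_le zero_le_one, abs_of_pos hε, smul_eq_mul]
  ring

theorem integral_abs_bump {φ : ℝ → ℝ} (hφ_neg : ∀ t ∈ Icc (0 : ℝ) 1, φ t < 0) {ε : ℝ} (hε : 0 < ε)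
    (h2 : ε < 2 * π) : ∫ t in (0 : ℝ)..2 * π, |bump φ ε t| = ε ^ 2 * mass φ := by
  have := integral_bump_mul (φ := φ) hε h2 (fun _ => -1)
  simp only [mul_neg, mul_one, intervalIntegral.integral_neg] at this
  rw [mass, mul_neg, ← this, ← intervalIntegral.integral_neg]
  congr 1
  ext t
  rw [abs_of_nonpos (bump_nonpos hφ_neg hε t)]

/-- Since `φ` may be unbounded, all perturbation estimates go through its `L¹` mass. -/
theorem abs_integral_bump_mul_le {φ : ℝ → ℝ} (hφ : IntegrableOn φ (Icc 0 1) volume)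
    (hφ_neg : ∀ t ∈ Icc (0 : ℝ) 1, φ t < 0) {ε : ℝ} (hε : 0 < ε) (h2 : ε < 2 * π) {h : ℝ → ℝ}
    {B : ℝ} (hB : ∀ t, |h t| ≤ B) {a b : ℝ} (ha : a ∈ Icc 0 (2 * π)) (hb : b ∈ Icc 0 (2 * π)) :
    |∫ t in a..b, bump φ ε t * h t| ≤ ε ^ 2 * mass φ * B := by
  have hB0 : 0 ≤ B := (abs_nonneg _).trans (hB 0)
  wlog hab : a ≤ b generalizing a b
  · rw [intervalIntegral.integral_symm, abs_neg]
    exact this hb ha (le_of_not_ge hab)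
  have hi := (integrable_bump hφ hε).abs
  calc |∫ t in a..b, bump φ ε t * h t| ≤ ∫ t in a..b, |bump φ ε t| * B := by
        rw [← Real.norm_eq_abs]
        refine intervalIntegral.norm_integral_le_of_norm_le hab (Eventually.of_forall ?_)
          (hi.mul_const B).intervalIntegrable
        intro t _
        rw [norm_mul, Real.norm_eq_abs, Real.norm_eq_abs]
        exact mul_le_mul_of_nonneg_left (hB t) (abs_nonneg _)
    _ ≤ ∫ t in (0 : ℝ)..2 * π, |bump φ ε t| * B := by
        refine intervalIntegral.integral_mono_interval ha.1 hab hb.2 ?_ ?_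
        · exact Eventually.of_forall fun t => by positivity
        · exact (hi.mul_const B).intervalIntegrable
    _ = ε ^ 2 * mass φ * B := by
        rw [intervalIntegral.integral_mul_const, integral_abs_bump hφ_neg hε h2]

/-! ### Integration by parts -/

/-- Integration by parts for `G` that is only absolutely continuous: the potential is merely
integrable, so the derivative of an eigenfunction need not be differentiable everywhere. -/
theorem integral_mul_eq_of_integral_eq_sub {G h v v' : ℝ → ℝ} {T : ℝ}
    (hT : 0 ≤ T) (hi : IntervalIntegrable h volume 0 T)
    (hG : ∀ t ∈ Icc 0 T, G t - G 0 = ∫ s in (0 : ℝ)..t, h s)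
    (hv : ∀ t, HasDerivAt v (v' t) t) (hv' : ContinuousOn v' (Icc 0 T)) :
    ∫ t in (0 : ℝ)..T, h t * v t = G T * v T - G 0 * v 0 - ∫ t in (0 : ℝ)..T, G t * v' t := by
  have hH := hi.absolutelyContinuousOnInterval_intervalIntegral (c := 0) (by simp)
  have hvd : deriv v = v' := funext fun t => (hv t).deriv
  rw [← uIcc_of_le hT] at hv'
  have hvi : IntervalIntegrable v' volume 0 T := hv'.intervalIntegrable
  have hvac : AbsolutelyContinuousOnInterval v 0 T := by
    obtain ⟨K, hK⟩ := isCompact_uIcc.exists_bound_of_continuousOn hv'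
    refine (Convex.lipschitzOnWith_of_nnnorm_hasDerivWithin_le (C := K.toNNReal) (convex_uIcc 0 T)
      (fun t _ => (hv t).hasDerivWithinAt) fun t ht => ?_).absolutelyContinuousOnInterval
    rw [← NNReal.coe_le_coe]
    exact (hK t ht).trans (Real.le_coe_toNNReal K)
  have key := hH.integral_mul_deriv_eq_deriv_mul hvac
  have h1 : ∫ x in (0 : ℝ)..T, deriv (fun t => ∫ s in (0 : ℝ)..t, h s) x * v x =
      ∫ x in (0 : ℝ)..T, h x * v x := by
    apply intervalIntegral.integral_congr_ae
    filter_upwards [hi.ae_hasDerivAt_integral] with x hx hx2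
    rw [(hx (uIoc_subset_uIcc hx2) 0 (by simp)).deriv]
  have h2 : ∫ x in (0 : ℝ)..T, (∫ s in (0 : ℝ)..x, h s) * deriv v x =
      (∫ x in (0 : ℝ)..T, G x * v' x) - G 0 * (v T - v 0) := by
    have e : ∫ x in (0 : ℝ)..T, (∫ s in (0 : ℝ)..x, h s) * deriv v x =
       ∫ x in (0 : ℝ)..T, (G x * v' x - G 0 * v' x) := by
      apply intervalIntegral.integral_congr
      intro x hx
      rw [uIcc_of_le hT] at hx
      simp only [hvd]
      rw [← hG x hx]; ring
    have hGc : ContinuousOn G (uIcc 0 T) := by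
      have : ContinuousOn (fun t => G 0 + ∫ s in (0 : ℝ)..t, h s) (uIcc 0 T) :=
        continuousOn_const.add hH.continuousOn
      refine this.congr fun t ht => ?_
      rw [uIcc_of_le hT] at ht
      simp only [← hG t ht]; ring
    rw [e, intervalIntegral.integral_sub, intervalIntegral.integral_const_mul,
      intervalIntegral.integral_eq_sub_of_hasDerivAt (fun x _ => hv x) hvi]
    · exact (hGc.mul hv').intervalIntegrable
    · exact (continuousOn_const.mul hv').intervalIntegrable
  rw [h1, h2] at key
  rw [← hG T ⟨hT, le_rfl⟩] at key
  simp only [intervalIntegral.integral_same, zero_mul, sub_zero] at key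
  linarith

/-! ### Periodic solutions -/

/-- `g` is a `2π`-periodic solution of `g'' = (1 + bump φ ε - μ) g`, with derivative `g'`. -/
structure IsPeriodicSolution (φ : ℝ → ℝ) (ε μ : ℝ) (g g' : ℝ → ℝ) : Prop where
  hasDerivAt : ∀ t, HasDerivAt g (g' t) t
  periodic : Function.Periodic g (2 * π)
  sub_eq : ∀ a ∈ Icc 0 (2 * π), ∀ b ∈ Icc 0 (2 * π),
    g' b - g' a = ∫ t in a..b, (1 + bump φ ε t - μ) * g t

theorem periodic_coe {X : Type*} (u : Torus → X) :
    Function.Periodic (fun t : ℝ => u (t : Torus)) (2 * π) := fun t => by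
  simp only [AddCircle.coe_add_period]

theorem IsEigenfunction.exists_isPeriodicSolution {φ : ℝ → ℝ} {ε μ : ℝ} {u : C(Torus, ℝ)}
    (hε : 0 < ε) (hu : IsEigenfunction (bumpPotential φ 0 ε) μ u) :
    ∃ g', IsPeriodicSolution φ ε μ (fun t => u (t : Torus)) g' := by
  obtain ⟨-, g', hg, hint⟩ := hu
  refine ⟨g', hg, periodic_coe _, fun a ha b hb => ?_⟩
  rw [(hint a b).2]
  apply intervalIntegral.integral_congr_ae
  -- At `2 * π` the circle is back at `0`, so the potential and `1 + bump φ ε` can differ there;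
  -- this is a null set.
  have : ∀ᵐ t : ℝ, t ≠ 2 * π := by
    simp [ae_iff, measure_singleton]
  filter_upwards [this] with t ht hab
  have h2 : t ∈ Icc 0 (2 * π) := (uIcc_subset_Icc ha hb) (uIoc_subset_uIcc hab)
  rw [bumpPotential_zero_coe hε ⟨h2.1, lt_of_le_of_ne h2.2 ht⟩]

namespace IsPeriodicSolution

variable {φ : ℝ → ℝ} {ε μ : ℝ} {g g' : ℝ → ℝ}

theorem continuous (h : IsPeriodicSolution φ ε μ g g') : Continuous g :=
  continuous_iff_continuousAt.2 fun t => (h.hasDerivAt t).continuousAt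

theorem periodic_deriv (h : IsPeriodicSolution φ ε μ g g') : Function.Periodic g' (2 * π) := by
  intro t
  have h1 := (h.hasDerivAt (t + 2 * π)).comp_add_const t (2 * π)
  have h2 : (fun x => g (x + 2 * π)) = g := funext h.periodic
  rw [h2] at h1
  exact h1.unique (h.hasDerivAt t)

theorem intervalIntegrable_bump_mul (hφ : IntegrableOn φ (Icc 0 1) volume) (hε : 0 < ε)
    {f : ℝ → ℝ} (hf : Continuous f) (a b : ℝ) :
    IntervalIntegrable (fun t => bump φ ε t * f t) volume a b :=
  ((integrable_bump hφ hε).intervalIntegrable).mul_continuousOn hf.continuousOn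

theorem intervalIntegrable (hφ : IntegrableOn φ (Icc 0 1) volume) (hε : 0 < ε)
    (hf : Continuous g) (a b : ℝ) :
    IntervalIntegrable (fun t => (1 + bump φ ε t - μ) * g t) volume a b := by
  have := (intervalIntegrable_bump_mul hφ hε hf a b).add
    ((hf.const_mul (1 - μ)).intervalIntegrable a b)
  refine this.congr (fun t _ => ?_)
  ring

theorem integral_eq (hφ : IntegrableOn φ (Icc 0 1) volume) (hε : 0 < ε)
    (hf : Continuous g) (a b : ℝ) :
    ∫ t in a..b, (1 + bump φ ε t - μ) * g t =
      (∫ t in a..b, bump φ ε t * g t) + (1 - μ) * ∫ t in a..b, g t := by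
  rw [← intervalIntegral.integral_const_mul, ← intervalIntegral.integral_add
    (intervalIntegrable_bump_mul hφ hε hf a b) ((hf.const_mul (1 - μ)).intervalIntegrable a b)]
  congr 1
  ext t
  ring

/-- The weak form of the equation. -/
theorem weak_form (hφ : IntegrableOn φ (Icc 0 1) volume) (hε : 0 < ε)
    (h : IsPeriodicSolution φ ε μ g g') {v v' : ℝ → ℝ} (hv : ∀ t, HasDerivAt v (v' t) t)
    (hv' : ContinuousOn v' (Icc 0 (2 * π))) (hp : v (2 * π) = v 0) :
    (∫ t in (0 : ℝ)..2 * π, bump φ ε t * (g t * v t)) + (1 - μ) * ∫ t in (0 : ℝ)..2 * π, g t * v t =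
      - ∫ t in (0 : ℝ)..2 * π, g' t * v' t := by
  have hpi : 0 ≤ 2 * π := by positivity
  have hvc : Continuous v := continuous_iff_continuousAt.2 fun t => (hv t).continuousAt
  have h0 := integral_mul_eq_of_integral_eq_sub hpi (intervalIntegrable hφ hε h.continuous 0 (2 * π))
    (fun t ht => h.sub_eq 0 ⟨le_rfl, hpi⟩ t ht) hv hv'
  have h1 : g' (2 * π) = g' 0 := by simpa using h.periodic_deriv 0
  rw [h1, hp, sub_self, zero_sub] at h0
  rw [← h0, ← integral_eq (g := fun t => g t * v t) hφ hε (h.continuous.mul hvc)]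
  congr 1
  ext t
  ring

theorem continuousOn_deriv (hφ : IntegrableOn φ (Icc 0 1) volume) (hε : 0 < ε)
    (h : IsPeriodicSolution φ ε μ g g') : ContinuousOn g' (Icc 0 (2 * π)) := by
  have hpi : 0 ≤ 2 * π := by positivity
  have hH := ((intervalIntegrable hφ hε h.continuous 0 (2 * π)
    (μ := μ)).absolutelyContinuousOnInterval_intervalIntegral (c := 0) (by simp)).continuousOn
  rw [uIcc_of_le hpi] at hH
  refine (hH.const_add (g' 0)).congr fun t ht => ?_
  simp only [← h.sub_eq 0 ⟨le_rfl, hpi⟩ t ht]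
  ring

/-- Testing the equation against an eigenfunction of the unperturbed operator. -/
theorem test_eq (hφ : IntegrableOn φ (Icc 0 1) volume) (hε : 0 < ε) (h2 : ε < 2 * π)
    (h : IsPeriodicSolution φ ε μ g g') {v v' : ℝ → ℝ} {κ : ℝ} (hv : ∀ t, HasDerivAt v (v' t) t)
    (hv' : ∀ t, HasDerivAt v' (-κ * v t) t) (hp : v (2 * π) = v 0) (hp' : v' (2 * π) = v' 0) :
    (1 + κ - μ) * ∫ t in (0 : ℝ)..2 * π, g t * v t =
      ε ^ 2 * ∫ s in (0 : ℝ)..1, -φ s * (g (ε * s) * v (ε * s)) := by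
  have hvc : Continuous v := continuous_iff_continuousAt.2 fun t => (hv t).continuousAt
  have hvc' : Continuous v' := continuous_iff_continuousAt.2 fun t => (hv' t).continuousAt
  have w := h.weak_form hφ hε hv hvc'.continuousOn hp
  have hpi : 0 ≤ 2 * π := by positivity
  -- A second integration by parts moves the remaining derivative onto `v'`, whose derivative is `-κ
  -- * v`.
  have ibp := intervalIntegral.integral_mul_deriv_eq_deriv_mul (a := 0) (b := 2 * π)
    (u := g) (v := v') (fun t _ => h.hasDerivAt t) (fun t _ => hv' t)
    ((h.continuousOn_deriv hφ hε).intervalIntegrable_of_Icc hpi)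
    ((hvc.const_mul (-κ)).intervalIntegrable _ _)
  have e : ∫ x in (0 : ℝ)..2 * π, g x * (-κ * v x) = -κ * ∫ x in (0 : ℝ)..2 * π, g x * v x := by
    rw [← intervalIntegral.integral_const_mul]
    congr 1; ext t; ring
  have hg : g (2 * π) = g 0 := by simpa using h.periodic 0
  rw [e, hg, hp', sub_self, zero_sub] at ibp
  rw [integral_bump_mul hε h2 (fun t => g t * v t)] at w
  have e2 : ∫ s in (0 : ℝ)..1, -φ s * (g (ε * s) * v (ε * s)) =
      - ∫ s in (0 : ℝ)..1, φ s * (g (ε * s) * v (ε * s)) := by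
    rw [← intervalIntegral.integral_neg]
    congr 1; ext t; ring
  rw [e2]
  linarith

/-- Solutions for distinct eigenvalues are orthogonal. -/
theorem integral_mul_eq_zero (hφ : IntegrableOn φ (Icc 0 1) volume) (hε : 0 < ε)
    {μ₁ μ₂ : ℝ} {g₁ g₁' g₂ g₂' : ℝ → ℝ} (h₁ : IsPeriodicSolution φ ε μ₁ g₁ g₁')
    (h₂ : IsPeriodicSolution φ ε μ₂ g₂ g₂') (hμ : μ₁ ≠ μ₂) :
    ∫ t in (0 : ℝ)..2 * π, g₁ t * g₂ t = 0 := by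
  have w₁ := h₁.weak_form hφ hε h₂.hasDerivAt (h₂.continuousOn_deriv hφ hε)
    (by simpa using h₂.periodic 0)
  have w₂ := h₂.weak_form hφ hε h₁.hasDerivAt (h₁.continuousOn_deriv hφ hε)
    (by simpa using h₁.periodic 0)
  simp only [mul_comm (g₂ _), mul_comm (g₂' _)] at w₂
  have : (μ₁ - μ₂) * ∫ t in (0 : ℝ)..2 * π, g₁ t * g₂ t = 0 := by linarith
  exact (mul_eq_zero.1 this).resolve_left (sub_ne_zero.2 hμ)

/-- Because `g'` has mean zero, this oscillation bound controls `g'` itself, uniformly in `g`;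
compactness of the eigenfunctions rests on it. -/
theorem abs_deriv_sub_le (hφ : IntegrableOn φ (Icc 0 1) volume)
    (hφ_neg : ∀ t ∈ Icc (0 : ℝ) 1, φ t < 0) (hε : 0 < ε) (h2 : ε < 2 * π)
    (h : IsPeriodicSolution φ ε μ g g') (hg : ∀ t, |g t| ≤ 1) {a b : ℝ}
    (ha : a ∈ Icc 0 (2 * π)) (hb : b ∈ Icc 0 (2 * π)) :
    |g' b - g' a| ≤ |1 - μ| * |b - a| + ε ^ 2 * mass φ := by
  rw [h.sub_eq a ha b hb, integral_eq hφ hε h.continuous]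
  have h1 := abs_integral_bump_mul_le hφ hφ_neg hε h2 hg ha hb
  have h3 : |∫ t in a..b, g t| ≤ 1 * |b - a| := by
    rw [← Real.norm_eq_abs]
    exact    intervalIntegral.norm_integral_le_of_norm_le_const fun t _ => hg t
  refine (abs_add_le _ _).trans ?_
  rw [abs_mul]
  nlinarith [abs_nonneg (1 - μ)]

theorem integral_deriv_eq_zero (hφ : IntegrableOn φ (Icc 0 1) volume) (hε : 0 < ε)
    (h : IsPeriodicSolution φ ε μ g g') : ∫ t in (0 : ℝ)..2 * π, g' t = 0 := by
  rw [intervalIntegral.integral_eq_sub_of_hasDerivAt (fun t _ => h.hasDerivAt t)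
    ((h.continuousOn_deriv hφ hε).intervalIntegrable_of_Icc (by positivity))]
  simpa [sub_eq_zero] using h.periodic 0

end IsPeriodicSolution

/-- A function of mean zero on the period whose oscillation is at most `η` is at most `η`. -/
theorem abs_le_of_integral_eq_zero {f : ℝ → ℝ} {η : ℝ} (hc : ContinuousOn f (Icc 0 (2 * π)))
    (hi : ∫ t in (0 : ℝ)..2 * π, f t = 0)
    (ho : ∀ a ∈ Icc 0 (2 * π), ∀ b ∈ Icc 0 (2 * π), |f b - f a| ≤ η) :
    ∀ t ∈ Icc 0 (2 * π), |f t| ≤ η := by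
  intro t ht
  have hpi : 0 < 2 * π := by positivity
  have h1 : ∫ s in (0 : ℝ)..2 * π, (f s - f t) = -(2 * π * f t) := by
    rw [intervalIntegral.integral_sub (hc.intervalIntegrable_of_Icc hpi.le) (by simp), hi]
    simp
  have h2 : |∫ s in (0 : ℝ)..2 * π, (f s - f t)| ≤ η * |2 * π - 0| := by
    rw [← Real.norm_eq_abs]
    refine intervalIntegral.norm_integral_le_of_norm_le_const fun s hs => ?_
    rw [uIoc_of_le hpi.le] at hs
    exact ho t ht s ⟨hs.1.le, hs.2⟩
  rw [h1, abs_neg, abs_mul, sub_zero, abs_of_pos hpi] at h2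
  nlinarith

/-! ### Compactness and trigonometric polynomials -/

theorem exists_coe_eq (x : Torus) : ∃ t ∈ Ico 0 (2 * π), ((t : ℝ) : Torus) = x :=
  AddCircle.eq_coe_Ico x

theorem exists_abs_eq_norm (u : C(Torus, ℝ)) : ∃ t ∈ Ico 0 (2 * π), |u (t : Torus)| = ‖u‖ := by
  obtain ⟨x, -, hx⟩ := isCompact_univ.exists_isMaxOn univ_nonempty
    (f := fun x => ‖u x‖) (by fun_prop)
  obtain ⟨t, ht, rfl⟩ := exists_coe_eq x
  refine ⟨t, ht, le_antisymm (u.norm_coe_le_norm _) ?_⟩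
  exact (ContinuousMap.norm_le _ (abs_nonneg _)).2 fun y => hx (mem_univ y)

/-- Arzelà–Ascoli, transported from bounded continuous functions; a common Lipschitz constant for
the lifts gives equicontinuity on the circle. -/
theorem exists_isCompact_of_lipschitz (L : ℝ) : ∃ S : Set C(Torus, ℝ), IsCompact S ∧
    ∀ u : C(Torus, ℝ), ‖u‖ ≤ 1 → (∀ s t : ℝ, |u (s : Torus) - u (t : Torus)| ≤ L * |s - t|) →
      u ∈ S := by
  let e := ContinuousMap.isometryEquivBoundedOfCompact Torus ℝ
  let A : Set C(Torus, ℝ) := {u | ‖u‖ ≤ 1 ∧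
    ∀ s t : ℝ, |u (s : Torus) - u (t : Torus)| ≤ L * |s - t|}
  have hA : IsCompact (closure (e '' A)) := by
    refine BoundedContinuousFunction.arzela_ascoli (Icc (-1) 1) isCompact_Icc _ ?_ ?_
    · rintro _ x ⟨u, hu, rfl⟩
      exact abs_le.1 ((u.norm_coe_le_norm x).trans hu.1)
    · intro x
      obtain ⟨s, -, rfl⟩ := exists_coe_eq x
      rw [Metric.equicontinuousAt_iff_right]
      intro ε hε
      -- The quotient map is open and continuous, so neighbourhoods on the circle can be tested on
      -- the line.
      have hn : 𝓝 ((s : ℝ) : Torus) = map (fun t : ℝ => (t : Torus)) (𝓝 s) :=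
        (QuotientAddGroup.isOpenQuotientMap_mk.map_nhds_eq s).symm
      rw [hn, eventually_map]
      have : Tendsto (fun t => L * |s - t|) (𝓝 s) (𝓝 (L * |s - s|)) :=
        ((continuous_const.sub continuous_id).abs.const_mul L).tendsto s
      rw [sub_self, abs_zero, mul_zero] at this
      filter_upwards [this.eventually_lt_const hε] with t ht
      rintro ⟨_, u, hu, rfl⟩
      exact (hu.2 s t).trans_lt ht
  refine ⟨e.symm '' closure (e '' A), hA.image e.symm.continuous, fun u h1 h2 => ?_⟩
  exact ⟨e u, subset_closure ⟨u, ⟨h1, h2⟩, rfl⟩, e.symm_apply_apply u⟩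

theorem fourierCoeff_ofReal_eq_zero (U : C(Torus, ℝ)) (n : ℤ)
    (hc : ∫ t in (0 : ℝ)..2 * π, U (t : Torus) * cos (n * t) = 0)
    (hs : ∫ t in (0 : ℝ)..2 * π, U (t : Torus) * sin (n * t) = 0) :
    fourierCoeff (fun x : Torus => (U x : ℂ)) n = 0 := by
  rw [fourierCoeff_eq_intervalIntegral _ n 0]
  have hUc : Continuous fun t : ℝ => U (t : Torus) :=
    U.continuous.comp (AddCircle.continuous_mk' _)
  have : ∀ t : ℝ, fourier (-n) (t : Torus) • (U (t : Torus) : ℂ) =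
      ((U (t : Torus) * cos (n * t) : ℝ) : ℂ) - Complex.I * ((U (t : Torus) * sin (n * t) : ℝ) : ℂ) := by
    intro t
    rw [fourier_coe_apply]
    have h1 : 2 * (π : ℂ) * Complex.I * ((-n : ℤ) : ℂ) * t / ((2 * π : ℝ) : ℂ) =
        (((-(n * t) : ℝ)) : ℂ) * Complex.I := by
      have : (π : ℂ) ≠ 0 := by exact_mod_cast pi_ne_zero
      push_cast
      field_simp
    rw [h1, Complex.exp_mul_I, ← Complex.ofReal_cos, ← Complex.ofReal_sin, cos_neg, sin_neg]
    push_cast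
    rw [smul_eq_mul]
    ring
  simp_rw [this]
  rw [intervalIntegral.integral_sub, intervalIntegral.integral_const_mul,
    intervalIntegral.integral_ofReal, intervalIntegral.integral_ofReal, zero_add, hc, hs]
  · simp
  · exact (Complex.continuous_ofReal.comp (by fun_prop)).intervalIntegrable _ _
  · exact (continuous_const.mul (Complex.continuous_ofReal.comp (by fun_prop))).intervalIntegrable _ _

/-- Only the Fourier coefficients at `±m` survive, so they are summable and the Fourier series, now
a finite sum, equals `U` pointwise. -/
theorem exists_eq_cos_add_sin (U : C(Torus, ℝ)) (m : ℕ)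
    (h : ∀ n : ℕ, n ≠ m → ∫ t in (0 : ℝ)..2 * π, U (t : Torus) * cos (n * t) = 0 ∧
      ∫ t in (0 : ℝ)..2 * π, U (t : Torus) * sin (n * t) = 0) :
    ∃ a b : ℝ, ∀ t : ℝ, U (t : Torus) = a * cos (m * t) + b * sin (m * t) := by
  let F : C(Torus, ℂ) := ⟨fun x => (U x : ℂ), by fun_prop⟩
  have hz : ∀ n : ℤ, n ∉ ({(m : ℤ), -(m : ℤ)} : Finset ℤ) → fourierCoeff F n = 0 := by
    intro n hn
    simp only [Finset.mem_insert, Finset.mem_singleton, not_or] at hn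
    have hm : n.natAbs ≠ m := by omega
    obtain ⟨h1, h2⟩ := h _ hm
    apply fourierCoeff_ofReal_eq_zero
    all_goals
      rcases Int.natAbs_eq n with h3 | h3
    · rw [h3]; simpa only [Int.cast_natCast] using h1
    · rw [h3]; simpa using h1
    · rw [h3]; simpa only [Int.cast_natCast] using h2
    · rw [h3]; simpa using h2
  have hs : Summable (fourierCoeff F) := summable_of_ne_finset_zero hz
  have key : ∀ t : ℝ, (U (t : Torus) : ℂ) =
      ∑ n ∈ ({(m : ℤ), -(m : ℤ)} : Finset ℤ), fourierCoeff F n • fourier n (t : Torus) := by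
    intro t
    refine (has_pointwise_sum_fourier_series_of_summable hs (t : Torus)).unique
      (hasSum_sum_of_ne_finset_zero fun n hn => ?_)
    rw [hz n hn, zero_smul]
  have hterm : ∀ n : ℤ, ∀ t : ℝ, (fourierCoeff F n • fourier n (t : Torus)).re =
      (fourierCoeff F n).re * cos (n * t) - (fourierCoeff F n).im * sin (n * t) := by
    intro n t
    have h1 : 2 * (π : ℂ) * Complex.I * (n : ℂ) * t / ((2 * π : ℝ) : ℂ) =
        ((n * t : ℝ) : ℂ) * Complex.I := by
      have : (π : ℂ) ≠ 0 := by exact_mod_cast pi_ne_zero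
      push_cast
      field_simp
    rw [fourier_coe_apply, h1, Complex.exp_mul_I, ← Complex.ofReal_cos, ← Complex.ofReal_sin]
    simp only [smul_eq_mul, Complex.mul_re, Complex.mul_im, Complex.add_re, Complex.add_im,
      Complex.ofReal_re, Complex.ofReal_im, Complex.I_re, Complex.I_im]
    ring
  -- For `m = 0` the frequencies `m` and `-m` coincide and the sum has one term instead of two.
  by_cases hm : m = 0
  · subst hm
    refine ⟨(fourierCoeff F 0).re, 0, fun t => ?_⟩
    have := congrArg Complex.re (key t)
    simp only [Nat.cast_zero, neg_zero, Finset.insert_eq_of_mem, Finset.mem_singleton,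
      Finset.sum_singleton, hterm] at this
    simpa using this
  · refine ⟨(fourierCoeff F m).re + (fourierCoeff F (-m)).re,
      -(fourierCoeff F m).im + (fourierCoeff F (-m)).im, fun t => ?_⟩
    have := congrArg Complex.re (key t)
    rw [Finset.sum_pair (by omega), Complex.add_re, hterm, hterm] at this
    simp only [Complex.ofReal_re, Int.cast_neg, Int.cast_natCast, neg_mul, cos_neg, sin_neg] at this
    rw [this]
    ring

theorem eq_zero_of_integral_eq_zero (U : C(Torus, ℝ))
    (h : ∀ n : ℕ, ∫ t in (0 : ℝ)..2 * π, U (t : Torus) * cos (n * t) = 0 ∧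
      ∫ t in (0 : ℝ)..2 * π, U (t : Torus) * sin (n * t) = 0) : U = 0 := by
  obtain ⟨a, b, hab⟩ := exists_eq_cos_add_sin U 0 fun n _ => h n
  have h0 := (h 0).1
  simp only [hab] at h0
  simp only [Nat.cast_zero, zero_mul, cos_zero, sin_zero, mul_one, mul_zero, add_zero,
    intervalIntegral.integral_const, sub_zero, smul_eq_mul, mul_eq_zero, OfNat.ofNat_ne_zero,
    pi_ne_zero, false_or, or_self] at h0
  ext x
  obtain ⟨t, -, rfl⟩ := exists_coe_eq x
  simp [hab, h0]

/-! ### The trigonometric test functions and their integrals -/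

/-- `sin (m t)` or `cos (m t)`, according to `s`. -/
noncomputable def trig (s : Bool) (m : ℕ) (t : ℝ) : ℝ := bif s then sin (m * t) else cos (m * t)

/-- The derivative of `trig s m`. -/
noncomputable def trigDeriv (s : Bool) (m : ℕ) (t : ℝ) : ℝ :=
  bif s then m * cos (m * t) else -(m * sin (m * t))

theorem hasDerivAt_trig (s : Bool) (m : ℕ) (t : ℝ) : HasDerivAt (trig s m) (trigDeriv s m t) t := by
  have h : HasDerivAt (fun t : ℝ => (m : ℝ) * t) m t := by
    simpa using (hasDerivAt_id t).const_mul (m : ℝ)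
  cases s
  · convert! h.cos using 1
    simp only [trigDeriv, cond_false]; ring
  · convert! h.sin using 1
    simp only [trigDeriv, cond_true]; ring

theorem hasDerivAt_trigDeriv (s : Bool) (m : ℕ) (t : ℝ) :
    HasDerivAt (trigDeriv s m) (-((m : ℝ) ^ 2) * trig s m t) t := by
  have h : HasDerivAt (fun t : ℝ => (m : ℝ) * t) m t := by
    simpa using (hasDerivAt_id t).const_mul (m : ℝ)
  cases s
  · convert! (h.sin.const_mul (m : ℝ)).neg using 1
    simp only [trig, cond_false]; ring
  · convert! h.cos.const_mul (m : ℝ) using 1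
    simp only [trig, cond_true]; ring

theorem continuous_trig (s : Bool) (m : ℕ) : Continuous (trig s m) :=
  continuous_iff_continuousAt.2 fun t => (hasDerivAt_trig s m t).continuousAt

theorem continuous_trigDeriv (s : Bool) (m : ℕ) : Continuous (trigDeriv s m) :=
  continuous_iff_continuousAt.2 fun t => (hasDerivAt_trigDeriv s m t).continuousAt

theorem trig_periodic (s : Bool) (m : ℕ) : Function.Periodic (trig s m) (2 * π) := by
  intro t
  cases s
  · simp [trig, mul_add, cos_add_nat_mul_two_pi]
  · simp [trig, mul_add, sin_add_nat_mul_two_pi]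

theorem trigDeriv_periodic (s : Bool) (m : ℕ) : Function.Periodic (trigDeriv s m) (2 * π) := by
  intro t
  cases s
  · simp [trigDeriv, mul_add, sin_add_nat_mul_two_pi]
  · simp [trigDeriv, mul_add, cos_add_nat_mul_two_pi]

theorem abs_trig_le_one (s : Bool) (m : ℕ) (t : ℝ) : |trig s m t| ≤ 1 := by
  cases s
  · exact abs_cos_le_one _
  · exact abs_sin_le_one _

theorem sin_nat_two_pi (m : ℕ) : sin ((m : ℝ) * (2 * π)) = 0 := by
  simpa using sin_add_nat_mul_two_pi 0 m

theorem integral_cos_mul_cos {m : ℕ} (hm : m ≠ 0) :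
    ∫ t in (0 : ℝ)..2 * π, cos (m * t) * cos (m * t) = π := by
  have hm' : (m : ℝ) ≠ 0 := by exact_mod_cast hm
  have := intervalIntegral.integral_comp_mul_left (a := 0) (b := 2 * π)
    (fun t => cos t ^ 2) hm'
  simp only [pow_two] at this
  rw [this]
  have h2 : ∫ x in (m : ℝ) * 0..m * (2 * π), cos x * cos x = m * π := by
    simp_rw [← pow_two]
    rw [integral_cos_sq]
    simp only [mul_zero, sin_nat_two_pi, sin_zero]
    ring
  rw [h2, smul_eq_mul]
  field_simp

theorem integral_sin_mul_sin {m : ℕ} (hm : m ≠ 0) :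
    ∫ t in (0 : ℝ)..2 * π, sin (m * t) * sin (m * t) = π := by
  have h1 : ∀ t : ℝ, sin (m * t) * sin (m * t) = 1 - cos (m * t) * cos (m * t) := by
    intro t
    nlinarith [sin_sq_add_cos_sq (m * t)]
  simp_rw [h1]
  rw [intervalIntegral.integral_sub (by simp)
    ((by fun_prop : Continuous fun t : ℝ => cos (m * t) * cos (m * t)).intervalIntegrable _ _),
    integral_cos_mul_cos hm]
  simp
  ring

theorem integral_cos_mul_sin {m : ℕ} (hm : m ≠ 0) :
    ∫ t in (0 : ℝ)..2 * π, cos (m * t) * sin (m * t) = 0 := by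
  have hm' : (m : ℝ) ≠ 0 := by exact_mod_cast hm
  have := intervalIntegral.integral_comp_mul_left (a := 0) (b := 2 * π)
    (fun t => sin t * cos t) hm'
  simp only [mul_comm (cos _)]
  rw [this, integral_sin_mul_cos₁]
  simp [sin_nat_two_pi]

/-! ### Classification of the normalised eigenfunctions for small `ε` -/

/-- Energy argument. If `μ ≤ 0`, testing the equation with `g` gives `∫ g² + ∫ g'² ≤ 1/2`. Since
`|(g²)'| ≤ g² + g'²`, the function `g²`, with maximum `1`, stays at least `1/2`, and its integral is
then at least `π`. -/
theorem IsEigenfunction.pos {φ : ℝ → ℝ} (hφ : IntegrableOn φ (Icc 0 1) volume)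
    (hφ_neg : ∀ t ∈ Icc (0 : ℝ) 1, φ t < 0) {ε μ : ℝ} (hε : 0 < ε) (h2 : ε < 2 * π)
    (hm : ε ^ 2 * mass φ ≤ 1 / 2) {u : C(Torus, ℝ)}
    (hu : IsEigenfunction (bumpPotential φ 0 ε) μ u) (h1 : ‖u‖ = 1) : 0 < μ := by
  obtain ⟨g', hg⟩ := hu.exists_isPeriodicSolution hε
  set g : ℝ → ℝ := fun t => u (t : Torus) with hgdef
  have hb : ∀ t, |g t| ≤ 1 := fun t => h1 ▸ u.norm_coe_le_norm _
  by_contra! hμ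
  have hpi : 0 < 2 * π := by positivity
  have hgc := hg.continuous
  have hgc' := hg.continuousOn_deriv hφ hε
  have w := hg.weak_form hφ hε hg.hasDerivAt hgc' (by simpa using hg.periodic 0)
  have hb2 := abs_integral_bump_mul_le hφ hφ_neg hε h2 (h := fun t => g t * g t) (B := 1)
    (fun t => by rw [abs_mul]; nlinarith [hb t, abs_nonneg (g t)]) (a := 0) (b := 2 * π)
    ⟨le_rfl, hpi.le⟩ ⟨hpi.le, le_rfl⟩
  have hG : 0 ≤ ∫ t in (0 : ℝ)..2 * π, g t * g t :=
    intervalIntegral.integral_nonneg hpi.le fun t _ => mul_self_nonneg _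
  have hi1 : IntervalIntegrable (fun t => g t * g t) volume 0 (2 * π) :=
    (hgc.mul hgc).intervalIntegrable _ _
  have hc2 : ContinuousOn (fun t => g' t * g' t) (Icc 0 (2 * π)) := hgc'.mul hgc'
  have hi2 : IntervalIntegrable (fun t => g' t * g' t) volume 0 (2 * π) :=
    hc2.intervalIntegrable_of_Icc hpi.le
  have hsum : (∫ t in (0 : ℝ)..2 * π, g t * g t) + ∫ t in (0 : ℝ)..2 * π, g' t * g' t ≤ 1 / 2 := by
    have := (abs_le.1 hb2).1
    nlinarith
  rw [← intervalIntegral.integral_add hi1 hi2] at hsum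
  have hci : ContinuousOn (fun t => 2 * (g t * g' t)) (Icc 0 (2 * π)) :=
    (hgc.continuousOn.mul hgc').const_mul 2
  have osc : ∀ a ∈ Icc 0 (2 * π), ∀ b ∈ Icc 0 (2 * π), a ≤ b → |g b ^ 2 - g a ^ 2| ≤ 1 / 2 := by
    intro a ha b hb hab
    have hs : uIcc a b ⊆ Icc 0 (2 * π) := uIcc_subset_Icc ha hb
    have e : ∫ t in a..b, 2 * (g t * g' t) = g b ^ 2 - g a ^ 2 := by
      apply intervalIntegral.integral_eq_sub_of_hasDerivAt (f := fun t => g t ^ 2)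
      · intro t _
        convert! (hg.hasDerivAt t).pow 2 using 1
        simp; ring
      · exact (hci.mono hs).intervalIntegrable
    rw [← e, ← Real.norm_eq_abs]
    refine (intervalIntegral.norm_integral_le_of_norm_le hab
      (g := fun t => g t * g t + g' t * g' t) (Eventually.of_forall fun t _ => ?_) ?_).trans ?_
    · rw [Real.norm_eq_abs, abs_le]
      constructor <;> nlinarith [sq_nonneg (g t + g' t), sq_nonneg (g t - g' t)]
    · exact (((hgc.mul hgc).continuousOn.add hc2).mono hs).intervalIntegrable
    · refine le_trans ?_ hsum
      exact intervalIntegral.integral_mono_interval ha.1 hab hb.2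
        (Eventually.of_forall fun t => add_nonneg (mul_self_nonneg _) (mul_self_nonneg _))
        (hi1.add hi2)
  obtain ⟨t₀, ht₀, hmax⟩ := exists_abs_eq_norm u
  rw [h1] at hmax
  have hmax2 : g t₀ ^ 2 = 1 := by rw [← sq_abs]; simp [hgdef, hmax]
  have ht₀' : t₀ ∈ Icc 0 (2 * π) := ⟨ht₀.1, ht₀.2.le⟩
  have hlow : ∀ t ∈ Icc 0 (2 * π), 1 / 2 ≤ g t * g t + g' t * g' t := by
    intro t ht
    have : |g t ^ 2 - g t₀ ^ 2| ≤ 1 / 2 := by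
      rcases le_total t t₀ with h | h
      · rw [abs_sub_comm]; exact osc t ht t₀ ht₀' h
      · exact osc t₀ ht₀' t ht h
    nlinarith [(abs_le.1 this).1, sq_nonneg (g' t)]
  have := intervalIntegral.integral_mono_on hpi.le (f := fun _ => (1 / 2 : ℝ)) (by simp)
    (hi1.add hi2) hlow
  rw [intervalIntegral.integral_const] at this
  simp only [sub_zero, smul_eq_mul] at this
  nlinarith [pi_gt_three]

/-- The eigenvalue `μ` is within `η` of `1 + m²`, it is shifted by approximately `ε² mass φ / π`
(for `s = false`) or `0` (for `s = true`), and `u` is, up to a sign, `η`-close in `C¹` to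
`trig s m`. -/
structure IsCloseTo (φ : ℝ → ℝ) (ε η μ : ℝ) (u : C(Torus, ℝ)) (s : Bool) (m : ℕ) : Prop where
  ne_zero : s = true → m ≠ 0
  abs_sub_lt : |μ - (1 + (m : ℝ) ^ 2)| < η
  shift : m ≠ 0 → |(1 + (m : ℝ) ^ 2 - μ) / ε ^ 2 - bif s then 0 else mass φ / π| < η
  exists_sign : ∃ σ : ℝ, (σ = 1 ∨ σ = -1) ∧ (∀ t : ℝ, |σ * u (t : Torus) - trig s m t| < η) ∧
    ∀ g' : ℝ → ℝ, (∀ t : ℝ, HasDerivAt (fun s : ℝ => u (s : Torus)) (g' t) t) →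
      ∀ t, |σ * g' t - trigDeriv s m t| < η

/-- After rescaling the bump sees only the values at the origin, where the sine vanishes; this
asymmetry separates the two types. Dominated convergence applies with majorant `|φ|`. -/
theorem tendsto_scaled_integral {φ : ℝ → ℝ} (hφ : IntegrableOn φ (Icc 0 1) volume)
    {u : ℕ → C(Torus, ℝ)} {U : C(Torus, ℝ)} (hu : Tendsto u atTop (𝓝 U)) (h1 : ∀ n, ‖u n‖ = 1)
    {e : ℕ → ℝ} (he : Tendsto e atTop (𝓝 0)) (s : Bool) (m : ℕ) :
    Tendsto (fun n => ∫ r in (0 : ℝ)..1, -φ r * (u n ((e n * r : ℝ) : Torus) * trig s m (e n * r)))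
      atTop (𝓝 (mass φ * (U ((0 : ℝ) : Torus) * trig s m 0))) := by
  have hi : IntervalIntegrable φ volume 0 1 :=
    (intervalIntegrable_iff_integrableOn_Icc_of_le zero_le_one).2 hφ
  have hlim : mass φ * (U ((0 : ℝ) : Torus) * trig s m 0) =
      ∫ r in (0 : ℝ)..1, -φ r * (U ((0 : ℝ) : Torus) * trig s m 0) := by
    rw [intervalIntegral.integral_mul_const, intervalIntegral.integral_neg, mass]
  rw [hlim]
  refine intervalIntegral.tendsto_integral_filter_of_dominated_convergence (fun r => |φ r|) ?_ ?_
    hi.abs ?_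
  · refine Eventually.of_forall fun n => ?_
    refine AEStronglyMeasurable.mul ?_ ?_
    · rw [uIoc_of_le zero_le_one]; exact hi.1.aestronglyMeasurable.neg
    · have h := continuous_trig s m
      have h' : Continuous fun r : ℝ => u n ((e n * r : ℝ) : Torus) :=
        (u n).continuous.comp ((AddCircle.continuous_mk' _).comp (continuous_const.mul continuous_id))
      exact (h'.mul (h.comp (continuous_const.mul continuous_id))).aestronglyMeasurable
  · refine Eventually.of_forall fun n => Eventually.of_forall fun r _ => ?_
    rw [norm_mul, norm_neg, norm_mul, Real.norm_eq_abs (trig _ _ _), Real.norm_eq_abs (φ r)]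
    have h3 := (u n).norm_coe_le_norm ((e n * r : ℝ) : Torus)
    rw [h1] at h3
    have h4 := abs_trig_le_one s m (e n * r)
    have : ‖u n ((e n * r : ℝ) : Torus)‖ * |trig s m (e n * r)| ≤ 1 := by
      nlinarith [abs_nonneg (trig s m (e n * r)), norm_nonneg (u n ((e n * r : ℝ) : Torus))]
    nlinarith [abs_nonneg (φ r)]
  · refine Eventually.of_forall fun r _ => ?_
    have hr : Tendsto (fun n => e n * r) atTop (𝓝 0) := by simpa using he.mul_const r
    refine Tendsto.const_mul _ (Tendsto.mul ?_ (((continuous_trig s m).tendsto 0).comp hr))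
    have hc : Continuous fun p : C(Torus, ℝ) × Torus => p.1 p.2 := by fun_prop
    exact (hc.tendsto (U, ((0 : ℝ) : Torus))).comp
      (hu.prodMk_nhds (((AddCircle.continuous_mk' (2 * π)).tendsto 0).comp hr))

theorem tendsto_integral_trig {u : ℕ → C(Torus, ℝ)} {U : C(Torus, ℝ)}
    (hu : Tendsto u atTop (𝓝 U)) (s : Bool) (m : ℕ) :
    Tendsto (fun n => ∫ t in (0 : ℝ)..2 * π, u n (t : Torus) * trig s m t) atTop
      (𝓝 (∫ t in (0 : ℝ)..2 * π, U (t : Torus) * trig s m t)) := by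
  have hc : Continuous fun p : C(Torus, ℝ) × ℝ => p.1 (p.2 : Torus) * trig s m p.2 := by
    have := continuous_trig s m
    have h2 : Continuous fun t : ℝ => (t : Torus) := AddCircle.continuous_mk' _
    fun_prop
  exact ((intervalIntegral.continuous_parametric_intervalIntegral_of_continuous'
    (f := fun (v : C(Torus, ℝ)) t => v (t : Torus) * trig s m t) hc 0 (2 * π)).tendsto U).comp hu

/-- `C⁰`-closeness of the eigenfunction and closeness of the eigenvalue imply
`C¹`-closeness. -/
theorem IsPeriodicSolution.abs_deriv_sub_trigDeriv_le {φ : ℝ → ℝ}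
    (hφ : IntegrableOn φ (Icc 0 1) volume) (hφ_neg : ∀ t ∈ Icc (0 : ℝ) 1, φ t < 0) {ε μ : ℝ}
    (hε : 0 < ε) (h2 : ε < 2 * π) {g g' : ℝ → ℝ} (h : IsPeriodicSolution φ ε μ g g')
    (hg : ∀ t, |g t| ≤ 1) {s : Bool} {m : ℕ} {η σ : ℝ} (hσ : σ = 1 ∨ σ = -1)
    (hμ : |μ - (1 + (m : ℝ) ^ 2)| ≤ η) (hu : ∀ t, |σ * g t - trig s m t| ≤ η) (t : ℝ) :
    |σ * g' t - trigDeriv s m t| ≤ 2 * π * (1 + (m : ℝ) ^ 2) * η + ε ^ 2 * mass φ := by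
  have hpi : 0 < 2 * π := by positivity
  have hσ1 : |σ| = 1 := by rcases hσ with rfl | rfl <;> simp
  have hη : 0 ≤ η := (abs_nonneg _).trans hμ
  set f : ℝ → ℝ := fun t => σ * g' t - trigDeriv s m t with hf
  have hfp : Function.Periodic f (2 * π) := fun t => by
    simp only [hf, h.periodic_deriv t, trigDeriv_periodic s m t]
  have hfc : ContinuousOn f (Icc 0 (2 * π)) :=
    ((h.continuousOn_deriv hφ hε).const_mul σ).sub (continuous_trigDeriv s m).continuousOn
  suffices ∀ t ∈ Icc 0 (2 * π), |f t| ≤ 2 * π * (1 + (m : ℝ) ^ 2) * η + ε ^ 2 * mass φ by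
    obtain ⟨r, hr, hr2⟩ := hfp.exists_mem_Ico₀ hpi t
    have := this r ⟨hr.1, hr.2.le⟩
    rw [← hr2] at this
    exact this
  -- `f` is the derivative of a periodic function, so it has mean zero and its oscillation bounds
  -- it.
  refine abs_le_of_integral_eq_zero hfc ?_ ?_
  · have hgi := (h.continuousOn_deriv hφ hε).intervalIntegrable_of_Icc hpi.le
      (μ := volume)
    rw [intervalIntegral.integral_sub (hgi.const_mul σ)
      ((continuous_trigDeriv s m).intervalIntegrable _ _), intervalIntegral.integral_const_mul,
      h.integral_deriv_eq_zero hφ hε,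
      intervalIntegral.integral_eq_sub_of_hasDerivAt (fun t _ => hasDerivAt_trig s m t)
      ((continuous_trigDeriv s m).intervalIntegrable _ _)]
    have := trig_periodic s m 0
    rw [zero_add] at this
    rw [this]; ring
  · intro a ha b hb
    have e1 := h.sub_eq a ha b hb
    rw [integral_eq hφ hε h.continuous] at e1
    have e2 : trigDeriv s m b - trigDeriv s m a = -((m : ℝ) ^ 2) * ∫ t in a..b, trig s m t := by
      rw [← intervalIntegral.integral_const_mul]
      exact (intervalIntegral.integral_eq_sub_of_hasDerivAt (fun t _ => hasDerivAt_trigDeriv s m t)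
        (((continuous_trig s m).const_mul _).intervalIntegrable _ _)).symm
    have e3 : ∫ t in a..b, (σ * g t - trig s m t) =
        σ * (∫ t in a..b, g t) - ∫ t in a..b, trig s m t := by
      rw [intervalIntegral.integral_sub ((h.continuous.const_mul σ).intervalIntegrable _ _)
        ((continuous_trig s m).intervalIntegrable _ _), intervalIntegral.integral_const_mul]
    -- Three sources of error: the bump, the mismatch of the eigenvalues, and the `C⁰` distance.
    have key : f b - f a = σ * (∫ t in a..b, bump φ ε t * g t)
        + σ * ((1 + (m : ℝ) ^ 2 - μ) * ∫ t in a..b, g t)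
        - (m : ℝ) ^ 2 * ∫ t in a..b, (σ * g t - trig s m t) := by
      have : f b - f a = σ * (g' b - g' a) - (trigDeriv s m b - trigDeriv s m a) := by
        simp only [hf]; ring
      rw [this, e1, e2, e3]
      ring
    have hlen : |b - a| ≤ 2 * π := by
      rw [abs_le]; constructor <;> linarith [ha.1, ha.2, hb.1, hb.2]
    have b1 := abs_integral_bump_mul_le hφ hφ_neg hε h2 hg ha hb
    have b2 : |∫ t in a..b, g t| ≤ 1 * |b - a| := by
      rw [← Real.norm_eq_abs]
      exact intervalIntegral.norm_integral_le_of_norm_le_const fun t _ => hg t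
    have b3 : |∫ t in a..b, (σ * g t - trig s m t)| ≤ η * |b - a| := by
      rw [← Real.norm_eq_abs]
      exact intervalIntegral.norm_integral_le_of_norm_le_const fun t _ => hu t
    have c2 : |σ * ((1 + (m : ℝ) ^ 2 - μ) * ∫ t in a..b, g t)| ≤ η * (2 * π) := by
      rw [abs_mul, hσ1, one_mul, abs_mul]
      have : |1 + (m : ℝ) ^ 2 - μ| ≤ η := by rwa [abs_sub_comm]
      exact mul_le_mul this (by linarith) (abs_nonneg _) hη
    have c3 : |(m : ℝ) ^ 2 * ∫ t in a..b, (σ * g t - trig s m t)| ≤ (m : ℝ) ^ 2 * (η * (2 * π)) := by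
      rw [abs_mul, abs_of_nonneg (sq_nonneg (m : ℝ))]
      exact mul_le_mul_of_nonneg_left (b3.trans (by nlinarith)) (sq_nonneg _)
    have c1 : |σ * (∫ t in a..b, bump φ ε t * g t)| ≤ ε ^ 2 * mass φ := by
      rw [abs_mul, hσ1, one_mul]; linarith
    rw [key]
    refine (abs_sub _ _).trans ?_
    have := abs_add_le (σ * (∫ t in a..b, bump φ ε t * g t))
      (σ * ((1 + (m : ℝ) ^ 2 - μ) * ∫ t in a..b, g t))
    nlinarith

/-- This identity is used three ways: in the limit it identifies the frequency, divided by `ε²` it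
gives the eigenvalue shift, and through signs it locates the zeros of sine-like functions. -/
theorem test_trig {φ : ℝ → ℝ} (hφ : IntegrableOn φ (Icc 0 1) volume) {ε μ : ℝ} (hε : 0 < ε)
    (h2 : ε < 2 * π) {u : C(Torus, ℝ)} (hu : IsEigenfunction (bumpPotential φ 0 ε) μ u)
    (s : Bool) (m : ℕ) :
    (1 + (m : ℝ) ^ 2 - μ) * ∫ t in (0 : ℝ)..2 * π, u (t : Torus) * trig s m t =
      ε ^ 2 * ∫ r in (0 : ℝ)..1, -φ r * (u ((ε * r : ℝ) : Torus) * trig s m (ε * r)) := by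
  obtain ⟨g', hg⟩ := hu.exists_isPeriodicSolution hε
  refine hg.test_eq hφ hε h2 (hasDerivAt_trig s m) (hasDerivAt_trigDeriv s m) ?_ ?_
  · simpa using trig_periodic s m 0
  · simpa using trigDeriv_periodic s m 0

/-- A convergent sequence of normalised eigenfunctions has a trigonometric limit, and the shift of
the eigenvalue is determined to second order. -/
theorem exists_eventually_isCloseTo {φ : ℝ → ℝ} (hφ : IntegrableOn φ (Icc 0 1) volume)
    (hφ_neg : ∀ t ∈ Icc (0 : ℝ) 1, φ t < 0) {e lam : ℕ → ℝ} {u : ℕ → C(Torus, ℝ)} {μ η : ℝ}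
    {U : C(Torus, ℝ)} (hη : 0 < η) (he0 : ∀ n, 0 < e n) (he1 : ∀ n, e n < 2 * π)
    (he : Tendsto e atTop (𝓝 0)) (hlam : Tendsto lam atTop (𝓝 μ)) (hu : Tendsto u atTop (𝓝 U))
    (h1 : ∀ n, ‖u n‖ = 1) (hE : ∀ n, IsEigenfunction (bumpPotential φ 0 (e n)) (lam n) (u n)) :
    ∃ s m, ∀ᶠ n in atTop, IsCloseTo φ (e n) η (lam n) (u n) s m := by
  have hU1 : ‖U‖ = 1 := by
    have := (continuous_norm.tendsto U).comp hu
    exact tendsto_nhds_unique this (by simp only [Function.comp_def, h1]; exact tendsto_const_nhds)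
  have he2 : Tendsto (fun n => e n ^ 2) atTop (𝓝 0) := by simpa using he.pow 2
  -- The right side of `test_trig` is of order `ε²` and disappears in the limit.
  have lim_eq : ∀ s (n : ℕ),
      (1 + (n : ℝ) ^ 2 - μ) * ∫ t in (0 : ℝ)..2 * π, U (t : Torus) * trig s n t = 0 := by
    intro s n
    have a1 := (hlam.const_sub (1 + (n : ℝ) ^ 2)).mul (tendsto_integral_trig hu s n)
    have a2 := he2.mul (tendsto_scaled_integral hφ hu h1 he s n)
    rw [zero_mul] at a2
    exact tendsto_nhds_unique a1 (a2.congr fun j => (test_trig hφ (he0 j) (he1 j) (hE j) s n).symm)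
  -- Otherwise all Fourier coefficients of `U` vanish, contradicting `‖U‖ = 1`.
  obtain ⟨m, hm⟩ : ∃ m : ℕ, μ = 1 + (m : ℝ) ^ 2 := by
    by_contra! hne
    have : U = 0 := by
      refine eq_zero_of_integral_eq_zero U fun n => ⟨?_, ?_⟩
      · exact (mul_eq_zero.1 (lim_eq false n)).resolve_left (sub_ne_zero.2 (hne n).symm)
      · exact (mul_eq_zero.1 (lim_eq true n)).resolve_left (sub_ne_zero.2 (hne n).symm)
    simp [this] at hU1
  have hne : ∀ n : ℕ, n ≠ m → 1 + (n : ℝ) ^ 2 - μ ≠ 0 := by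
    intro n hn h
    rw [hm] at h
    have : (n : ℝ) ^ 2 = (m : ℝ) ^ 2 := by linarith
    rw [sq_eq_sq₀ (by positivity) (by positivity)] at this
    exact hn (by exact_mod_cast this)
  obtain ⟨a, b, hab⟩ := exists_eq_cos_add_sin U m fun n hn =>
    ⟨(mul_eq_zero.1 (lim_eq false n)).resolve_left (hne n hn),
      (mul_eq_zero.1 (lim_eq true n)).resolve_left (hne n hn)⟩
  have hnear : Tendsto (fun n => |lam n - (1 + (m : ℝ) ^ 2)|) atTop (𝓝 0) := by
    have := (hlam.sub_const (1 + (m : ℝ) ^ 2)).abs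
    rwa [hm, sub_self, abs_zero] at this
  -- Identify the limit up to sign and find the second order shift.
  suffices H : ∃ s, (s = true → m ≠ 0) ∧ (m ≠ 0 → Tendsto
      (fun n => (1 + (m : ℝ) ^ 2 - lam n) / e n ^ 2) atTop (𝓝 (bif s then 0 else mass φ / π))) ∧
      ∃ σ : ℝ, (σ = 1 ∨ σ = -1) ∧ ∀ t : ℝ, U (t : Torus) = σ * trig s m t by
    obtain ⟨s, hs, hshift, σ, hσ, hUσ⟩ := H
    refine ⟨s, m, ?_⟩
    have hσσ : σ * σ = 1 := by rcases hσ with rfl | rfl <;> norm_num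
    have hσ1 : |σ| = 1 := by rcases hσ with rfl | rfl <;> simp
    have hUn : Tendsto (fun n => ‖u n - U‖) atTop (𝓝 0) := tendsto_iff_norm_sub_tendsto_zero.1 hu
    -- The derivative error is at most `2 * π * (1 + m ^ 2) * δ + e n ^ 2 * mass φ`; each term gets
    -- half of `η`.
    obtain ⟨δ, hδ, hδη, hδ2⟩ : ∃ δ > 0, δ < η ∧
        2 * π * (1 + (m : ℝ) ^ 2) * δ < η / 2 := by
      have hp : 0 < 2 * π * (1 + (m : ℝ) ^ 2) := by positivity
      refine ⟨min (η / 2) (η / 4 / (2 * π * (1 + (m : ℝ) ^ 2))), by positivity, ?_, ?_⟩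
      · exact (min_le_left _ _).trans_lt (by linarith)
      · calc _ ≤ 2 * π * (1 + (m : ℝ) ^ 2) * (η / 4 / (2 * π * (1 + (m : ℝ) ^ 2))) :=
              mul_le_mul_of_nonneg_left (min_le_right _ _) hp.le
          _ = η / 4 := by field_simp
          _ < η / 2 := by linarith
    have hmass : Tendsto (fun n => e n ^ 2 * mass φ) atTop (𝓝 0) := by
      simpa using he2.mul_const (mass φ)
    have hsh : ∀ᶠ n in atTop, m ≠ 0 → |(1 + (m : ℝ) ^ 2 - lam n) / e n ^ 2 -
        bif s then 0 else mass φ / π| < η := by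
      by_cases hm0 : m = 0
      · exact Eventually.of_forall fun n h => absurd hm0 h
      · have := (hshift hm0).sub_const (bif s then 0 else mass φ / π) |>.abs
        rw [sub_self, abs_zero] at this
        filter_upwards [this.eventually_lt_const hη] with n hn _ using hn
    filter_upwards [hnear.eventually_lt_const hδ, hUn.eventually_lt_const hδ,
      hmass.eventually_lt_const (half_pos hη), hsh] with n n1 n2 n3 n4
    have hclose : ∀ t : ℝ, |σ * u n (t : Torus) - trig s m t| ≤ δ := by
      intro t
      have e1 : σ * u n (t : Torus) - trig s m t = σ * ((u n - U) (t : Torus)) := by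
        rw [ContinuousMap.sub_apply, hUσ t]
        linear_combination trig s m t * hσσ
      rw [e1, abs_mul, hσ1, one_mul]
      exact ((u n - U).norm_coe_le_norm _).trans n2.le
    refine ⟨hs, n1.trans hδη, n4, σ, hσ, fun t => (hclose t).trans_lt hδη, fun g' hg' t => ?_⟩
    obtain ⟨g'', hg''⟩ := (hE n).exists_isPeriodicSolution (he0 n)
    have hgg : g' = g'' := funext fun t => (hg' t).unique (hg''.hasDerivAt t)
    subst hgg
    refine (hg''.abs_deriv_sub_trigDeriv_le hφ hφ_neg (he0 n) (he1 n)
      (fun t => h1 n ▸ (u n).norm_coe_le_norm _) hσ n1.le hclose t).trans_lt ?_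
    linarith
  -- The unperturbed level of the constants is already simple, so no second order information is
  -- needed and `shift` is vacuous.
  by_cases hm0 : m = 0
  · subst hm0
    refine ⟨false, by simp, by simp, a, ?_, fun t => ?_⟩
    · obtain ⟨t, -, ht⟩ := exists_abs_eq_norm U
      rw [hab, hU1] at ht
      simp only [Nat.cast_zero, zero_mul, cos_zero, sin_zero, mul_one, mul_zero, add_zero] at ht
      exact eq_or_eq_neg_of_abs_eq ht
    · rw [hab]; simp [trig]
  have hmR : (m : ℝ) ≠ 0 := by exact_mod_cast hm0
  have hintc : ∫ t in (0 : ℝ)..2 * π, U (t : Torus) * trig false m t = π * a := by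
    have : ∀ t : ℝ, U (t : Torus) * trig false m t =
        a * (cos (m * t) * cos (m * t)) + b * (cos (m * t) * sin (m * t)) := by
      intro t; rw [hab]; simp only [trig, cond_false]; ring
    simp_rw [this]
    rw [intervalIntegral.integral_add
      ((by fun_prop : Continuous fun t : ℝ => a * (cos (m * t) * cos (m * t))).intervalIntegrable _ _)
      ((by fun_prop : Continuous fun t : ℝ => b * (cos (m * t) * sin (m * t))).intervalIntegrable _ _),
      intervalIntegral.integral_const_mul, intervalIntegral.integral_const_mul,
      integral_cos_mul_cos hm0, integral_cos_mul_sin hm0]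
    ring
  have hints : ∫ t in (0 : ℝ)..2 * π, U (t : Torus) * trig true m t = π * b := by
    have : ∀ t : ℝ, U (t : Torus) * trig true m t =
        a * (cos (m * t) * sin (m * t)) + b * (sin (m * t) * sin (m * t)) := by
      intro t; rw [hab]; simp only [trig, cond_true]; ring
    simp_rw [this]
    rw [intervalIntegral.integral_add
      ((by fun_prop : Continuous fun t : ℝ => a * (cos (m * t) * sin (m * t))).intervalIntegrable _ _)
      ((by fun_prop : Continuous fun t : ℝ => b * (sin (m * t) * sin (m * t))).intervalIntegrable _ _),
      intervalIntegral.integral_const_mul, intervalIntegral.integral_const_mul,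
      integral_sin_mul_sin hm0, integral_cos_mul_sin hm0]
    ring
  set r : ℕ → ℝ := fun n => (1 + (m : ℝ) ^ 2 - lam n) / e n ^ 2 with hr
  have hrT : ∀ s n, r n * ∫ t in (0 : ℝ)..2 * π, u n (t : Torus) * trig s m t =
      ∫ q in (0 : ℝ)..1, -φ q * (u n ((e n * q : ℝ) : Torus) * trig s m (e n * q)) := by
    intro s n
    have h0 := (he0 n).ne'
    have := test_trig hφ (he0 n) (he1 n) (hE n) s m
    rw [hr]
    simp only
    rw [div_mul_eq_mul_div, this]
    field_simp
  have hU0 : U ((0 : ℝ) : Torus) = a := by rw [hab]; simp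
  have hc1 := tendsto_integral_trig hu false m
  have hs1 := tendsto_integral_trig hu true m
  have hc2 := tendsto_scaled_integral hφ hu h1 he false m
  have hs2 := tendsto_scaled_integral hφ hu h1 he true m
  rw [hintc] at hc1
  rw [hints] at hs1
  simp only [trig, cond_false, mul_zero, cos_zero, mul_one, hU0] at hc2
  simp only [trig, cond_true, mul_zero, sin_zero] at hs2
  have hc3 : Tendsto (fun n => r n * ∫ t in (0 : ℝ)..2 * π, u n (t : Torus) * trig false m t) atTop
      (𝓝 (mass φ * a)) := hc2.congr fun n => (hrT false n).symm
  have hs3 : Tendsto (fun n => r n * ∫ t in (0 : ℝ)..2 * π, u n (t : Torus) * trig true m t) atTop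
      (𝓝 0) := hs2.congr fun n => (hrT true n).symm
  have lim_r : ∀ {I : ℕ → ℝ} {L M : ℝ}, Tendsto I atTop (𝓝 L) → L ≠ 0 →
      Tendsto (fun n => r n * I n) atTop (𝓝 M) → Tendsto r atTop (𝓝 (M / L)) := by
    intro I L M hI hL hM
    refine (hM.div hI hL).congr' ?_
    filter_upwards [hI.eventually_ne hL] with n hn
    exact mul_div_cancel_right₀ _ hn
  -- If `r` has a limit `ρ`, then `ρ * (π * a) = mass φ * a` and `ρ * (π * b) = 0`. So `a ≠ 0` gives
  -- `ρ = mass φ / π ≠ 0` and hence `b = 0`, while `a = 0` forces `b ≠ 0` and `ρ = 0`. Mixed limits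
  -- are impossible.
  by_cases ha : a = 0
  · have hb : b ≠ 0 := by
      rintro rfl
      obtain ⟨t, -, ht⟩ := exists_abs_eq_norm U
      rw [hab, hU1, ha] at ht
      simp at ht
    have := lim_r hs1 (mul_ne_zero pi_ne_zero hb) hs3
    rw [zero_div] at this
    refine ⟨true, fun _ => hm0, fun _ => this, b, ?_, fun t => ?_⟩
    · apply eq_or_eq_neg_of_abs_eq
      apply le_antisymm
      · have := U.norm_coe_le_norm ((π / 2 / m : ℝ) : Torus)
        rw [hab, hU1, mul_div_cancel₀ _ hmR, ha] at this
        simpa using this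
      · obtain ⟨t, -, ht⟩ := exists_abs_eq_norm U
        rw [hab, hU1, ha, zero_mul, zero_add, abs_mul] at ht
        rw [← ht]
        exact mul_le_of_le_one_right (abs_nonneg _) (abs_sin_le_one _)
    · rw [hab, ha]; simp [trig]
  · have hlim := lim_r hc1 (mul_ne_zero pi_ne_zero ha) hc3
    rw [mul_comm π a, mul_comm (mass φ) a, mul_div_mul_left _ _ ha] at hlim
    have hb : b = 0 := by
      have := tendsto_nhds_unique (hlim.mul hs1) hs3
      have hmp := (mass_pos hφ hφ_neg).ne'
      simpa [hmp, pi_ne_zero] using this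
    refine ⟨false, by simp, fun _ => hlim, a, ?_, fun t => ?_⟩
    · apply eq_or_eq_neg_of_abs_eq
      apply le_antisymm
      · have := U.norm_coe_le_norm ((0 : ℝ) : Torus)
        rwa [hU0, hU1] at this
      · obtain ⟨t, -, ht⟩ := exists_abs_eq_norm U
        rw [hab, hU1, hb, zero_mul, add_zero, abs_mul] at ht
        rw [← ht]
        exact mul_le_of_le_one_right (abs_nonneg _) (abs_cos_le_one _)
    · rw [hab, hb]; simp [trig]

/-- By contradiction: unclassified eigenfunctions with `ε → 0` have eigenvalues in `[0, K]` and a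
common Lipschitz constant, so a subsequence converges and `exists_eventually_isCloseTo` classifies
it. -/
theorem exists_forall_isCloseTo {φ : ℝ → ℝ} (hφ : IntegrableOn φ (Icc 0 1) volume)
    (hφ_neg : ∀ t ∈ Icc (0 : ℝ) 1, φ t < 0) (K : ℝ) {η : ℝ} (hη : 0 < η) :
    ∃ ε₀ > 0, ∀ ε, 0 < ε → ε < ε₀ → ∀ (μ : ℝ) (u : C(Torus, ℝ)),
      IsEigenfunction (bumpPotential φ 0 ε) μ u → ‖u‖ = 1 → μ ≤ K →
        0 < μ ∧ ∃ s m, IsCloseTo φ ε η μ u s m := by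
  obtain ⟨r₀, hr₀, hr₁, hr₂⟩ : ∃ r₀ > 0, r₀ ≤ 1 ∧ r₀ * mass φ ≤ 1 / 2 := by
    have hm := mass_pos hφ hφ_neg
    refine ⟨min 1 (1 / 2 / mass φ), by positivity, min_le_left _ _, ?_⟩
    calc _ ≤ 1 / 2 / mass φ * mass φ := mul_le_mul_of_nonneg_right (min_le_right _ _) hm.le
      _ = 1 / 2 := by field_simp
  have small : ∀ ε, 0 < ε → ε < r₀ → ε < 2 * π ∧ ε ^ 2 * mass φ ≤ 1 / 2 := by
    intro ε h0 h1
    have hm := mass_pos hφ hφ_neg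
    refine ⟨by linarith [pi_gt_three], le_trans ?_ hr₂⟩
    exact mul_le_mul_of_nonneg_right (by nlinarith) hm.le
  by_contra! H
  have hex : ∀ n : ℕ, ∃ (ε μ : ℝ) (u : C(Torus, ℝ)), 0 < ε ∧ ε < min r₀ (1 / ((n : ℝ) + 1)) ∧
      IsEigenfunction (bumpPotential φ 0 ε) μ u ∧ ‖u‖ = 1 ∧ μ ≤ K ∧
      ∀ s m, ¬ IsCloseTo φ ε η μ u s m := by
    intro n
    obtain ⟨ε, h0, h1, μ, u, hE, hu, hK, hn⟩ := H (min r₀ (1 / ((n : ℝ) + 1))) (by positivity)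
    have h2 := small ε h0 (h1.trans_le (min_le_left _ _))
    exact ⟨ε, μ, u, h0, h1, hE, hu, hK, hn (hE.pos hφ hφ_neg h0 h2.1 h2.2 hu)⟩
  choose e lam u he0 he1 hE hu hK hn using hex
  have hsm := fun n => small (e n) (he0 n) ((he1 n).trans_le (min_le_left _ _))
  have hpos := fun n => (hE n).pos hφ hφ_neg (he0 n) (hsm n).1 (hsm n).2 (hu n)
  have he : Tendsto e atTop (𝓝 0) :=
    squeeze_zero (fun n => (he0 n).le) (fun n => ((he1 n).trans_le (min_le_right _ _)).le)
      tendsto_one_div_add_atTop_nhds_zero_nat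
  -- The constant bounds `g'`: `|1 - μ| ≤ 1 + K` over a period of length `2 * π`, plus at most `1 /
  -- 2` from the bump.
  obtain ⟨S, hS, hmem⟩ := exists_isCompact_of_lipschitz ((1 + K) * (2 * π) + 1 / 2)
  have huS : ∀ n, u n ∈ S := by
    intro n
    obtain ⟨g', hg⟩ := (hE n).exists_isPeriodicSolution (he0 n)
    have hpi : 0 < 2 * π := by positivity
    have hb : ∀ t ∈ Icc 0 (2 * π), |g' t| ≤ (1 + K) * (2 * π) + 1 / 2 := by
      refine abs_le_of_integral_eq_zero (hg.continuousOn_deriv hφ (he0 n))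
        (hg.integral_deriv_eq_zero hφ (he0 n)) fun a ha b hb => ?_
      refine (hg.abs_deriv_sub_le hφ hφ_neg (he0 n) (hsm n).1
        (fun t => hu n ▸ (u n).norm_coe_le_norm _) ha hb).trans (add_le_add ?_ (hsm n).2)
      have h3 : |1 - lam n| ≤ 1 + K := by
        rw [abs_le]; constructor <;> linarith [hpos n, hK n]
      refine mul_le_mul h3 ?_ (abs_nonneg _) ((abs_nonneg _).trans h3)
      rw [abs_le]; constructor <;> linarith [ha.1, ha.2, hb.1, hb.2]
    have hb' : ∀ t, ‖g' t‖ ≤ (1 + K) * (2 * π) + 1 / 2 := by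
      intro t
      obtain ⟨r, hr, hr2⟩ := hg.periodic_deriv.exists_mem_Ico₀ hpi t
      rw [hr2]
      exact hb r ⟨hr.1, hr.2.le⟩
    refine hmem _ (hu n).le fun s t => ?_
    exact convex_univ.norm_image_sub_le_of_norm_hasDerivWithin_le
      (fun x _ => (hg.hasDerivAt x).hasDerivWithinAt) (fun x _ => hb' x) (mem_univ t) (mem_univ s)
  obtain ⟨⟨μ, U⟩, -, ψ, hψ, hlim⟩ := (isCompact_Icc (a := (0 : ℝ)) (b := K)).prod hS
    |>.tendsto_subseq (x := fun n => (lam n, u n)) fun n => ⟨⟨(hpos n).le, hK n⟩, huS n⟩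
  obtain ⟨s, m, hev⟩ := exists_eventually_isCloseTo hφ hφ_neg (e := e ∘ ψ) (lam := lam ∘ ψ)
    (u := u ∘ ψ) hη (fun n => he0 _) (fun n => (hsm _).1) (he.comp hψ.tendsto_atTop)
    ((continuous_fst.tendsto _).comp hlim) ((continuous_snd.tendsto _).comp hlim)
    (fun n => hu _) (fun n => hE _)
  obtain ⟨n, h⟩ := hev.exists
  exact hn _ s m h

/-! ### Simplicity of the spectrum and zeros of the eigenfunctions -/

theorem IsEigenfunction.lin_comb {V : Torus → ℝ} {μ : ℝ} {u v : C(Torus, ℝ)}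
    (hu : IsEigenfunction V μ u) (hv : IsEigenfunction V μ v) {a b : ℝ}
    (h : a • u + b • v ≠ 0) : IsEigenfunction V μ (a • u + b • v) := by
  obtain ⟨-, u', hu1, hu2⟩ := hu
  obtain ⟨-, v', hv1, hv2⟩ := hv
  refine ⟨h, fun t => a * u' t + b * v' t, fun t => ?_, fun p q => ?_⟩
  · exact ((hu1 t).const_mul a).add ((hv1 t).const_mul b)
  · have e : (fun t : ℝ => (V (t : Torus) - μ) * (a • u + b • v) (t : Torus)) = fun t : ℝ =>
        a * ((V (t : Torus) - μ) * u (t : Torus)) + b * ((V (t : Torus) - μ) * v (t : Torus)) := by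
      ext t
      simp only [ContinuousMap.add_apply, ContinuousMap.smul_apply, smul_eq_mul]
      ring
    have i1 := (hu2 p q).1.const_mul a
    have i2 := (hv2 p q).1.const_mul b
    rw [e]
    refine ⟨i1.add i2, ?_⟩
    rw [intervalIntegral.integral_add i1 i2, intervalIntegral.integral_const_mul,
      intervalIntegral.integral_const_mul, ← (hu2 p q).2, ← (hv2 p q).2]
    ring

theorem IsEigenfunction.const_smul {V : Torus → ℝ} {μ : ℝ} {u : C(Torus, ℝ)}
    (hu : IsEigenfunction V μ u) {a : ℝ} (ha : a ≠ 0) : IsEigenfunction V μ (a • u) := by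
  have := hu.lin_comb hu (a := a) (b := 0) (by simpa using ⟨ha, hu.1⟩)
  simpa using this

theorem norm_inv_norm_smul {u : C(Torus, ℝ)} (hu : u ≠ 0) : ‖(‖u‖⁻¹ : ℝ) • u‖ = 1 := by
  rw [norm_smul, norm_inv, norm_norm, inv_mul_cancel₀ (norm_ne_zero_iff.2 hu)]

/-- Every normalised eigenfunction with eigenvalue at most `K` is `η`-close to a trigonometric
function. -/
def IsClassified (φ : ℝ → ℝ) (ε η K : ℝ) : Prop :=
  ∀ (μ : ℝ) (u : C(Torus, ℝ)), IsEigenfunction (bumpPotential φ 0 ε) μ u → ‖u‖ = 1 → μ ≤ K →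
    0 < μ ∧ ∃ s m, IsCloseTo φ ε η μ u s m

section

variable {φ : ℝ → ℝ} {ε η μ K : ℝ} {s s' : Bool} {m m' : ℕ} {u v : C(Torus, ℝ)}

/-- The eigenvalue alone determines the type: its position gives `m`, and the two possible shifts
are at least `2 * η` apart. -/
theorem IsCloseTo.type_unique (hη : η ≤ 1 / 8) (hηm : 2 * η ≤ mass φ / π)
    (h : IsCloseTo φ ε η μ u s m) (h' : IsCloseTo φ ε η μ v s' m') : s = s' ∧ m = m' := by
  have hm : m = m' := by
    have h1 := abs_lt.1 h.abs_sub_lt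
    have h2 := abs_lt.1 h'.abs_sub_lt
    by_contra hne
    have h3 : (m : ℝ) ^ 2 < (m' : ℝ) ^ 2 + 1 := by linarith
    have h4 : (m' : ℝ) ^ 2 < (m : ℝ) ^ 2 + 1 := by linarith
    have h5 : m ^ 2 < m' ^ 2 + 1 := by exact_mod_cast h3
    have h6 : m' ^ 2 < m ^ 2 + 1 := by exact_mod_cast h4
    have h7 : m ^ 2 = m' ^ 2 := by omega
    exact hne (Nat.pow_left_injective (n := 2) (by norm_num) h7)
  subst hm
  refine ⟨?_, rfl⟩
  by_cases hm0 : m = 0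
  · cases s
    · cases s'
      · rfl
      · exact absurd hm0 (h'.ne_zero rfl)
    · exact absurd hm0 (h.ne_zero rfl)
  · have h1 := abs_lt.1 (h.shift hm0)
    have h2 := abs_lt.1 (h'.shift hm0)
    cases s <;> cases s'
    · rfl
    · simp only [cond_false, cond_true] at h1 h2; linarith
    · simp only [cond_false, cond_true] at h1 h2; linarith
    · rfl

theorem IsCloseTo.trig_lt (h : IsCloseTo φ ε η μ u s m) {t : ℝ} (ht : u (t : Torus) = 0) :
    |trig s m t| < η := by
  obtain ⟨σ, -, h1, -⟩ := h.exists_sign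
  have := h1 t
  rwa [ht, mul_zero, zero_sub, abs_neg] at this

/-- Eigenvalues are simple. -/
theorem IsClassified.not_linearIndependent (hK : IsClassified φ ε η K) (hη : η ≤ 1 / 8)
    (hηm : 2 * η ≤ mass φ / π) (hμ : μ ≤ K) (hu : IsEigenfunction (bumpPotential φ 0 ε) μ u)
    (hv : IsEigenfunction (bumpPotential φ 0 ε) μ v) : ¬ LinearIndependent ℝ ![u, v] := by
  intro hli
  -- In a two-dimensional eigenspace a zero can be prescribed at any point.
  have key : ∀ p : ℝ, ∃ w : C(Torus, ℝ), IsEigenfunction (bumpPotential φ 0 ε) μ w ∧ ‖w‖ = 1 ∧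
      w (p : Torus) = 0 := by
    intro p
    have : ∃ w : C(Torus, ℝ), IsEigenfunction (bumpPotential φ 0 ε) μ w ∧ w (p : Torus) = 0 := by
      by_cases h0 : u (p : Torus) = 0
      · exact ⟨u, hu, h0⟩
      · refine ⟨v (p : Torus) • u + (-u (p : Torus)) • v, hu.lin_comb hv fun h => ?_, ?_⟩
        · have := (LinearIndependent.pair_iff.1 hli _ _ h).2
          exact h0 (neg_eq_zero.1 this)
        · simp only [ContinuousMap.add_apply, ContinuousMap.smul_apply, smul_eq_mul]
          ring
    obtain ⟨w, hw, hwp⟩ := this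
    refine ⟨_, hw.const_smul (inv_ne_zero (norm_ne_zero_iff.2 hw.1)), norm_inv_norm_smul hw.1, ?_⟩
    simp [hwp]
  -- A zero at `0` forces sine type, hence the same type for the whole eigenspace; a zero at `π / 2
  -- / m`, where that sine equals `1`, is then impossible.
  obtain ⟨w₁, hw₁, hn₁, hz₁⟩ := key 0
  obtain ⟨-, s, m, hc⟩ := hK _ _ hw₁ hn₁ hμ
  have h1 := hc.trig_lt hz₁
  cases s
  · simp [trig] at h1
    linarith
  have hm := hc.ne_zero rfl
  have hmR : (m : ℝ) ≠ 0 := by exact_mod_cast hm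
  obtain ⟨w₂, hw₂, hn₂, hz₂⟩ := key (π / 2 / m)
  obtain ⟨-, s', m', hc'⟩ := hK _ _ hw₂ hn₂ hμ
  obtain ⟨rfl, rfl⟩ := hc.type_unique hη hηm hc'
  have h2 := hc'.trig_lt hz₂
  simp only [trig, cond_true, mul_div_cancel₀ _ hmR, sin_pi_div_two, abs_one] at h2
  linarith

theorem integral_trig_mul_trig_ge (s : Bool) (m : ℕ) (h : s = true → m ≠ 0) :
    π ≤ ∫ t in (0 : ℝ)..2 * π, trig s m t * trig s m t := by
  by_cases hm : m = 0
  · subst hm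
    cases s
    · simp [trig]; linarith [pi_pos]
    · exact absurd rfl (h rfl)
  · cases s
    · exact (integral_cos_mul_cos hm).ge
    · exact (integral_sin_mul_sin hm).ge

theorem abs_integral_sub_le {f g : ℝ → ℝ} (hf : Continuous f) (hg : Continuous g) {δ : ℝ}
    (h : ∀ t, |f t - g t| ≤ δ) :
    |(∫ t in (0 : ℝ)..2 * π, f t) - ∫ t in (0 : ℝ)..2 * π, g t| ≤ 2 * π * δ := by
  rw [← intervalIntegral.integral_sub (hf.intervalIntegrable _ _) (hg.intervalIntegrable _ _),
    ← Real.norm_eq_abs]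
  refine (intervalIntegral.norm_integral_le_of_norm_le_const fun t _ => h t).trans ?_
  rw [sub_zero, abs_of_pos (by positivity), mul_comm]

theorem continuous_coe (u : C(Torus, ℝ)) : Continuous fun t : ℝ => u (t : Torus) :=
  u.continuous.comp (AddCircle.continuous_mk' _)

/-- Eigenfunctions for distinct eigenvalues have distinct types. -/
theorem IsCloseTo.type_ne (hφ : IntegrableOn φ (Icc 0 1) volume) (hε : 0 < ε) (hη : η ≤ 1 / 8)
    {μ₁ μ₂ : ℝ} {u₁ u₂ : C(Torus, ℝ)} (hμ : μ₁ ≠ μ₂)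
    (he₁ : IsEigenfunction (bumpPotential φ 0 ε) μ₁ u₁)
    (he₂ : IsEigenfunction (bumpPotential φ 0 ε) μ₂ u₂) (hn₁ : ‖u₁‖ = 1)
    (h₁ : IsCloseTo φ ε η μ₁ u₁ s m) (h₂ : IsCloseTo φ ε η μ₂ u₂ s' m') : ¬ (s = s' ∧ m = m') := by
  rintro ⟨rfl, rfl⟩
  obtain ⟨σ₁, hs₁, hc₁, -⟩ := h₁.exists_sign
  obtain ⟨σ₂, hs₂, hc₂, -⟩ := h₂.exists_sign
  obtain ⟨g₁', hg₁⟩ := he₁.exists_isPeriodicSolution hε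
  obtain ⟨g₂', hg₂⟩ := he₂.exists_isPeriodicSolution hε
  have h0 := hg₁.integral_mul_eq_zero hφ hε hg₂ hμ
  have hσ₁ : |σ₁| = 1 := by rcases hs₁ with rfl | rfl <;> simp
  have h3 : ∫ t in (0 : ℝ)..2 * π, (σ₁ * u₁ (t : Torus)) * (σ₂ * u₂ (t : Torus)) = 0 := by
    have : ∀ t : ℝ, (σ₁ * u₁ (t : Torus)) * (σ₂ * u₂ (t : Torus)) =
        (σ₁ * σ₂) * (u₁ (t : Torus) * u₂ (t : Torus)) := fun t => by ring
    simp_rw [this]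
    rw [intervalIntegral.integral_const_mul, h0, mul_zero]
  -- With equal types the inner product would be at least `π - 4 * π * η ≥ π / 2`, against
  -- orthogonality.
  have hb : ∀ t : ℝ, |(σ₁ * u₁ (t : Torus)) * (σ₂ * u₂ (t : Torus)) - trig s m t * trig s m t|
      ≤ 2 * η := by
    intro t
    have e : (σ₁ * u₁ (t : Torus)) * (σ₂ * u₂ (t : Torus)) - trig s m t * trig s m t =
      (σ₁ * u₁ (t : Torus)) * (σ₂ * u₂ (t : Torus) - trig s m t) +
        trig s m t * (σ₁ * u₁ (t : Torus) - trig s m t) := by ring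
    rw [e]
    refine (abs_add_le _ _).trans ?_
    rw [abs_mul (σ₁ * u₁ (t : Torus)), abs_mul (trig s m t)]
    have b1 : |σ₁ * u₁ (t : Torus)| ≤ 1 := by
      rw [abs_mul, hσ₁, one_mul]
      exact hn₁ ▸ u₁.norm_coe_le_norm _
    have := abs_trig_le_one s m t
    nlinarith [hc₁ t, hc₂ t, abs_nonneg (σ₂ * u₂ (t : Torus) - trig s m t),
      abs_nonneg (σ₁ * u₁ (t : Torus) - trig s m t)]
  have h4 := abs_integral_sub_le
    (f := fun t => (σ₁ * u₁ (t : Torus)) * (σ₂ * u₂ (t : Torus)))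
    (g := fun t => trig s m t * trig s m t)
    (((continuous_coe u₁).const_mul σ₁).mul ((continuous_coe u₂).const_mul σ₂))
    ((continuous_trig s m).mul (continuous_trig s m)) hb
  rw [h3] at h4
  have h5 := integral_trig_mul_trig_ge s m h₁.ne_zero
  have h6 := (abs_le.1 h4).1
  nlinarith [pi_pos]

/-- The sine-like eigenfunctions vanish on the support of the perturbation. -/
theorem IsCloseTo.exists_zero (hφ : IntegrableOn φ (Icc 0 1) volume)
    (hφ_neg : ∀ t ∈ Icc (0 : ℝ) 1, φ t < 0) (hε : 0 < ε) (h2 : ε < 2 * π) (hη : η ≤ 1 / 8)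
    (hu : IsEigenfunction (bumpPotential φ 0 ε) μ u) (h : IsCloseTo φ ε η μ u true m)
    (hmε : 2 * (m * ε) ≤ 1) : ∃ z ∈ Icc 0 ε, u ((z : ℝ) : Torus) = 0 := by
  by_contra! hne
  have huc := continuous_coe u
  have hm0 := h.ne_zero rfl
  have hmn : (0 : ℝ) ≤ m := Nat.cast_nonneg m
  -- Without a zero, `u` has a constant sign `c` on `[0, ε]`.
  obtain ⟨c, hc1, hc⟩ : ∃ c : ℝ, |c| = 1 ∧ ∀ t ∈ Icc 0 ε, 0 < c * u (t : Torus) := by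
    rcases lt_or_gt_of_ne (hne 0 ⟨le_rfl, hε.le⟩) with h0 | h0
    · refine ⟨-1, by simp, fun t ht => ?_⟩
      by_contra! hle
      obtain ⟨z, hz, hz0⟩ := intermediate_value_Icc ht.1 huc.continuousOn
        (show (0 : ℝ) ∈ Icc _ _ from ⟨h0.le, by linarith⟩)
      exact hne z ⟨hz.1, hz.2.trans ht.2⟩ hz0
    · refine ⟨1, by simp, fun t ht => ?_⟩
      by_contra! hle
      obtain ⟨z, hz, hz0⟩ := intermediate_value_Icc' ht.1 huc.continuousOn
        (show (0 : ℝ) ∈ Icc _ _ from ⟨by linarith, h0.le⟩)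
      exact hne z ⟨hz.1, hz.2.trans ht.2⟩ hz0
  have hi : IntervalIntegrable φ volume 0 1 :=
    (intervalIntegrable_iff_integrableOn_Icc_of_le zero_le_one).2 hφ
  have hint : ∀ s : Bool, IntervalIntegrable
      (fun r => -φ r * (c * u ((ε * r : ℝ) : Torus) * trig s m (ε * r))) volume 0 1 := by
    intro s
    have := continuous_trig s m
    exact hi.neg.mul_continuousOn (by fun_prop)
  -- On the support of the bump the argument of the sine and cosine is at most `1 / 2`, where `0 ≤
  -- sin ≤ cos`.
  have hTpos : 0 < ∫ r in (0 : ℝ)..1, -φ r * (c * u ((ε * r : ℝ) : Torus) * trig false m (ε * r)) ∧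
      0 ≤ ∫ r in (0 : ℝ)..1, -φ r * (c * u ((ε * r : ℝ) : Torus) * trig true m (ε * r)) ∧
      ∫ r in (0 : ℝ)..1, -φ r * (c * u ((ε * r : ℝ) : Torus) * trig true m (ε * r)) ≤
      ∫ r in (0 : ℝ)..1, -φ r * (c * u ((ε * r : ℝ) : Torus) * trig false m (ε * r)) := by
    have pt : ∀ r ∈ Icc (0 : ℝ) 1, 0 < -φ r ∧ 0 < c * u ((ε * r : ℝ) : Torus) ∧
        0 ≤ sin (m * (ε * r)) ∧ 0 < cos (m * (ε * r)) ∧ sin (m * (ε * r)) ≤ cos (m * (ε * r)) := by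
      intro r hr
      have hx0 : 0 ≤ m * (ε * r) := mul_nonneg hmn (mul_nonneg hε.le hr.1)
      have hx1 : m * (ε * r) ≤ 1 / 2 := by
        have : m * (ε * r) ≤ m * ε := by
          rw [← mul_assoc]
          exact mul_le_of_le_one_right (mul_nonneg hmn hε.le) hr.2
        linarith
      have hcos := one_sub_sq_div_two_le_cos (x := m * (ε * r))
      have hsin := sin_le hx0
      refine ⟨by linarith [hφ_neg r hr], hc _ ⟨mul_nonneg hε.le hr.1,
        mul_le_of_le_one_right hε.le hr.2⟩, sin_nonneg_of_nonneg_of_le_pi hx0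
        (by linarith [pi_gt_three]), by nlinarith, by nlinarith⟩
    refine ⟨?_, ?_, ?_⟩
    · refine intervalIntegral.intervalIntegral_pos_of_pos_on (hint false) (fun r hr => ?_) zero_lt_one
      obtain ⟨p1, p2, p3, p4, p5⟩ := pt r (Ioo_subset_Icc_self hr)
      exact mul_pos p1 (mul_pos p2 p4)
    · refine intervalIntegral.integral_nonneg zero_le_one fun r hr => ?_
      obtain ⟨p1, p2, p3, p4, p5⟩ := pt r hr
      exact mul_nonneg p1.le (mul_nonneg p2.le p3)
    · refine intervalIntegral.integral_mono_on zero_le_one (hint true) (hint false) fun r hr => ?_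
      obtain ⟨p1, p2, p3, p4, p5⟩ := pt r hr
      exact mul_le_mul_of_nonneg_left (mul_le_mul_of_nonneg_left p5 p2.le) p1.le
  have hcT : ∀ s : Bool, ∫ r in (0 : ℝ)..1, -φ r * (c * u ((ε * r : ℝ) : Torus) * trig s m (ε * r)) =
      c * ∫ r in (0 : ℝ)..1, -φ r * (u ((ε * r : ℝ) : Torus) * trig s m (ε * r)) := by
    intro s
    rw [← intervalIntegral.integral_const_mul]
    congr 1; ext r; ring
  simp only [hcT] at hTpos
  have hA := test_trig hφ hε h2 hu false m
  have hB := test_trig hφ hε h2 hu true m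
  set Tc := ∫ r in (0 : ℝ)..1, -φ r * (u ((ε * r : ℝ) : Torus) * trig false m (ε * r))
  set Ts := ∫ r in (0 : ℝ)..1, -φ r * (u ((ε * r : ℝ) : Torus) * trig true m (ε * r))
  set A := ∫ t in (0 : ℝ)..2 * π, u (t : Torus) * trig false m t with hAdef
  set B := ∫ t in (0 : ℝ)..2 * π, u (t : Torus) * trig true m t with hBdef
  set d := 1 + (m : ℝ) ^ 2 - μ
  have hd : d ≠ 0 := by
    intro h0
    rw [h0, zero_mul] at hA
    have : Tc = 0 := by
      rcases mul_eq_zero.1 hA.symm with h | h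
      · exact absurd h (by positivity)
      · exact h
    rw [this] at hTpos
    simp at hTpos
  -- The factor `d` is common to both identities and cancels. But closeness to a sine makes `|B| ≥ π
  -- - 2 * π * η` and `|A| ≤ 2 * π * η`, which is incompatible with `η ≤ 1 / 8`.
  have habs : |B| ≤ |A| := by
    have : |d * B| ≤ |d * A| := by
      rw [hA, hB, abs_mul, abs_mul]
      refine mul_le_mul_of_nonneg_left ?_ (abs_nonneg _)
      have e1 : |Ts| = |c * Ts| := by rw [abs_mul, hc1, one_mul]
      have e2 : |Tc| = |c * Tc| := by rw [abs_mul, hc1, one_mul]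
      rw [e1, e2, abs_of_nonneg hTpos.2.1, abs_of_pos hTpos.1]
      exact hTpos.2.2
    rw [abs_mul, abs_mul] at this
    exact le_of_mul_le_mul_left this (abs_pos.2 hd)
  obtain ⟨σ, hσ, hcl, -⟩ := h.exists_sign
  have hσ1 : |σ| = 1 := by rcases hσ with rfl | rfl <;> simp
  have est : ∀ s : Bool, |σ * (∫ t in (0 : ℝ)..2 * π, u (t : Torus) * trig s m t) -
      ∫ t in (0 : ℝ)..2 * π, trig true m t * trig s m t| ≤ 2 * π * η := by
    intro s
    rw [← intervalIntegral.integral_const_mul]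
    refine abs_integral_sub_le (f := fun t => σ * (u (t : Torus) * trig s m t))
      (g := fun t => trig true m t * trig s m t) ((huc.mul (continuous_trig s m)).const_mul σ)
      ((continuous_trig true m).mul (continuous_trig s m)) fun t => ?_
    have : σ * (u (t : Torus) * trig s m t) - trig true m t * trig s m t =
        (σ * u (t : Torus) - trig true m t) * trig s m t := by ring
    rw [this, abs_mul]
    nlinarith [hcl t, abs_trig_le_one s m t, abs_nonneg (trig s m t),
      abs_nonneg (σ * u (t : Torus) - trig true m t)]
  have eA := est false
  have eB := est true
  have i1 : ∫ t in (0 : ℝ)..2 * π, trig true m t * trig false m t = 0 := by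
    simp only [trig, cond_true, cond_false, mul_comm (sin _)]
    exact integral_cos_mul_sin hm0
  have i2 : ∫ t in (0 : ℝ)..2 * π, trig true m t * trig true m t = π := integral_sin_mul_sin hm0
  rw [i1, sub_zero, abs_mul, hσ1, one_mul] at eA
  rw [i2] at eB
  have : π - 2 * π * η ≤ |B| := by
    have h1 := (abs_le.1 eB).1
    have h2 : σ * B ≤ |B| := by
      have := le_abs_self (σ * B)
      rwa [abs_mul, hσ1, one_mul] at this
    linarith
  nlinarith [pi_pos]

end

/-! ### Volterra operators and the monodromy matrix -/

/-- The compact interval `[0, 2π]`. -/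
abbrev Period : Type := Icc (0 : ℝ) (2 * π)

/-- The Banach space of continuous functions on `[0, 2π]`. -/
def PeriodFun : Type := C(Period, ℝ)

namespace PeriodFun

noncomputable instance instNormedAddCommGroup : NormedAddCommGroup PeriodFun :=
  inferInstanceAs (NormedAddCommGroup C(Period, ℝ))

noncomputable instance instNormedSpace : NormedSpace ℝ PeriodFun :=
  inferInstanceAs (NormedSpace ℝ C(Period, ℝ))

instance instCompleteSpace : CompleteSpace PeriodFun :=
  inferInstanceAs (CompleteSpace C(Period, ℝ))

instance instFunLike : FunLike PeriodFun Period ℝ :=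
  inferInstanceAs (FunLike C(Period, ℝ) Period ℝ)

/-- The restriction of a function on the line to `[0, 2π]`. -/
def ofFun (f : ℝ → ℝ) (hf : Continuous f) : PeriodFun :=
  (⟨fun t => f t, hf.comp continuous_subtype_val⟩ : C(Period, ℝ))

theorem ofFun_apply (f : ℝ → ℝ) (hf : Continuous f) (t : Period) : ofFun f hf t = f t := rfl

theorem ext {f g : PeriodFun} (h : ∀ t, f t = g t) : f = g := ContinuousMap.ext h

theorem add_apply (f g : PeriodFun) (t : Period) : (f + g) t = f t + g t := rfl

theorem neg_apply (f : PeriodFun) (t : Period) : (-f) t = -f t := rfl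

theorem smul_apply (c : ℝ) (f : PeriodFun) (t : Period) : (c • f) t = c * f t := rfl

theorem continuous (f : PeriodFun) : Continuous f := ContinuousMap.continuous f

theorem norm_coe_le_norm (f : PeriodFun) (t : Period) : ‖f t‖ ≤ ‖f‖ :=
  ContinuousMap.norm_coe_le_norm f t

theorem norm_le {f : PeriodFun} {C : ℝ} (hC : 0 ≤ C) : ‖f‖ ≤ C ↔ ∀ t, ‖f t‖ ≤ C :=
  ContinuousMap.norm_le f hC

theorem continuous_eval (t : Period) : Continuous fun f : PeriodFun => f t :=
  (ContinuousMap.evalCLM ℝ t : C(Period, ℝ) →L[ℝ] ℝ).continuous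

end PeriodFun

theorem zero_le_two_pi : (0 : ℝ) ≤ 2 * π := by positivity

/-- The extension of a function on `[0, 2π]` to the line, constant outside the interval. -/
noncomputable def extendConst (f : PeriodFun) : ℝ → ℝ := IccExtend zero_le_two_pi f

theorem continuous_extend (f : PeriodFun) : Continuous (extendConst f) := (PeriodFun.continuous f).Icc_extend'

theorem extend_of_mem (f : PeriodFun) {t : ℝ} (ht : t ∈ Icc 0 (2 * π)) :
    extendConst f t = f ⟨t, ht⟩ := IccExtend_of_mem _ _ ht

theorem abs_extend_le (f : PeriodFun) (t : ℝ) : |extendConst f t| ≤ ‖f‖ := f.norm_coe_le_norm _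

theorem intervalIntegrable_mul_extend {ρ : ℝ → ℝ} (hρ : ∀ a b, IntervalIntegrable ρ volume a b) (f : PeriodFun)
    (a b : ℝ) : IntervalIntegrable (fun t => ρ t * extendConst f t) volume a b :=
  (hρ _ _).mul_continuousOn (continuous_extend f).continuousOn

/-- The Volterra operator `f ↦ ∫₀ᵗ ρ f`. -/
noncomputable def volterra (ρ : ℝ → ℝ) (hρ : ∀ a b, IntervalIntegrable ρ volume a b) :
    PeriodFun →L[ℝ] PeriodFun :=
  LinearMap.mkContinuous
    { toFun := fun f => .ofFun (fun t => ∫ s in (0 : ℝ)..t, ρ s * extendConst f s)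
        (intervalIntegral.continuous_primitive (intervalIntegrable_mul_extend hρ f) 0)
      map_add' := fun f g => by
        refine PeriodFun.ext fun t => ?_
        simp only [PeriodFun.ofFun_apply, PeriodFun.add_apply]
        rw [← intervalIntegral.integral_add (intervalIntegrable_mul_extend hρ f _ _)
          (intervalIntegrable_mul_extend hρ g _ _)]
        congr 1; ext s
        simp only [extendConst, IccExtend, Function.comp_apply, PeriodFun.add_apply]
        ring
      map_smul' := fun c f => by
        refine PeriodFun.ext fun t => ?_
        simp only [PeriodFun.ofFun_apply, PeriodFun.smul_apply, RingHom.id_apply]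
        rw [← intervalIntegral.integral_const_mul]
        congr 1; ext s
        simp only [extendConst, IccExtend, Function.comp_apply, PeriodFun.smul_apply]
        ring }
    (∫ s in (0 : ℝ)..2 * π, |ρ s|)
    (fun f => by
      have hi : IntervalIntegrable (fun s => |ρ s|) volume 0 (2 * π) := (hρ _ _).abs
      refine (PeriodFun.norm_le (mul_nonneg (intervalIntegral.integral_nonneg zero_le_two_pi
        fun _ _ => abs_nonneg _) (norm_nonneg _))).2 fun t => ?_
      simp only [LinearMap.coe_mk, AddHom.coe_mk, PeriodFun.ofFun_apply]
      rw [← intervalIntegral.integral_mul_const]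
      refine (intervalIntegral.norm_integral_le_of_norm_le t.2.1
        (g := fun s => |ρ s| * ‖f‖) (Eventually.of_forall fun s _ => ?_) ?_).trans ?_
      · rw [norm_mul, Real.norm_eq_abs, Real.norm_eq_abs]
        exact mul_le_mul_of_nonneg_left (abs_extend_le f s) (abs_nonneg _)
      · exact (hρ _ _).abs.mul_const _
      · exact intervalIntegral.integral_mono_interval le_rfl t.2.1 t.2.2
          (Eventually.of_forall fun s => by positivity) (hi.mul_const _))

theorem volterra_apply {ρ : ℝ → ℝ} (hρ : ∀ a b, IntervalIntegrable ρ volume a b) (f : PeriodFun) (t : Period) :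
    volterra ρ hρ f t = ∫ s in (0 : ℝ)..t, ρ s * extendConst f s := rfl

theorem norm_volterra_le {ρ : ℝ → ℝ} (hρ : ∀ a b, IntervalIntegrable ρ volume a b) :
    ‖volterra ρ hρ‖ ≤ ∫ s in (0 : ℝ)..2 * π, |ρ s| :=
  LinearMap.mkContinuous_norm_le _
    (intervalIntegral.integral_nonneg zero_le_two_pi fun _ _ => abs_nonneg _) _

/-- The operator `f ↦ ∫₀ᵗ f`. -/
noncomputable def primitiveOp : PeriodFun →L[ℝ] PeriodFun :=
  volterra (fun _ => 1) (fun _ _ => by simp)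

theorem primitiveOp_apply (f : PeriodFun) (t : Period) :
    primitiveOp f t = ∫ s in (0 : ℝ)..t, extendConst f s := by
  simp only [primitiveOp, volterra_apply, one_mul]

theorem abs_primitiveOp_pow_le (f : PeriodFun) (n : ℕ) (t : Period) :
    |(primitiveOp ^ n) f t| ≤ (t : ℝ) ^ n / n.factorial * ‖f‖ := by
  induction n generalizing t with
  | zero => simpa using f.norm_coe_le_norm t
  | succ n ih =>
    rw [pow_succ', mul_apply_eq_comp, primitiveOp_apply, ← Real.norm_eq_abs]
    have hc : Continuous fun s : ℝ => s ^ n / n.factorial * ‖f‖ := by fun_prop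
    refine (intervalIntegral.norm_integral_le_of_norm_le t.2.1
      (g := fun s => s ^ n / n.factorial * ‖f‖) (Eventually.of_forall fun s hs => ?_)
      (hc.intervalIntegrable _ _)).trans_eq ?_
    · have hs' : s ∈ Icc 0 (2 * π) := ⟨hs.1.le, hs.2.trans t.2.2⟩
      rw [extend_of_mem _ hs']
      exact ih ⟨s, hs'⟩
    · rw [intervalIntegral.integral_mul_const, intervalIntegral.integral_div, integral_pow,
        Nat.factorial_succ]
      push_cast
      have : (n.factorial : ℝ) ≠ 0 := by positivity
      field_simp
      simp

theorem norm_primitiveOp_pow_le (n : ℕ) :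
    ‖primitiveOp ^ n‖ ≤ (2 * π) ^ n / n.factorial := by
  refine ContinuousLinearMap.opNorm_le_bound _ (by positivity) fun f => ?_
  refine (PeriodFun.norm_le (by positivity)).2 fun t => ?_
  refine (abs_primitiveOp_pow_le f n t).trans ?_
  gcongr
  · exact t.2.1
  · exact t.2.2

/-- `1 - x ^ n` is `1 - x` times a geometric sum, and the two factors commute, so each is invertible
if the product is. -/
theorem isUnit_one_sub_of_norm_pow_lt_one {R : Type*} [NormedRing R] [CompleteSpace R] {x : R}
    {n : ℕ} (h : ‖x ^ n‖ < 1) : IsUnit (1 - x) := by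
  have hu : IsUnit (1 - x ^ n) := isUnit_one_sub_of_norm_lt_one h
  rw [← mul_neg_geom_sum x n] at hu
  have hc : Commute (1 - x) (∑ i ∈ Finset.range n, x ^ i) := by
    rw [commute_iff_eq, mul_neg_geom_sum, geom_sum_mul_neg]
  exact (hc.isUnit_mul_iff.1 hu).1

/-- The operator `1 - J (P - ν J)`, where `J` is integration; the solution with data `(α, β)` of
the equation whose potential is encoded in `P` is the preimage of `α + β t`. -/
noncomputable def shootOp (p : ℝ × (PeriodFun →L[ℝ] PeriodFun)) :
    PeriodFun →L[ℝ] PeriodFun := 1 - primitiveOp * (p.2 - p.1 • primitiveOp)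

theorem continuous_shootOp : Continuous shootOp := by
  unfold shootOp
  fun_prop

/-- Integration is quasinilpotent: the factorial decay of its powers beats every power of `ν`, so no
smallness of `ν` is needed. -/
theorem isUnit_shootOp_zero (ν : ℝ) : IsUnit (shootOp (ν, 0)) := by
  have hlim := FloorSemiring.tendsto_pow_div_factorial_atTop (|ν| * (2 * π) ^ 2)
  obtain ⟨n, hn⟩ := (hlim.eventually_lt_const zero_lt_one).exists
  have e : shootOp (ν, 0) = 1 - (-ν) • primitiveOp ^ 2 := by
    simp only [shootOp, zero_sub, mul_neg, mul_smul_comm, pow_two, neg_smul]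
  rw [e]
  refine isUnit_one_sub_of_norm_pow_lt_one (n := n) (lt_of_le_of_lt ?_ hn)
  rw [smul_pow, ← pow_mul, norm_smul, norm_pow, norm_neg, Real.norm_eq_abs, mul_pow, ← pow_mul,
    mul_div_assoc]
  refine mul_le_mul_of_nonneg_left ((norm_primitiveOp_pow_le _).trans ?_) (by positivity)
  gcongr
  omega

theorem isOpen_isUnit_shootOp : IsOpen {p | IsUnit (shootOp p)} :=
  Units.isOpen.preimage continuous_shootOp

/-- The solution with initial data encoded in `f`. -/
noncomputable def shoot (f : PeriodFun) (p : ℝ × (PeriodFun →L[ℝ] PeriodFun)) :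
    PeriodFun := Ring.inverse (shootOp p) f

theorem continuousOn_shoot (f : PeriodFun) :
    ContinuousOn (shoot f) {p | IsUnit (shootOp p)} := by
  intro p hp
  obtain ⟨U, hU⟩ : IsUnit (shootOp p) := hp
  have h1 : ContinuousAt Ring.inverse (shootOp p) := hU ▸ NormedRing.inverse_continuousAt U
  have h2 : ContinuousAt (fun q => Ring.inverse (shootOp q)) p :=
    ContinuousAt.comp (f := shootOp) (g := Ring.inverse) h1 continuous_shootOp.continuousAt
  exact (h2.clm_apply continuousAt_const).continuousWithinAt

theorem shoot_eq_of_shootOp_apply {f g : PeriodFun}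
    {p : ℝ × (PeriodFun →L[ℝ] PeriodFun)} (hp : IsUnit (shootOp p))
    (h : shootOp p g = f) : shoot f p = g := by
  rw [shoot, ← h, ← mul_apply_eq_comp, Ring.inverse_mul_cancel _ hp,
    one_apply_eq_self]

theorem shootOp_shoot (f : PeriodFun) {p : ℝ × (PeriodFun →L[ℝ] PeriodFun)}
    (hp : IsUnit (shootOp p)) : shootOp p (shoot f p) = f := by
  rw [shoot, ← mul_apply_eq_comp, Ring.mul_inverse_cancel _ hp,
    one_apply_eq_self]

/-- The function `α + β t` on `[0, 2π]`. -/
noncomputable def affineFun (α β : ℝ) : PeriodFun := .ofFun (fun t => α + β * t) (by fun_prop)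

/-- The right endpoint of `[0, 2π]`. -/
noncomputable def rightEnd : Period := ⟨2 * π, zero_le_two_pi, le_rfl⟩

/-- The value at `2π` of the solution with data `(α, β)`. -/
noncomputable def endValue (α β : ℝ) (p : ℝ × (PeriodFun →L[ℝ] PeriodFun)) : ℝ :=
  shoot (affineFun α β) p rightEnd

/-- The derivative at `2π` of the solution with data `(α, β)`. -/
noncomputable def endDeriv (α β : ℝ) (p : ℝ × (PeriodFun →L[ℝ] PeriodFun)) : ℝ :=
  β + (p.2 - p.1 • primitiveOp) (shoot (affineFun α β) p) rightEnd

theorem continuousOn_endValue (α β : ℝ) :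
    ContinuousOn (endValue α β) {p | IsUnit (shootOp p)} :=
  (PeriodFun.continuous_eval rightEnd).comp_continuousOn (continuousOn_shoot _)

theorem continuousOn_endDeriv (α β : ℝ) :
    ContinuousOn (endDeriv α β) {p | IsUnit (shootOp p)} := by
  unfold endDeriv
  refine continuousOn_const.add ((PeriodFun.continuous_eval rightEnd).comp_continuousOn ?_)
  have h : Continuous fun p : ℝ × (PeriodFun →L[ℝ] PeriodFun) =>
      p.2 - p.1 • primitiveOp := by fun_prop
  exact h.continuousOn.clm_apply (continuousOn_shoot _)

theorem affineFun_eq (α β : ℝ) : affineFun α β = α • affineFun 1 0 + β • affineFun 0 1 := by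
  refine PeriodFun.ext fun t => ?_
  simp [affineFun, PeriodFun.add_apply, PeriodFun.smul_apply, PeriodFun.ofFun_apply]

theorem shoot_affineFun (α β : ℝ) (p : ℝ × (PeriodFun →L[ℝ] PeriodFun)) :
    shoot (affineFun α β) p = α • shoot (affineFun 1 0) p + β • shoot (affineFun 0 1) p := by
  rw [affineFun_eq, shoot, shoot, shoot, map_add, map_smul, map_smul]

theorem endValue_eq (α β : ℝ) (p : ℝ × (PeriodFun →L[ℝ] PeriodFun)) :
    endValue α β p = α * endValue 1 0 p + β * endValue 0 1 p := by
  simp only [endValue, shoot_affineFun α β, PeriodFun.add_apply, PeriodFun.smul_apply]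

theorem endDeriv_eq (α β : ℝ) (p : ℝ × (PeriodFun →L[ℝ] PeriodFun)) :
    endDeriv α β p = α * endDeriv 1 0 p + β * endDeriv 0 1 p := by
  simp only [endDeriv, shoot_affineFun α β, map_add, map_smul, PeriodFun.add_apply,
    PeriodFun.smul_apply]
  ring

/-! ### The unperturbed monodromy -/

theorem primitiveOp_eq {f : PeriodFun} {F g : ℝ → ℝ} (hF : ∀ t, HasDerivAt F (g t) t)
    (hg : Continuous g) (hfg : ∀ t : Period, f t = g t) (t : Period) :
    primitiveOp f t = F t - F 0 := by
  rw [primitiveOp_apply, ← intervalIntegral.integral_eq_sub_of_hasDerivAt (fun x _ => hF x)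
    (hg.intervalIntegrable _ _)]
  apply intervalIntegral.integral_congr
  intro s hs
  rw [uIcc_of_le t.2.1] at hs
  have hs' : s ∈ Icc 0 (2 * π) := ⟨hs.1, hs.2.trans t.2.2⟩
  simp only [extend_of_mem f hs', hfg]

/-- The explicit solution `g` is checked through the operator equation `g + κ² J² g = α + β t`, with
`J` denoting `primitiveOp`. -/
theorem shoot_zero {κ : ℝ} (hκ : κ ≠ 0) (α β : ℝ) :
    (∀ t : Period, shoot (affineFun α β) (κ ^ 2, 0) t = α * cos (κ * t) + β * (sin (κ * t) / κ)) ∧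
    ∀ t : Period, β + ((0 : PeriodFun →L[ℝ] PeriodFun) - κ ^ 2 • primitiveOp)
      (shoot (affineFun α β) (κ ^ 2, 0)) t = -α * κ * sin (κ * t) + β * cos (κ * t) := by
  let g : PeriodFun := .ofFun (fun t => α * cos (κ * t) + β * (sin (κ * t) / κ)) (by fun_prop)
  have hlin : ∀ t : ℝ, HasDerivAt (fun t : ℝ => κ * t) κ t := fun t => by
    simpa using (hasDerivAt_id t).const_mul κ
  have h1 : ∀ t : Period, primitiveOp g t =
      α * (sin (κ * t) / κ) + β * (1 - cos (κ * t)) / κ ^ 2 := by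
    intro t
    rw [primitiveOp_eq (F := fun t => α * (sin (κ * t) / κ) - β * cos (κ * t) / κ ^ 2)
      (g := fun t => α * cos (κ * t) + β * (sin (κ * t) / κ)) ?_ (by fun_prop) fun t => rfl]
    · simp; field_simp; ring
    · intro t
      convert! (((hlin t).sin.div_const κ).const_mul α).sub
        (((hlin t).cos.const_mul β).div_const (κ ^ 2)) using 1
      field_simp; ring
  have h2 : ∀ t : Period, primitiveOp (primitiveOp g) t =
      α * (1 - cos (κ * t)) / κ ^ 2 + β * (t - sin (κ * t) / κ) / κ ^ 2 := by
    intro t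
    rw [primitiveOp_eq
      (F := fun t => β * (t - sin (κ * t) / κ) / κ ^ 2 - α * cos (κ * t) / κ ^ 2)
      (g := fun t => α * (sin (κ * t) / κ) + β * (1 - cos (κ * t)) / κ ^ 2) ?_ (by fun_prop) h1]
    · simp; field_simp; ring
    · intro t
      convert! ((((hasDerivAt_id t).sub ((hlin t).sin.div_const κ)).const_mul β).div_const
        (κ ^ 2)).sub (((hlin t).cos.const_mul α).div_const (κ ^ 2)) using 1
      field_simp; ring
  have hs : shoot (affineFun α β) (κ ^ 2, 0) = g := by
    refine shoot_eq_of_shootOp_apply (isUnit_shootOp_zero _) ?_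
    refine PeriodFun.ext fun t => ?_
    simp only [shootOp, zero_sub, mul_neg, mul_smul_comm, sub_neg_eq_add, _root_.add_apply,
      one_apply_eq_self, _root_.smul_apply, mul_apply_eq_comp,
      PeriodFun.add_apply, PeriodFun.smul_apply, h2, g, PeriodFun.ofFun_apply,
      affineFun]
    field_simp
    ring
  refine ⟨fun t => by rw [hs]; rfl, fun t => ?_⟩
  rw [hs]
  simp only [zero_sub, _root_.neg_apply, _root_.smul_apply,
    PeriodFun.neg_apply, PeriodFun.smul_apply, h1]
  field_simp
  ring

/-! ### Existence of eigenvalues near `1 + m²` -/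

/-- `u` solves `u'' = (q - ν) u` on `[0, 2π]` in integrated form, with derivative `w`. -/
structure IsSolution (q : ℝ → ℝ) (ν : ℝ) (u w : ℝ → ℝ) : Prop where
  hasDerivAt : ∀ t, HasDerivAt u (w t) t
  continuous_deriv : Continuous w
  sub_eq : ∀ t ∈ Icc 0 (2 * π), w t - w 0 = ∫ s in (0 : ℝ)..t, (q s - ν) * u s

theorem IsSolution.continuous {q u w : ℝ → ℝ} {ν : ℝ} (h : IsSolution q ν u w) : Continuous u :=
  continuous_iff_continuousAt.2 fun t => (h.hasDerivAt t).continuousAt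

theorem intervalIntegrable_sub_mul {q f : ℝ → ℝ} (hq : ∀ a b, IntervalIntegrable q volume a b)
    (hf : Continuous f) (ν a b : ℝ) : IntervalIntegrable (fun s => (q s - ν) * f s) volume a b :=
  ((hq a b).sub intervalIntegrable_const).mul_continuousOn hf.continuousOn

/-- Passes from the operator equation on `[0, 2π]` to functions on the line: `w` is integrated from
the fixed point and `u` from `w`, and the equation says that `u` agrees with the fixed point on the
period. -/
theorem exists_isSolution {q : ℝ → ℝ} (hq : ∀ a b, IntervalIntegrable q volume a b) {ν : ℝ}
    (hp : IsUnit (shootOp (ν, volterra q hq))) (α β : ℝ) :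
    ∃ u w, IsSolution q ν u w ∧ u 0 = α ∧ w 0 = β ∧
      u (2 * π) = endValue α β (ν, volterra q hq) ∧ w (2 * π) = endDeriv α β (ν, volterra q hq) := by
  set f := shoot (affineFun α β) (ν, volterra q hq) with hf
  have hfe := shootOp_shoot (affineFun α β) hp
  rw [← hf] at hfe
  set k := (volterra q hq - ν • primitiveOp) f with hk
  have hii := intervalIntegrable_sub_mul hq (continuous_extend f) ν
  set w : ℝ → ℝ := fun t => β + ∫ s in (0 : ℝ)..t, (q s - ν) * extendConst f s with hw
  have hwc : Continuous w := continuous_const.add (intervalIntegral.continuous_primitive hii 0)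
  have hwk : ∀ t : Period, w t = β + k t := by
    intro t
    have : k t = (∫ s in (0 : ℝ)..t, q s * extendConst f s) -
        ν * ∫ s in (0 : ℝ)..t, extendConst f s := by
      rw [hk, sub_eq_add_neg, _root_.add_apply, PeriodFun.add_apply, _root_.neg_apply,
        PeriodFun.neg_apply, _root_.smul_apply, PeriodFun.smul_apply, volterra_apply,
        primitiveOp_apply]
      ring
    rw [this, hw, ← intervalIntegral.integral_const_mul,
      ← intervalIntegral.integral_sub (intervalIntegrable_mul_extend hq f _ _)
      (((continuous_extend f).const_mul ν).intervalIntegrable _ _)]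
    simp only [sub_mul]
  set u : ℝ → ℝ := fun t => α + ∫ s in (0 : ℝ)..t, w s with hu
  have huf : ∀ t : Period, u t = f t := by
    intro t
    have h1 : f t - primitiveOp k t = α + β * t := by
      have := congrArg (fun g : PeriodFun => g t) hfe
      simp only [shootOp, sub_eq_add_neg, _root_.add_apply, _root_.neg_apply, one_apply_eq_self,
        mul_apply_eq_comp, PeriodFun.add_apply, PeriodFun.neg_apply] at this
      simp only [← sub_eq_add_neg] at this
      exact this
    have h2 : ∫ s in (0 : ℝ)..t, w s = ∫ s in (0 : ℝ)..t, (β + extendConst k s) := by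
      apply intervalIntegral.integral_congr
      intro s hs
      rw [uIcc_of_le t.2.1] at hs
      have hs' : s ∈ Icc 0 (2 * π) := ⟨hs.1, hs.2.trans t.2.2⟩
      simp only [extendConst, IccExtend_of_mem _ _ hs']
      exact hwk ⟨s, hs'⟩
    rw [hu]
    simp only
    rw [h2, intervalIntegral.integral_add (by simp) ((continuous_extend k).intervalIntegrable _ _),
      ← primitiveOp_apply]
    simp only [intervalIntegral.integral_const, sub_zero, smul_eq_mul]
    linarith
  refine ⟨u, w, ⟨fun t => ?_, hwc, fun t ht => ?_⟩, by simp [hu], by simp [hw], ?_, ?_⟩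
  · exact (intervalIntegral.integral_hasDerivAt_right (hwc.intervalIntegrable _ _)
      (hwc.stronglyMeasurableAtFilter _ _) hwc.continuousAt).const_add α
  · simp only [hw, intervalIntegral.integral_same, add_zero, add_sub_cancel_left]
    apply intervalIntegral.integral_congr
    intro s hs
    rw [uIcc_of_le ht.1] at hs
    have hs' : s ∈ Icc 0 (2 * π) := ⟨hs.1, hs.2.trans ht.2⟩
    simp only [extend_of_mem f hs', ← huf ⟨s, hs'⟩]
  · exact huf rightEnd
  · exact hwk rightEnd

/-- The Wronskian of two solutions is constant. -/
theorem IsSolution.wronskian {q : ℝ → ℝ} (hq : ∀ a b, IntervalIntegrable q volume a b) {ν : ℝ}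
    {u₁ w₁ u₂ w₂ : ℝ → ℝ} (h₁ : IsSolution q ν u₁ w₁) (h₂ : IsSolution q ν u₂ w₂) :
    u₁ (2 * π) * w₂ (2 * π) - w₁ (2 * π) * u₂ (2 * π) = u₁ 0 * w₂ 0 - w₁ 0 * u₂ 0 := by
  have e₁ := integral_mul_eq_of_integral_eq_sub zero_le_two_pi
    (intervalIntegrable_sub_mul hq h₁.continuous ν 0 (2 * π)) h₁.sub_eq h₂.hasDerivAt
    h₂.continuous_deriv.continuousOn
  have e₂ := integral_mul_eq_of_integral_eq_sub zero_le_two_pi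
    (intervalIntegrable_sub_mul hq h₂.continuous ν 0 (2 * π)) h₂.sub_eq h₁.hasDerivAt
    h₁.continuous_deriv.continuousOn
  have a : ∫ t in (0 : ℝ)..2 * π, (q t - ν) * u₂ t * u₁ t =
      ∫ t in (0 : ℝ)..2 * π, (q t - ν) * u₁ t * u₂ t := by
    congr 1; ext t; ring
  have b : ∫ t in (0 : ℝ)..2 * π, w₂ t * w₁ t = ∫ t in (0 : ℝ)..2 * π, w₁ t * w₂ t := by
    congr 1; ext t; ring
  rw [a, b] at e₂
  linarith

/-- Equal data at both ends make the successive primitives of the periodically extended right side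
periodic, so gluing creates no corner. The eigenvalue is `1 + ν` because `bump` omits the constant
part of the potential. -/
theorem IsSolution.exists_isEigenfunction {φ : ℝ → ℝ} (hφ : IntegrableOn φ (Icc 0 1) volume)
    {ε ν : ℝ} (hε : 0 < ε) {u w : ℝ → ℝ} (h : IsSolution (bump φ ε) ν u w)
    (hu : u (2 * π) = u 0) (hw : w (2 * π) = w 0) (hne : u 0 ≠ 0 ∨ w 0 ≠ 0) :
    ∃ U : C(Torus, ℝ), IsEigenfunction (bumpPotential φ 0 ε) (1 + ν) U ∧
      U ((0 : ℝ) : Torus) = u 0 ∧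
      ∀ g' : ℝ → ℝ, (∀ t : ℝ, HasDerivAt (fun s : ℝ => U (s : Torus)) (g' t) t) → g' 0 = w 0 := by
  have hpi : 0 < 2 * π := by positivity
  let U : C(Torus, ℝ) := ⟨AddCircle.liftIco (2 * π) 0 u,
    AddCircle.liftIco_zero_continuous hu.symm h.continuous.continuousOn⟩
  have hU : ∀ t ∈ Ico 0 (2 * π), U (t : Torus) = u t := fun t ht =>
    AddCircle.liftIco_zero_coe_apply ht
  set f : ℝ → ℝ := fun t => (bumpPotential φ 0 ε (t : Torus) - (1 + ν)) * U (t : Torus) with hf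
  have hfp : Function.Periodic f (2 * π) :=
    periodic_coe fun x : Torus => (bumpPotential φ 0 ε x - (1 + ν)) * U x
  have hae : ∀ᵐ t : ℝ, t ∈ Icc 0 (2 * π) → f t = (bump φ ε t - ν) * u t := by
    have : ∀ᵐ t : ℝ, t ≠ 2 * π := by simp [ae_iff, measure_singleton]
    filter_upwards [this] with t ht ht2
    have ht3 : t ∈ Ico 0 (2 * π) := ⟨ht2.1, lt_of_le_of_ne ht2.2 ht⟩
    simp only [hf]
    rw [bumpPotential_zero_coe hε ht3, hU t ht3]
    ring
  have hqi : ∀ a b, IntervalIntegrable (bump φ ε) volume a b := fun a b =>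
    (integrable_bump hφ hε).intervalIntegrable
  have hfi : ∀ a b, IntervalIntegrable f volume a b := by
    refine hfp.intervalIntegrable₀ hpi.ne' ?_
    refine (intervalIntegrable_sub_mul hqi h.continuous ν 0 (2 * π)).congr_ae ?_
    rw [EventuallyEq, ae_restrict_iff' measurableSet_uIoc]
    filter_upwards [hae] with t ht ht2
    rw [uIoc_of_le hpi.le] at ht2
    exact (ht ⟨ht2.1.le, ht2.2⟩).symm
  have hfint : ∀ t ∈ Icc 0 (2 * π), ∫ s in (0 : ℝ)..t, f s = w t - w 0 := by
    intro t ht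
    rw [h.sub_eq t ht]
    apply intervalIntegral.integral_congr_ae
    filter_upwards [hae] with s hs hs2
    rw [uIoc_of_le ht.1] at hs2
    exact hs ⟨hs2.1.le, hs2.2.trans ht.2⟩
  set F : ℝ → ℝ := fun t => w 0 + ∫ s in (0 : ℝ)..t, f s with hF
  have hFc : Continuous F := continuous_const.add (intervalIntegral.continuous_primitive hfi 0)
  have hFw : ∀ t ∈ Icc 0 (2 * π), F t = w t := by
    intro t ht
    simp only [hF, hfint t ht]; ring
  have hFp : Function.Periodic F (2 * π) := by
    intro t
    have h1 : ∫ s in t..t + 2 * π, f s = 0 := by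
      rw [hfp.intervalIntegral_add_eq t 0, zero_add, hfint _ ⟨hpi.le, le_rfl⟩, hw, sub_self]
    simp only [hF]
    rw [← intervalIntegral.integral_add_adjacent_intervals (hfi 0 t) (hfi t (t + 2 * π)), h1,
      add_zero]
  have hFint : ∀ t ∈ Icc 0 (2 * π), ∫ s in (0 : ℝ)..t, F s = u t - u 0 := by
    intro t ht
    rw [← intervalIntegral.integral_eq_sub_of_hasDerivAt (fun x _ => h.hasDerivAt x)
      (h.continuous_deriv.intervalIntegrable _ _)]
    apply intervalIntegral.integral_congr
    intro s hs
    rw [uIcc_of_le ht.1] at hs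
    exact hFw s ⟨hs.1, hs.2.trans ht.2⟩
  set G : ℝ → ℝ := fun t => u 0 + ∫ s in (0 : ℝ)..t, F s with hG
  have hGp : Function.Periodic G (2 * π) := by
    intro t
    have h1 : ∫ s in t..t + 2 * π, F s = 0 := by
      rw [hFp.intervalIntegral_add_eq t 0, zero_add, hFint _ ⟨hpi.le, le_rfl⟩, hu, sub_self]
    simp only [hG]
    rw [← intervalIntegral.integral_add_adjacent_intervals (hFc.intervalIntegrable 0 t)
      (hFc.intervalIntegrable t (t + 2 * π)), h1, add_zero]
  have hUG : (fun t : ℝ => U (t : Torus)) = G := by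
    ext t
    have hp : Function.Periodic (fun t : ℝ => U (t : Torus) - G t) (2 * π) :=
      (periodic_coe U).sub hGp
    obtain ⟨r, hr, hr2⟩ := hp.exists_mem_Ico₀ hpi t
    have h3 : U (r : Torus) - G r = 0 := by
      rw [hU r hr]
      simp only [hG, hFint r ⟨hr.1, hr.2.le⟩]
      ring
    rw [h3] at hr2
    exact sub_eq_zero.1 hr2
  have hder : ∀ t : ℝ, HasDerivAt (fun s : ℝ => U (s : Torus)) (F t) t := by
    intro t
    rw [hUG]
    exact (intervalIntegral.integral_hasDerivAt_right (hFc.intervalIntegrable _ _)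
      (hFc.stronglyMeasurableAtFilter _ _) hFc.continuousAt).const_add _
  have hF0 : F 0 = w 0 := by simp [hF]
  have hU0 : U ((0 : ℝ) : Torus) = u 0 := hU 0 ⟨le_rfl, hpi⟩
  refine ⟨U, ⟨fun h0 => ?_, F, hder, fun a b => ⟨hfi a b, ?_⟩⟩, hU0, fun g' hg' => ?_⟩
  · rcases hne with h1 | h1
    · rw [← hU0, h0] at h1
      exact h1 rfl
    · rw [← hF0] at h1
      apply h1
      refine (hder 0).unique ?_
      rw [h0]
      exact hasDerivAt_const 0 0
  · simp only [hF, add_sub_add_left_eq_sub]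
    exact intervalIntegral.integral_interval_sub_left (hfi 0 b) (hfi 0 a)
  · rw [← hF0]
    exact (hg' 0).unique (hder 0)

/-- If the off-diagonal entry `B` of a continuous curve of unimodular matrices with trace larger
than `-2` changes sign between two points where the trace is less than `2`, then either the
matrix is unipotent triangular somewhere in between, or the trace attains `2` twice. -/
theorem trace_dichotomy {A B C D : ℝ → ℝ} {a b : ℝ} (hab : a ≤ b) (hB : ContinuousOn B (Icc a b))
    (hT : ContinuousOn (fun x => A x + D x) (Icc a b))
    (hdet : ∀ x ∈ Icc a b, A x * D x - B x * C x = 1) (hlow : ∀ x ∈ Icc a b, -2 < A x + D x)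
    (ha : A a + D a < 2) (hb : A b + D b < 2) (hs : B a * B b < 0) :
    (∃ x ∈ Icc a b, B x = 0 ∧ A x = 1 ∧ D x = 1) ∨
      ∃ x ∈ Icc a b, ∃ y ∈ Icc a b, x ≠ y ∧ A x + D x = 2 ∧ A y + D y = 2 := by
  obtain ⟨x, hx, hx0⟩ : ∃ x ∈ Icc a b, B x = 0 := by
    rw [← uIcc_of_le hab] at hB ⊢
    have := intermediate_value_uIcc hB
    apply this
    rcases mul_neg_iff.1 hs with h | h
    · exact mem_uIcc.2 (Or.inr ⟨h.2.le, h.1.le⟩)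
    · exact mem_uIcc.2 (Or.inl ⟨h.1.le, h.2.le⟩)
  have hAD : A x * D x = 1 := by
    have := hdet x hx
    rwa [hx0, zero_mul, sub_zero] at this
  have hl := hlow x hx
  -- `A x * D x = 1` makes the trace at least `2` in absolute value; `hl` excludes the negative
  -- branch.
  have hge : 2 ≤ A x + D x := by
    by_contra! hlt
    nlinarith [sq_nonneg (A x - D x)]
  rcases hge.eq_or_lt with heq | hgt
  · left
    have hz : A x - D x = 0 := by
      have : (A x - D x) ^ 2 = 0 := by nlinarith
      exact pow_eq_zero_iff (two_ne_zero) |>.1 this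
    exact ⟨x, hx, hx0, by linarith, by linarith⟩
  -- The trace is below `2` at both ends and above `2` at `x`, so it takes the value `2` on each
  -- side of `x`.
  · right
    obtain ⟨y, hy, hy2⟩ := intermediate_value_Icc hx.1
      (hT.mono (Icc_subset_Icc le_rfl hx.2)) (show (2 : ℝ) ∈ Icc _ _ from ⟨ha.le, hgt.le⟩)
    obtain ⟨z, hz, hz2⟩ := intermediate_value_Icc' hx.2
      (hT.mono (Icc_subset_Icc hx.1 le_rfl)) (show (2 : ℝ) ∈ Icc _ _ from ⟨hb.le, hgt.le⟩)
    refine ⟨y, ⟨hy.1, hy.2.trans hx.2⟩, z, ⟨hx.1.trans hz.1, hz.2⟩, ?_, hy2, hz2⟩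
    rintro rfl
    have : y = x := le_antisymm hy.2 hz.1
    subst this
    simp only at hy2
    linarith

/-- A unimodular matrix of trace `2` has a fixed vector. -/
theorem exists_fixed_vector {A B C D : ℝ} (hdet : A * D - B * C = 1) (ht : A + D = 2) :
    ∃ α β : ℝ, (α ≠ 0 ∨ β ≠ 0) ∧ α * A + β * B = α ∧ α * C + β * D = β := by
  by_cases h : B = 0 ∧ A = 1
  · exact ⟨0, 1, Or.inr one_ne_zero, by linarith [h.1], by linarith [h.2]⟩
  · refine ⟨B, 1 - A, ?_, by ring, by linear_combination (-1) * hdet + ht⟩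
    by_contra! hc
    exact h ⟨hc.1, by linarith [hc.2]⟩

/-- The interval `[(m - 1/4)², (m + 1/4)²]`. -/
def window (m : ℕ) : Set ℝ := Icc (((m : ℝ) - 1 / 4) ^ 2) (((m : ℝ) + 1 / 4) ^ 2)

theorem unperturbed_entries {κ : ℝ} (hκ : κ ≠ 0) :
    endValue 1 0 (κ ^ 2, 0) = cos (κ * (2 * π)) ∧ endValue 0 1 (κ ^ 2, 0) = sin (κ * (2 * π)) / κ ∧
    endDeriv 1 0 (κ ^ 2, 0) = -κ * sin (κ * (2 * π)) ∧
    endDeriv 0 1 (κ ^ 2, 0) = cos (κ * (2 * π)) := by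
  have h1 := shoot_zero hκ 1 0
  have h2 := shoot_zero hκ 0 1
  refine ⟨(h1.1 rightEnd).trans ?_, (h2.1 rightEnd).trans ?_, (h1.2 rightEnd).trans ?_,
    (h2.2 rightEnd).trans ?_⟩ <;> simp [rightEnd]

theorem sqrt_mem_of_mem_window {m : ℕ} (hm : m ≠ 0) {ν : ℝ} (hν : ν ∈ window m) :
    ∃ κ : ℝ, κ ≠ 0 ∧ ν = κ ^ 2 ∧ |κ - m| ≤ 1 / 4 := by
  have hm1 : (1 : ℝ) ≤ m := by exact_mod_cast Nat.one_le_iff_ne_zero.2 hm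
  have hν0 : 0 ≤ ν := (sq_nonneg _).trans hν.1
  have l1 := Real.le_sqrt_of_sq_le hν.1
  have l2 : √ν ≤ (m : ℝ) + 1 / 4 := Real.sqrt_le_iff.2 ⟨by positivity, hν.2⟩
  refine ⟨√ν, by intro h; rw [h] at l1; linarith, (Real.sq_sqrt hν0).symm, ?_⟩
  rw [abs_le]; constructor <;> linarith

theorem cos_two_pi_nonneg {κ : ℝ} {m : ℕ} (h : |κ - m| ≤ 1 / 4) : 0 ≤ cos (κ * (2 * π)) := by
  have e : κ * (2 * π) = (κ - m) * (2 * π) + m * (2 * π) := by ring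
  rw [e, cos_add_nat_mul_two_pi]
  have := abs_le.1 h
  apply cos_nonneg_of_neg_pi_div_two_le_of_le <;> nlinarith [pi_pos]

theorem window_ends (m : ℕ) : cos (((m : ℝ) - 1 / 4) * (2 * π)) = 0 ∧
    sin (((m : ℝ) - 1 / 4) * (2 * π)) = -1 ∧ cos (((m : ℝ) + 1 / 4) * (2 * π)) = 0 ∧
    sin (((m : ℝ) + 1 / 4) * (2 * π)) = 1 := by
  have e1 : ((m : ℝ) - 1 / 4) * (2 * π) = -(π / 2) + m * (2 * π) := by ring
  have e2 : ((m : ℝ) + 1 / 4) * (2 * π) = π / 2 + m * (2 * π) := by ring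
  rw [e1, e2, cos_add_nat_mul_two_pi, cos_add_nat_mul_two_pi, sin_add_nat_mul_two_pi,
    sin_add_nat_mul_two_pi]
  simp

/-- Near the unperturbed equation the monodromy has the qualitative properties needed for
`trace_dichotomy` on the window around `m²`. -/
theorem exists_forall_monodromy {m : ℕ} (hm : m ≠ 0) : ∃ r > 0,
    ∀ P : PeriodFun →L[ℝ] PeriodFun, ‖P‖ < r →
      (∀ ν ∈ window m, IsUnit (shootOp (ν, P)) ∧ -2 < endValue 1 0 (ν, P) + endDeriv 0 1 (ν, P)) ∧
      ∀ κ : ℝ, κ = m - 1 / 4 ∨ κ = m + 1 / 4 →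
        endValue 1 0 (κ ^ 2, P) + endDeriv 0 1 (κ ^ 2, P) < 2 ∧
        0 < sin (κ * (2 * π)) * endValue 0 1 (κ ^ 2, P) ∧
        0 < -sin (κ * (2 * π)) * endDeriv 1 0 (κ ^ 2, P) := by
  have hm1 : (1 : ℝ) ≤ m := by exact_mod_cast Nat.one_le_iff_ne_zero.2 hm
  set O : Set (ℝ × (PeriodFun →L[ℝ] PeriodFun)) := {p | IsUnit (shootOp p)} with hO
  have hOo : IsOpen O := isOpen_isUnit_shootOp
  have cA := continuousOn_endValue 1 0
  have cB := continuousOn_endValue 0 1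
  have cC := continuousOn_endDeriv 1 0
  have cD := continuousOn_endDeriv 0 1
  have hO1 : IsOpen (O ∩ (fun p => endValue 1 0 p + endDeriv 0 1 p) ⁻¹' Ioi (-2)) :=
    (cA.add cD).isOpen_inter_preimage hOo isOpen_Ioi
  -- Compactness of the window makes the open conditions at `P = 0` hold for small `P` uniformly in
  -- `ν`.
  obtain ⟨V₁, V₂, -, hV₂, hw, h0, hsub⟩ := generalized_tube_lemma
    (s := window m) isCompact_Icc (t := {(0 : PeriodFun →L[ℝ] PeriodFun)}) isCompact_singleton hO1
    (by
      rintro ⟨ν, P⟩ ⟨hν, hP⟩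
      obtain rfl : P = 0 := hP
      obtain ⟨κ, hκ, hνκ, hκm⟩ := sqrt_mem_of_mem_window hm hν
      simp only at hνκ
      subst hνκ
      refine ⟨isUnit_shootOp_zero _, ?_⟩
      obtain ⟨a, -, -, d⟩ := unperturbed_entries hκ
      have := cos_two_pi_nonneg hκm
      simp only [mem_preimage, mem_Ioi]
      rw [a, d]
      linarith)
  -- The sine is `-1` at the left end and `1` at the right, so positivity of these products says
  -- that both off-diagonal entries change sign across the window.
  have hend : ∀ κ : ℝ, κ = m - 1 / 4 ∨ κ = m + 1 / 4 →
      ∀ᶠ P in 𝓝 (0 : PeriodFun →L[ℝ] PeriodFun),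
        endValue 1 0 (κ ^ 2, P) + endDeriv 0 1 (κ ^ 2, P) < 2 ∧
        0 < sin (κ * (2 * π)) * endValue 0 1 (κ ^ 2, P) ∧
        0 < -sin (κ * (2 * π)) * endDeriv 1 0 (κ ^ 2, P) := by
    intro κ hκ
    have hκ0 : 0 < κ := by rcases hκ with rfl | rfl <;> linarith
    have hcs : cos (κ * (2 * π)) = 0 ∧ sin (κ * (2 * π)) ^ 2 = 1 := by
      obtain ⟨h1, h2, h3, h4⟩ := window_ends m
      rcases hκ with rfl | rfl
      · rw [h1, h2]; norm_num
      · rw [h3, h4]; norm_num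
    obtain ⟨a, b, c, d⟩ := unperturbed_entries hκ0.ne'
    have hmem : O ∈ 𝓝 (κ ^ 2, (0 : PeriodFun →L[ℝ] PeriodFun)) :=
      hOo.mem_nhds (isUnit_shootOp_zero _)
    have hincl : Tendsto (fun P : PeriodFun →L[ℝ] PeriodFun => (κ ^ 2, P)) (𝓝 0)
        (𝓝 (κ ^ 2, 0)) := (Continuous.prodMk_right (κ ^ 2)).tendsto 0
    have tA := (cA.continuousAt hmem).tendsto.comp hincl
    have tB := (cB.continuousAt hmem).tendsto.comp hincl
    have tC := (cC.continuousAt hmem).tendsto.comp hincl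
    have tD := (cD.continuousAt hmem).tendsto.comp hincl
    rw [a, hcs.1] at tA
    rw [d, hcs.1] at tD
    rw [b] at tB
    rw [c] at tC
    refine ((tA.add tD).eventually_lt_const (by norm_num)).and
      (((tB.const_mul (sin (κ * (2 * π)))).eventually_const_lt ?_).and
      ((tC.const_mul (-sin (κ * (2 * π)))).eventually_const_lt ?_))
    · have : sin (κ * (2 * π)) * (sin (κ * (2 * π)) / κ) = 1 / κ := by
        rw [← hcs.2]; ring
      rw [this]; positivity
    · have : -sin (κ * (2 * π)) * (-κ * sin (κ * (2 * π))) = κ := by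
        linear_combination κ * hcs.2
      rw [this]; exact hκ0
  have hV : ∀ᶠ P in 𝓝 (0 : PeriodFun →L[ℝ] PeriodFun), P ∈ V₂ := hV₂.mem_nhds (h0 rfl)
  have hall := hV.and ((hend _ (Or.inl rfl)).and (hend _ (Or.inr rfl)))
  obtain ⟨r, hr, hball⟩ := Metric.eventually_nhds_iff.1 hall
  refine ⟨r, hr, fun P hP => ?_⟩
  obtain ⟨h1, h2, h3⟩ := hball (y := P) (by simpa using hP)
  refine ⟨fun ν hν => ?_, fun κ hκ => ?_⟩
  · have := hsub (mk_mem_prod (hw hν) h1)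
    exact this
  · rcases hκ with rfl | rfl
    · exact h2
    · exact h3

/-- A zero of an off-diagonal entry yields an eigenfunction with a zero, respectively a critical
point, at the origin, unless the trace exceeds `2` there and gives two eigenvalues. Either outcome
lets `IsClassified.exists_of_type` find the wanted type. -/
theorem exists_forall_eigenfunction_window {φ : ℝ → ℝ} (hφ : IntegrableOn φ (Icc 0 1) volume)
    (hφ_neg : ∀ t ∈ Icc (0 : ℝ) 1, φ t < 0) {m : ℕ} (hm : m ≠ 0) : ∃ ε₀ > 0, ∀ ε, 0 < ε → ε < ε₀ →
      ((∃ ν ∈ window m, ∃ U : C(Torus, ℝ), IsEigenfunction (bumpPotential φ 0 ε) (1 + ν) U ∧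
          U ((0 : ℝ) : Torus) = 0) ∨
        ∃ ν₁ ∈ window m, ∃ ν₂ ∈ window m, ν₁ ≠ ν₂ ∧
          (∃ U, IsEigenfunction (bumpPotential φ 0 ε) (1 + ν₁) U) ∧
          ∃ U, IsEigenfunction (bumpPotential φ 0 ε) (1 + ν₂) U) ∧
      ((∃ ν ∈ window m, ∃ U : C(Torus, ℝ), IsEigenfunction (bumpPotential φ 0 ε) (1 + ν) U ∧
          ∀ g' : ℝ → ℝ, (∀ t : ℝ, HasDerivAt (fun s : ℝ => U (s : Torus)) (g' t) t) → g' 0 = 0) ∨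
        ∃ ν₁ ∈ window m, ∃ ν₂ ∈ window m, ν₁ ≠ ν₂ ∧
          (∃ U, IsEigenfunction (bumpPotential φ 0 ε) (1 + ν₁) U) ∧
          ∃ U, IsEigenfunction (bumpPotential φ 0 ε) (1 + ν₂) U) := by
  obtain ⟨r, hr, H⟩ := exists_forall_monodromy hm
  have hmass := mass_pos hφ hφ_neg
  have hm1 : (1 : ℝ) ≤ m := by exact_mod_cast Nat.one_le_iff_ne_zero.2 hm
  refine ⟨min 1 (r / mass φ), by positivity, fun ε hε hlt => ?_⟩
  have hε1 : ε < 1 := hlt.trans_le (min_le_left _ _)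
  have hεr : ε * mass φ < r := (lt_div_iff₀ hmass).1 (hlt.trans_le (min_le_right _ _))
  have hε2 : ε < 2 * π := by linarith [pi_gt_three]
  have hqi : ∀ a b, IntervalIntegrable (bump φ ε) volume a b := fun a b =>
    (integrable_bump hφ hε).intervalIntegrable
  set P := volterra (bump φ ε) hqi with hP
  have hPr : ‖P‖ < r := by
    refine (norm_volterra_le hqi).trans_lt ?_
    rw [integral_abs_bump hφ_neg hε hε2]
    nlinarith [mul_pos hε hmass]
  obtain ⟨Hw, He⟩ := H P hPr
  have incl : ContinuousOn (fun ν : ℝ => (ν, P)) (window m) :=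
    (Continuous.prodMk_left P).continuousOn
  have maps : MapsTo (fun ν : ℝ => (ν, P)) (window m) {p | IsUnit (shootOp p)} :=
    fun ν hν => (Hw ν hν).1
  have cA := (continuousOn_endValue 1 0).comp incl maps
  have cB := (continuousOn_endValue 0 1).comp incl maps
  have cC := (continuousOn_endDeriv 1 0).comp incl maps
  have cD := (continuousOn_endDeriv 0 1).comp incl maps
  have hab : ((m : ℝ) - 1 / 4) ^ 2 ≤ ((m : ℝ) + 1 / 4) ^ 2 := by nlinarith
  have hdet : ∀ ν ∈ window m, endValue 1 0 (ν, P) * endDeriv 0 1 (ν, P) -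
      endValue 0 1 (ν, P) * endDeriv 1 0 (ν, P) = 1 := by
    intro ν hν
    obtain ⟨u₁, w₁, h₁, a1, a2, a3, a4⟩ := exists_isSolution hqi (Hw ν hν).1 1 0
    obtain ⟨u₂, w₂, h₂, b1, b2, b3, b4⟩ := exists_isSolution hqi (Hw ν hν).1 0 1
    have := h₁.wronskian hqi h₂
    rw [a1, a2, a3, a4, b1, b2, b3, b4] at this
    linarith
  have mk : ∀ ν ∈ window m, ∀ α β : ℝ, (α ≠ 0 ∨ β ≠ 0) →
      α * endValue 1 0 (ν, P) + β * endValue 0 1 (ν, P) = α →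
      α * endDeriv 1 0 (ν, P) + β * endDeriv 0 1 (ν, P) = β →
      ∃ U : C(Torus, ℝ), IsEigenfunction (bumpPotential φ 0 ε) (1 + ν) U ∧
        U ((0 : ℝ) : Torus) = α ∧ ∀ g' : ℝ → ℝ,
          (∀ t : ℝ, HasDerivAt (fun s : ℝ => U (s : Torus)) (g' t) t) → g' 0 = β := by
    intro ν hν α β hne e1 e2
    obtain ⟨u, w, h, a1, a2, a3, a4⟩ := exists_isSolution hqi (Hw ν hν).1 α β
    have := h.exists_isEigenfunction hφ hε (by rw [a3, a1, endValue_eq]; exact e1)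
      (by rw [a4, a2, endDeriv_eq]; exact e2) (by rwa [a1, a2])
    rwa [a1, a2] at this
  have two : (∃ x ∈ window m, ∃ y ∈ window m, x ≠ y ∧
      endValue 1 0 (x, P) + endDeriv 0 1 (x, P) = 2 ∧
      endValue 1 0 (y, P) + endDeriv 0 1 (y, P) = 2) →
      ∃ ν₁ ∈ window m, ∃ ν₂ ∈ window m, ν₁ ≠ ν₂ ∧
          (∃ U, IsEigenfunction (bumpPotential φ 0 ε) (1 + ν₁) U) ∧
          ∃ U, IsEigenfunction (bumpPotential φ 0 ε) (1 + ν₂) U := by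
    rintro ⟨x, hx, y, hy, hxy, tx, ty⟩
    obtain ⟨α, β, hne, e1, e2⟩ := exists_fixed_vector (hdet x hx) tx
    obtain ⟨α', β', hne', e1', e2'⟩ := exists_fixed_vector (hdet y hy) ty
    obtain ⟨U, hU, -⟩ := mk x hx α β hne e1 e2
    obtain ⟨U', hU', -⟩ := mk y hy α' β' hne' e1' e2'
    exact ⟨x, hx, y, hy, hxy, ⟨U, hU⟩, U', hU'⟩
  obtain ⟨-, s1, -, s2⟩ := window_ends m
  obtain ⟨t1, b1, c1⟩ := He _ (Or.inl rfl)
  obtain ⟨t2, b2, c2⟩ := He _ (Or.inr rfl)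
  rw [s1] at b1 c1
  rw [s2] at b2 c2
  refine ⟨?_, ?_⟩
  · rcases trace_dichotomy (A := fun ν => endValue 1 0 (ν, P)) (B := fun ν => endValue 0 1 (ν, P))
      (C := fun ν => endDeriv 1 0 (ν, P)) (D := fun ν => endDeriv 0 1 (ν, P)) hab cB (cA.add cD)
      hdet (fun ν hν => (Hw ν hν).2) t1 t2 (by nlinarith) with ⟨ν, hν, hB, hA, hD⟩ | h
    · left
      obtain ⟨U, hU, hU0, -⟩ := mk ν hν 0 1 (Or.inr one_ne_zero) (by rw [hB]; ring)
        (by rw [hD]; ring)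
      exact ⟨ν, hν, U, hU, hU0⟩
    · exact Or.inr (two h)
  -- Reversing the order of the basis swaps the diagonal entries and the off-diagonal ones; the
  -- eigenfunction now has data `(1, 0)` at the origin.
  · rcases trace_dichotomy (A := fun ν => endDeriv 0 1 (ν, P)) (B := fun ν => endDeriv 1 0 (ν, P))
      (C := fun ν => endValue 0 1 (ν, P)) (D := fun ν => endValue 1 0 (ν, P)) hab cC (cD.add cA)
      (fun ν hν => by have := hdet ν hν; linarith) (fun ν hν => by have := (Hw ν hν).2; linarith)
      (by linarith) (by linarith) (by nlinarith) with ⟨ν, hν, hB, hA, hD⟩ | h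
    · left
      obtain ⟨U, hU, -, hU0⟩ := mk ν hν 1 0 (Or.inl one_ne_zero) (by rw [hD]; ring)
        (by rw [hB]; ring)
      exact ⟨ν, hν, U, hU, hU0⟩
    · right
      obtain ⟨x, hx, y, hy, hxy, tx, ty⟩ := h
      exact two ⟨x, hx, y, hy, hxy, by linarith, by linarith⟩

/-! ### The low-lying part of an eigensystem -/

/-- The eigenfunction normalised in the supremum norm. -/
noncomputable def normalized (u : C(Torus, ℝ)) : C(Torus, ℝ) := (‖u‖⁻¹ : ℝ) • u

theorem IsEigenfunction.normalized {V : Torus → ℝ} {μ : ℝ} {u : C(Torus, ℝ)}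
    (hu : IsEigenfunction V μ u) : IsEigenfunction V μ (normalized u) :=
  hu.const_smul (inv_ne_zero (norm_ne_zero_iff.2 hu.1))

theorem norm_normalized {u : C(Torus, ℝ)} (hu : u ≠ 0) : ‖normalized u‖ = 1 :=
  norm_inv_norm_smul hu

theorem normalized_apply (u : C(Torus, ℝ)) (x : Torus) : normalized u x = ‖u‖⁻¹ * u x := rfl

section

variable {φ : ℝ → ℝ} {ε η μ K : ℝ} {s : Bool} {m m' : ℕ} {u : C(Torus, ℝ)}

/-- The squares of the other natural numbers are more than `1 / 8` away from the window. -/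
theorem IsCloseTo.eq_of_mem_window (hη : η ≤ 1 / 8) (hm : m ≠ 0) {ν : ℝ} (hν : ν ∈ window m)
    (h : IsCloseTo φ ε η (1 + ν) u s m') : m' = m := by
  have h1 := abs_lt.1 h.abs_sub_lt
  have hm1 : (1 : ℝ) ≤ m := by exact_mod_cast Nat.one_le_iff_ne_zero.2 hm
  obtain ⟨h2, h3⟩ := hν
  by_contra hne
  rcases lt_or_gt_of_ne hne with hlt | hlt
  · have : (m' : ℝ) + 1 ≤ m := by exact_mod_cast hlt
    have h0 : (0 : ℝ) ≤ m' := Nat.cast_nonneg _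
    nlinarith
  · have : (m : ℝ) + 1 ≤ m' := by exact_mod_cast hlt
    nlinarith

/-- For each type there is an eigenvalue near `2` of that type. -/
theorem IsClassified.exists_of_type (hφ : IntegrableOn φ (Icc 0 1) volume) (hε : 0 < ε)
    (hK : IsClassified φ ε η K) (hη : η ≤ 1 / 8) (hKm : ∀ ν ∈ window m, 1 + ν ≤ K) (hm : m ≠ 0)
    (h : ((∃ ν ∈ window m, ∃ U : C(Torus, ℝ), IsEigenfunction (bumpPotential φ 0 ε) (1 + ν) U ∧
          U ((0 : ℝ) : Torus) = 0) ∨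
        ∃ ν₁ ∈ window m, ∃ ν₂ ∈ window m, ν₁ ≠ ν₂ ∧
          (∃ U, IsEigenfunction (bumpPotential φ 0 ε) (1 + ν₁) U) ∧
          ∃ U, IsEigenfunction (bumpPotential φ 0 ε) (1 + ν₂) U) ∧
      ((∃ ν ∈ window m, ∃ U : C(Torus, ℝ), IsEigenfunction (bumpPotential φ 0 ε) (1 + ν) U ∧
          ∀ g' : ℝ → ℝ, (∀ t : ℝ, HasDerivAt (fun s : ℝ => U (s : Torus)) (g' t) t) → g' 0 = 0) ∨
        ∃ ν₁ ∈ window m, ∃ ν₂ ∈ window m, ν₁ ≠ ν₂ ∧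
          (∃ U, IsEigenfunction (bumpPotential φ 0 ε) (1 + ν₁) U) ∧
          ∃ U, IsEigenfunction (bumpPotential φ 0 ε) (1 + ν₂) U)) (s : Bool) :
    ∃ μ U, μ ≤ K ∧ IsEigenfunction (bumpPotential φ 0 ε) μ U ∧ ‖U‖ = 1 ∧
      IsCloseTo φ ε η μ U s m := by
  have two : (∃ ν₁ ∈ window m, ∃ ν₂ ∈ window m, ν₁ ≠ ν₂ ∧
          (∃ U, IsEigenfunction (bumpPotential φ 0 ε) (1 + ν₁) U) ∧
          ∃ U, IsEigenfunction (bumpPotential φ 0 ε) (1 + ν₂) U) →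
      ∃ μ U, μ ≤ K ∧ IsEigenfunction (bumpPotential φ 0 ε) μ U ∧ ‖U‖ = 1 ∧
        IsCloseTo φ ε η μ U s m := by
    rintro ⟨ν₁, hν₁, ν₂, hν₂, hne, ⟨U₁, hU₁⟩, U₂, hU₂⟩
    have e₁ := norm_normalized hU₁.1
    have e₂ := norm_normalized hU₂.1
    obtain ⟨-, s₁, m₁, h₁⟩ := hK _ _ hU₁.normalized e₁ (hKm _ hν₁)
    obtain ⟨-, s₂, m₂, h₂⟩ := hK _ _ hU₂.normalized e₂ (hKm _ hν₂)
    obtain rfl := h₁.eq_of_mem_window hη hm hν₁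
    obtain rfl := h₂.eq_of_mem_window hη hm hν₂
    have := h₁.type_ne hφ hε hη (by simpa using hne) hU₁.normalized hU₂.normalized e₁ h₂
    by_cases hs : s₁ = s
    · subst hs
      exact ⟨_, _, hKm _ hν₁, hU₁.normalized, e₁, h₁⟩
    -- The frequencies agree and the types differ, so the two eigenfunctions realise both values of
    -- the Boolean.
    · have : s₂ = s := by
        cases s₁ <;> cases s₂ <;> cases s <;> simp_all
      subst this
      exact ⟨_, _, hKm _ hν₂, hU₂.normalized, e₂, h₂⟩
  have hη' : η < 1 := by linarith
  cases s
  · rcases h.2 with ⟨ν, hν, U, hU, h0⟩ | h2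
    · have e := norm_normalized hU.1
      obtain ⟨-, s', m', h'⟩ := hK _ _ hU.normalized e (hKm _ hν)
      obtain rfl := h'.eq_of_mem_window hη hm hν
      cases s'
      · exact ⟨_, _, hKm _ hν, hU.normalized, e, h'⟩
      -- A sine-like function has slope close to `m ≥ 1` in absolute value at the origin.
      · exfalso
        obtain ⟨U', hU', -⟩ := hU.2
        obtain ⟨σ, -, -, hd⟩ := h'.exists_sign
        have := hd (fun t => ‖U‖⁻¹ * U' t) (fun t => (hU' t).const_mul _) 0
        simp only [h0 U' hU', mul_zero, trigDeriv, cond_true, cos_zero, mul_one, zero_sub,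
          abs_neg, Nat.abs_cast] at this
        have hm1 : (1 : ℝ) ≤ m' := by exact_mod_cast Nat.one_le_iff_ne_zero.2 hm
        linarith
    · exact two h2
  · rcases h.1 with ⟨ν, hν, U, hU, h0⟩ | h2
    · have e := norm_normalized hU.1
      obtain ⟨-, s', m', h'⟩ := hK _ _ hU.normalized e (hKm _ hν)
      obtain rfl := h'.eq_of_mem_window hη hm hν
      cases s'
      · exfalso
        have := h'.trig_lt (t := 0) (by rw [normalized_apply, h0, mul_zero])
        simp only [trig, cond_false, mul_zero, cos_zero, abs_one] at this
        linarith
      · exact ⟨_, _, hKm _ hν, hU.normalized, e, h'⟩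
    · exact two h2

end

/-! ### Counting eigenvalues in an eigensystem -/

section

variable {V : Torus → ℝ} {lam : ℕ → ℝ} {u : ℕ → C(Torus, ℝ)}

/-- For an unlisted eigenvalue `complete` would put `w` in the span of the empty set. -/
theorem IsEigenSystem.exists_index (h : IsEigenSystem V lam u) {μ : ℝ} {w : C(Torus, ℝ)}
    (hw : IsEigenfunction V μ w) : ∃ k, lam k = μ := by
  by_contra! hne
  have h1 := h.complete μ w hw
  have h2 : {k | lam k = μ} = ∅ := by
    ext k; simpa using hne k
  rw [h2, image_empty, Submodule.span_empty, Submodule.mem_bot] at h1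
  exact hw.1 h1

/-- If `n + 1` distinct eigenvalues are at most `K`, then the `n`-th is. -/
theorem IsEigenSystem.le_of_injective (h : IsEigenSystem V lam u) {n : ℕ} {μ : Fin (n + 1) → ℝ}
    (hinj : Function.Injective μ) (hμ : ∀ i, ∃ w, IsEigenfunction V (μ i) w) {K : ℝ}
    (hK : ∀ i, μ i ≤ K) : lam n ≤ K := by
  have : ∀ i, ∃ k, lam k = μ i := fun i => by
    obtain ⟨w, hw⟩ := hμ i
    exact h.exists_index hw
  choose f hf using this
  have hfi : Function.Injective f := fun i j hij => hinj (by rw [← hf, ← hf, hij])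
  obtain ⟨i, hi⟩ : ∃ i, n ≤ f i := by
    by_contra! hlt
    obtain ⟨i, j, hij, he⟩ := Fintype.exists_ne_map_eq_of_card_lt
      (fun i => (⟨f i, hlt i⟩ : Fin n)) (by simp)
    exact hij (hfi (Fin.mk.inj_iff.1 he))
  exact (h.monotone hi).trans ((hf i).le.trans (hK i))

theorem IsEigenSystem.linearIndependent_pair (h : IsEigenSystem V lam u) {j k : ℕ} (hjk : j ≠ k) :
    LinearIndependent ℝ ![u j, u k] := by
  have hinj : Function.Injective ![j, k] := by
    intro a b
    fin_cases a <;> fin_cases b <;> simp [hjk, hjk.symm]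
  convert! h.linearIndependent.comp ![j, k] hinj using 1
  ext i
  fin_cases i <;> rfl

end

/-- Equal eigenvalues are excluded by simplicity, distinct ones by orthogonality. -/
theorem IsEigenSystem.type_ne {φ : ℝ → ℝ} {ε η K : ℝ} {lam : ℕ → ℝ} {u : ℕ → C(Torus, ℝ)}
    (hφ : IntegrableOn φ (Icc 0 1) volume) (hε : 0 < ε) (hK : IsClassified φ ε η K)
    (hη : η ≤ 1 / 8) (hηm : 2 * η ≤ mass φ / π)
    (h : IsEigenSystem (bumpPotential φ 0 ε) lam u) {j k : ℕ} (hjk : j ≠ k) (hj : lam j ≤ K)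
    {s s' : Bool} {m m' : ℕ} (h₁ : IsCloseTo φ ε η (lam j) (normalized (u j)) s m)
    (h₂ : IsCloseTo φ ε η (lam k) (normalized (u k)) s' m') : ¬ (s = s' ∧ m = m') := by
  by_cases he : lam j = lam k
  · exact absurd (h.linearIndependent_pair hjk)
      (hK.not_linearIndependent hη hηm hj (h.eigen j) (he ▸ h.eigen k))
  · exact h₁.type_ne hφ hε hη he (h.eigen j).normalized (h.eigen k).normalized
      (norm_normalized (h.eigen j).1) h₂

theorem window_strictMono {m n : ℕ} (hm : m ≠ 0) (hmn : m < n) {ν₁ ν₂ : ℝ} (h₁ : ν₁ ∈ window m)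
    (h₂ : ν₂ ∈ window n) : ν₁ < ν₂ := by
  have h3 : (m : ℝ) + 1 ≤ n := by exact_mod_cast hmn
  have hm1 : (1 : ℝ) ≤ m := by exact_mod_cast Nat.one_le_iff_ne_zero.2 hm
  refine h₁.2.trans_lt (lt_of_lt_of_le ?_ h₂.1)
  nlinarith

/-- A bound for the first `N` eigenvalues. -/
noncomputable def levelBound (N : ℕ) : ℝ := 1 + ((N : ℝ) + 2) ^ 2

/-- For small `ε` the first `N` eigenvalues are positive and bounded, the corresponding normalised
eigenfunctions are classified, and both types of frequency one occur among them. -/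
theorem exists_forall_eigenSystem {φ : ℝ → ℝ} (hφ : IntegrableOn φ (Icc 0 1) volume)
    (hφ_neg : ∀ t ∈ Icc (0 : ℝ) 1, φ t < 0) {N : ℕ} (hN : 3 ≤ N) {η : ℝ} (hη0 : 0 < η)
    (hη : η ≤ 1 / 8) (hηm : 2 * η ≤ mass φ / π) :
    ∃ ε₀ > 0, ∀ ε, 0 < ε → ε < ε₀ → ∀ (lam : ℕ → ℝ) (u : ℕ → C(Torus, ℝ)),
      IsEigenSystem (bumpPotential φ 0 ε) lam u →
      (∀ k < N, 0 < lam k ∧ lam k ≤ levelBound N ∧ ∃ s m,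
        IsCloseTo φ ε η (lam k) (normalized (u k)) s m ∧
          (s = true → ∃ z ∈ Icc 0 ε, u k ((z : ℝ) : Torus) = 0)) ∧
      ∀ s, ∃ k < N, IsCloseTo φ ε η (lam k) (normalized (u k)) s 1 := by
  obtain ⟨ε₁, hε₁, H₁⟩ := exists_forall_isCloseTo hφ hφ_neg (levelBound N) hη0
  -- The frequencies `1, …, N + 1` supply `N + 1` distinct eigenvalues, which bounds `lam N`.
  have hw : ∀ i : Fin (N + 1), _ := fun i =>
    exists_forall_eigenfunction_window hφ hφ_neg (m := i.1 + 1) (Nat.succ_ne_zero _)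
  choose ε₂ hε₂ H₂ using hw
  obtain ⟨ε₃, hε₃, H₃⟩ : ∃ ε₃ > 0, ∀ i, ε₃ ≤ ε₂ i := by
    refine ⟨Finset.univ.inf' Finset.univ_nonempty ε₂, ?_, fun i =>
      Finset.inf'_le _ (Finset.mem_univ i)⟩
    exact (Finset.lt_inf'_iff _).2 fun i _ => hε₂ i
  have hKpos : 1 < levelBound N := by unfold levelBound; nlinarith [sq_nonneg ((N : ℝ) + 2),
    (Nat.cast_nonneg N : (0 : ℝ) ≤ N)]
  refine ⟨min (min ε₁ ε₃) (1 / (4 * levelBound N)), by positivity, fun ε hε hlt lam u hsys => ?_⟩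
  have l1 : ε < ε₁ := hlt.trans_le ((min_le_left _ _).trans (min_le_left _ _))
  have l2 : ∀ i, ε < ε₂ i := fun i =>
    hlt.trans_le ((min_le_left _ _).trans ((min_le_right _ _).trans (H₃ i)))
  have l3 : ε * (4 * levelBound N) < 1 := (lt_div_iff₀ (by linarith)).1 (hlt.trans_le (min_le_right _ _))
  have hε2 : ε < 2 * π := by nlinarith [pi_gt_three]
  have hK : IsClassified φ ε η (levelBound N) := fun μ v hv h1 hμ => H₁ ε hε l1 μ v hv h1 hμ
  have hwin : ∀ i : Fin (N + 1), ∀ ν ∈ window (i.1 + 1), 1 + ν ≤ levelBound N := by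
    intro i ν hν
    have hi : (i.1 : ℝ) ≤ N := by exact_mod_cast Nat.lt_succ_iff.1 i.2
    have hi0 : (0 : ℝ) ≤ i.1 := Nat.cast_nonneg _
    have := hν.2
    push_cast at this
    unfold levelBound
    nlinarith
  have hev : ∀ i : Fin (N + 1), ∃ ν ∈ window (i.1 + 1), ∃ U,
      IsEigenfunction (bumpPotential φ 0 ε) (1 + ν) U := by
    intro i
    rcases (H₂ i ε hε (l2 i)).1 with ⟨ν, hν, U, hU, -⟩ | ⟨ν, hν, -, -, -, ⟨U, hU⟩, -⟩
    · exact ⟨ν, hν, U, hU⟩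
    · exact ⟨ν, hν, U, hU⟩
  choose ν hν hU using hev
  have hlamN : lam N ≤ levelBound N := by
    refine hsys.le_of_injective (μ := fun i => 1 + ν i) ?_ hU (fun i => hwin i _ (hν i))
    have hmono : StrictMono ν := fun i j hij =>
      window_strictMono (Nat.succ_ne_zero _) (Nat.succ_lt_succ hij) (hν i) (hν j)
    exact fun i j hij => hmono.injective (add_left_cancel hij)
  have hlam : ∀ k < N, lam k ≤ levelBound N := fun k hk => (hsys.monotone hk.le).trans hlamN
  have htype : ∀ k, lam k ≤ levelBound N → 0 < lam k ∧ ∃ s m,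
      IsCloseTo φ ε η (lam k) (normalized (u k)) s m := fun k hk =>
    hK _ _ (hsys.eigen k).normalized (norm_normalized (hsys.eigen k).1) hk
  refine ⟨fun k hk => ?_, fun s => ?_⟩
  · obtain ⟨hpos, s, m, hc⟩ := htype k (hlam k hk)
    refine ⟨hpos, hlam k hk, s, m, hc, ?_⟩
    rintro rfl
    -- Here `m ≤ 1 + m ^ 2 ≤ 2 * levelBound N`, and `ε` was taken below `1 / (4 * levelBound N)`.
    have hmε : 2 * (m * ε) ≤ 1 := by
      have h1 := (abs_lt.1 hc.abs_sub_lt).1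
      have h2 := hlam k hk
      have h3 : (m : ℝ) ≤ 1 + (m : ℝ) ^ 2 := by nlinarith [sq_nonneg ((m : ℝ) - 1)]
      have h4 : (m : ℝ) ≤ 2 * levelBound N := by linarith
      nlinarith
    obtain ⟨z, hz, hz0⟩ := hc.exists_zero hφ hφ_neg hε hε2 hη (hsys.eigen k).normalized hmε
    refine ⟨z, hz, ?_⟩
    rw [normalized_apply] at hz0
    exact (mul_eq_zero.1 hz0).resolve_left (inv_ne_zero (norm_ne_zero_iff.2 (hsys.eigen k).1))
  · obtain ⟨μ, U, hμK, hUe, hU1, hc⟩ := hK.exists_of_type hφ hε hη (hwin 0) (Nat.succ_ne_zero _)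
      (H₂ 0 ε hε (l2 0)) s
    obtain ⟨k, rfl⟩ := hsys.exists_index hUe
    obtain ⟨-, s', m', hc'⟩ := htype k hμK
    obtain ⟨rfl, rfl⟩ := hc.type_unique hη hηm hc'
    refine ⟨k, ?_, hc'⟩
    by_contra! hge
    -- Were the index `k` at least `N ≥ 3`, four eigenfunctions would have eigenvalues at most `lam
    -- k`, which is near `2`; only three types are available there.
    let idx : Fin 4 → ℕ := ![0, 1, 2, k]
    have hidx : Function.Injective idx := by
      intro a b
      fin_cases a <;> fin_cases b <;> simp [idx] <;> omega
    have hle : ∀ i, idx i ≤ k := by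
      intro i
      fin_cases i <;> simp [idx] <;> omega
    have ht : ∀ i, ∃ p : Bool × ℕ, IsCloseTo φ ε η (lam (idx i)) (normalized (u (idx i))) p.1 p.2 := by
      intro i
      obtain ⟨-, s, m, h⟩ := htype (idx i) ((hsys.monotone (hle i)).trans hμK)
      exact ⟨(s, m), h⟩
    choose p hp using ht
    have hpm : ∀ i, p i ∈ ({(false, 0), (false, 1), (true, 1)} : Finset (Bool × ℕ)) := by
      intro i
      have h1 := (abs_lt.1 (hp i).abs_sub_lt).1
      have h2 := (abs_lt.1 hc'.abs_sub_lt).2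
      have h3 := hsys.monotone (hle i)
      have h4 := (hp i).ne_zero
      generalize p i = q at h1 h4 ⊢
      obtain ⟨b, n⟩ := q
      simp only [Fin.val_zero, zero_add, Nat.cast_one] at h1 h2 h4
      have h5 : n ≤ 1 := by
        by_contra! hn
        have : (2 : ℝ) ≤ n := by exact_mod_cast hn
        nlinarith
      interval_cases n <;> cases b <;> simp_all
    obtain ⟨i, -, j, -, hij, hpij⟩ := Finset.exists_ne_map_eq_of_card_lt_of_maps_to
      (s := (Finset.univ : Finset (Fin 4))) (by simp) fun i _ => hpm i
    exact hsys.type_ne hφ hε hK hη hηm (hidx.ne hij) ((hsys.monotone (hle i)).trans hμK) (hp i)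
      (hp j) ⟨by rw [hpij], by rw [hpij]⟩

/-! ### The local shape of the eigenfunctions near the perturbation -/

/-- On `[-r, r]` the slope of `σ * u` is within `η` of `m * cos (m * t)`, and `K * r ≤ 1 / 8` keeps
this cosine above `7 / 8`. -/
theorem IsCloseTo.sub_le_sub {φ : ℝ → ℝ} {ε η μ K r : ℝ} {m : ℕ} {u : C(Torus, ℝ)}
    (h : IsCloseTo φ ε η μ u true m) (hu : ∃ u' : ℝ → ℝ, ∀ t : ℝ,
      HasDerivAt (fun s : ℝ => u (s : Torus)) (u' t) t) (hη : η ≤ 1 / 8) (hK : 1 ≤ K)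
    (hm : (m : ℝ) ^ 2 ≤ K) (hr : 0 ≤ r) (hKr : K * r ≤ 1 / 8) :
    ∃ σ : ℝ, (σ = 1 ∨ σ = -1) ∧ ∀ a ∈ Icc (-r) r, ∀ b ∈ Icc (-r) r, a ≤ b →
      1 / 2 * (b - a) ≤ σ * u (b : Torus) - σ * u (a : Torus) := by
  obtain ⟨u', hu'⟩ := hu
  obtain ⟨σ, hσ, -, hd⟩ := h.exists_sign
  refine ⟨σ, hσ, fun a ha b hb hab => ?_⟩
  have hD : ∀ t, HasDerivAt (fun t : ℝ => σ * u (t : Torus)) (σ * u' t) t :=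
    fun t => (hu' t).const_mul σ
  have hm1 : (1 : ℝ) ≤ m := by exact_mod_cast Nat.one_le_iff_ne_zero.2 (h.ne_zero rfl)
  refine (convex_Icc (-r) r).mul_sub_le_image_sub_of_le_deriv
    (f := fun t : ℝ => σ * u (t : Torus))
    (fun t _ => (hD t).continuousAt.continuousWithinAt)
    (fun t _ => (hD t).differentiableAt.differentiableWithinAt) (fun t ht => ?_) a ha b hb hab
  rw [(hD t).deriv]
  have ht' := interior_subset ht
  have h1 := (abs_lt.1 (hd u' hu' t)).1
  simp only [trigDeriv, cond_true] at h1
  have h2 := Real.one_sub_sq_div_two_le_cos (x := (m : ℝ) * t)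
  have h3 : t ^ 2 ≤ r ^ 2 := by nlinarith [ht'.1, ht'.2]
  have h4 : ((m : ℝ) * t) ^ 2 ≤ 1 / 8 := by
    have e1 : ((m : ℝ) * t) ^ 2 ≤ K * r ^ 2 := by
      rw [mul_pow]
      exact mul_le_mul hm h3 (sq_nonneg _) (by linarith)
    have e2 : r ≤ 1 := by nlinarith
    nlinarith
  have h5 : (7 : ℝ) / 8 ≤ cos ((m : ℝ) * t) := by linarith
  nlinarith

/-- The cosine has small slope near the origin, `|m * sin (m * t)| ≤ m ^ 2 * |t|`, so these terms
cannot compete with a sine. -/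
theorem IsCloseTo.abs_sub_le {φ : ℝ → ℝ} {ε η μ K r : ℝ} {m : ℕ} {u : C(Torus, ℝ)}
    (h : IsCloseTo φ ε η μ u false m) (hu : ∃ u' : ℝ → ℝ, ∀ t : ℝ,
      HasDerivAt (fun s : ℝ => u (s : Torus)) (u' t) t) (hm : (m : ℝ) ^ 2 ≤ K) {a b : ℝ}
    (ha : a ∈ Icc (-r) r) (hb : b ∈ Icc (-r) r) (hab : a ≤ b) :
    |u (b : Torus) - u (a : Torus)| ≤ (η + K * r) * (b - a) := by
  obtain ⟨u', hu'⟩ := hu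
  obtain ⟨σ, hσ, -, hd⟩ := h.exists_sign
  have hb' : ∀ t ∈ Icc (-r) r, ‖u' t‖ ≤ η + K * r := by
    intro t ht
    have h1 := hd u' hu' t
    simp only [trigDeriv, cond_false] at h1
    have h2 : |(m : ℝ) * sin ((m : ℝ) * t)| ≤ K * r := by
      rw [abs_mul, Nat.abs_cast]
      have e1 : |sin ((m : ℝ) * t)| ≤ m * |t| := by
        have := Real.abs_sin_le_abs (x := (m : ℝ) * t)
        rwa [abs_mul, Nat.abs_cast] at this
      calc (m : ℝ) * |sin ((m : ℝ) * t)| ≤ m * (m * |t|) := by gcongr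
        _ = (m : ℝ) ^ 2 * |t| := by ring
        _ ≤ K * r := mul_le_mul hm (abs_le.2 ⟨ht.1, ht.2⟩) (abs_nonneg _) ((sq_nonneg _).trans hm)
    have h3 : |σ * u' t| = |u' t| := by
      rcases hσ with rfl | rfl <;> simp
    rw [Real.norm_eq_abs, ← h3]
    have h4 : |σ * u' t| ≤ |σ * u' t - -((m : ℝ) * sin ((m : ℝ) * t))| +
        |-((m : ℝ) * sin ((m : ℝ) * t))| := by
      have := abs_add_le (σ * u' t - -((m : ℝ) * sin ((m : ℝ) * t))) (-((m : ℝ) * sin ((m : ℝ) * t)))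
      simpa using this
    rw [abs_neg] at h4
    linarith
  have := (convex_Icc (-r) r).norm_image_sub_le_of_norm_hasDerivWithin_le
    (fun t _ => (hu' t).hasDerivWithinAt) hb' ha hb
  rwa [Real.norm_eq_abs, Real.norm_eq_abs, abs_of_nonneg (sub_nonneg.2 hab)] at this

theorem IsCloseTo.half_lt_abs {φ : ℝ → ℝ} {ε η μ K r : ℝ} {m : ℕ} {u : C(Torus, ℝ)}
    (h : IsCloseTo φ ε η μ u false m) (hη : η ≤ 1 / 8) (hK : 1 ≤ K)
    (hm : (m : ℝ) ^ 2 ≤ K) (hr : 0 ≤ r) (hKr : K * r ≤ 1 / 8) {t : ℝ} (ht : t ∈ Icc (-r) r) :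
    1 / 2 < |u (t : Torus)| := by
  obtain ⟨σ, hσ, hd, -⟩ := h.exists_sign
  have h1 := (abs_lt.1 (hd t)).1
  simp only [trig, cond_false] at h1
  have h2 := Real.one_sub_sq_div_two_le_cos (x := (m : ℝ) * t)
  have h3 : t ^ 2 ≤ r ^ 2 := by nlinarith [ht.1, ht.2]
  have h4 : ((m : ℝ) * t) ^ 2 ≤ 1 / 8 := by
    have e1 : ((m : ℝ) * t) ^ 2 ≤ K * r ^ 2 := by
      rw [mul_pow]
      exact mul_le_mul hm h3 (sq_nonneg _) (by linarith)
    have e2 : r ≤ 1 := by nlinarith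
    nlinarith
  have h5 : |σ * u (t : Torus)| = |u (t : Torus)| := by
    rcases hσ with rfl | rfl <;> simp
  rw [← h5]
  have := le_abs_self (σ * u (t : Torus))
  linarith

/-- A sign-normalised increasing function grows in absolute value away from its zero. -/
theorem abs_sub_abs_ge_of_zero {g : ℝ → ℝ} {σ r z a b : ℝ} (hσ : σ = 1 ∨ σ = -1)
    (h : ∀ a ∈ Icc (-r) r, ∀ b ∈ Icc (-r) r, a ≤ b → 1 / 2 * (b - a) ≤ σ * g b - σ * g a)
    (hz : z ∈ Icc (-r) r) (hgz : g z = 0) (ha : a ∈ Icc (-r) r) (hb : b ∈ Icc (-r) r)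
    (hab : a ≤ b) :
    (z ≤ a → 1 / 2 * (b - a) ≤ |g b| - |g a|) ∧ (b ≤ z → 1 / 2 * (b - a) ≤ |g a| - |g b|) := by
  have e : ∀ t, |σ * g t| = |g t| := fun t => by rcases hσ with rfl | rfl <;> simp
  have h1 := h a ha b hb hab
  rw [← e a, ← e b]
  refine ⟨fun hza => ?_, fun hbz => ?_⟩
  · have h2 := h z hz a ha hza
    have h3 := h z hz b hb (hza.trans hab)
    rw [hgz, mul_zero] at h2 h3
    rw [abs_of_nonneg (by linarith), abs_of_nonneg (by linarith)]
    exact h1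
  · have h2 := h a ha z hz (hab.trans hbz)
    have h3 := h b hb z hz hbz
    rw [hgz, mul_zero] at h2 h3
    rw [abs_of_nonpos (by linarith), abs_of_nonpos (by linarith)]
    linarith

/-- Adding `b` to every `a k` makes all terms nonnegative, so the sum is at least the term `k₀`, at
a total cost of at most `2 * N * b`. It serves both for the monotonicity outside the bump and for
the concavity. -/
theorem sum_pos_of_dominant {N k₀ : ℕ} (hk₀ : k₀ < N) {c a : ℕ → ℝ} {b c₀ d : ℝ} (hb : 0 ≤ b)
    (hc₀ : 0 ≤ c₀) (hd : 0 ≤ d) (hc : ∀ k < N, c k ∈ Icc c₀ 2) (ha : ∀ k < N, -b ≤ a k)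
    (ha₀ : d ≤ a k₀) (hlt : 2 * N * b < c₀ * d) : 0 < ∑ k ∈ Finset.range N, c k * a k := by
  have h1 : c k₀ * (a k₀ + b) ≤ ∑ k ∈ Finset.range N, c k * (a k + b) :=
    Finset.single_le_sum (f := fun k => c k * (a k + b)) (fun k hk => by
      have hk := Finset.mem_range.1 hk
      exact mul_nonneg (hc₀.trans (hc k hk).1) (by linarith [ha k hk])) (Finset.mem_range.2 hk₀)
  have h2 : ∑ k ∈ Finset.range N, c k * b ≤ 2 * N * b := by
    rw [← Finset.sum_mul]
    refine mul_le_mul_of_nonneg_right ?_ hb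
    have := Finset.sum_le_card_nsmul (Finset.range N) c 2
      (fun k hk => (hc k (Finset.mem_range.1 hk)).2)
    rw [Finset.card_range, nsmul_eq_mul] at this
    linarith
  have h3 : c₀ * d ≤ c k₀ * (a k₀ + b) :=
    mul_le_mul (hc k₀ hk₀).1 (by linarith) hd (hc₀.trans (hc k₀ hk₀).1)
  simp only [mul_add, Finset.sum_add_distrib] at h1
  rw [mul_add] at h3
  linarith

/-- A continuous function which decreases before `[0, ε]`, increases after it, and whose
minimisers form a finite set has a strict local minimum in `[0, ε]`. -/
theorem exists_strict_min {f : ℝ → ℝ} {ε δ : ℝ} (hε : 0 ≤ ε) (hδ : 0 < δ) (hf : Continuous f)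
    (hl : StrictAntiOn f (Icc (-δ) 0)) (hr : StrictMonoOn f (Icc ε (ε + δ))) {Z : Set ℝ}
    (hZ : Z.Finite) (h : ∀ t ∈ Ioo (-δ) (ε + δ), (∀ s ∈ Icc (-δ) (ε + δ), f t ≤ f s) → t ∈ Z) :
    ∃ t ∈ Icc 0 ε, ∀ᶠ s in 𝓝[≠] t, f t < f s := by
  obtain ⟨t, ht, hmin⟩ := isCompact_Icc.exists_isMinOn (nonempty_Icc.2 hε) hf.continuousOn
  have hall : ∀ s ∈ Icc (-δ) (ε + δ), f t ≤ f s := by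
    intro s hs
    rcases le_total s 0 with h0 | h0
    · exact (hmin ⟨le_rfl, hε⟩).trans (hl.antitoneOn ⟨hs.1, h0⟩ ⟨by linarith, le_rfl⟩ h0)
    · rcases le_total s ε with h1 | h1
      · exact hmin ⟨h0, h1⟩
      · exact (hmin ⟨hε, le_rfl⟩).trans (hr.monotoneOn ⟨le_rfl, by linarith⟩ ⟨h1, hs.2⟩ h1)
  refine ⟨t, ht, ?_⟩
  have h1 : ∀ᶠ s in 𝓝[≠] t, s ∈ Ioo (-δ) (ε + δ) :=
    nhdsWithin_le_nhds (Ioo_mem_nhds (by linarith [ht.1]) (by linarith [ht.2]))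
  -- The other candidates for minimisers form a finite set missing `t`, so they stay away from `t`.
  have h2 : ∀ᶠ s in 𝓝[≠] t, s ∉ Z \ {t} :=
    nhdsWithin_le_nhds ((hZ.sdiff).isClosed.isOpen_compl.mem_nhds (by simp))
  filter_upwards [h1, h2, self_mem_nhdsWithin] with s hs1 hs2 hs3
  refine lt_of_le_of_ne (hall s (Ioo_subset_Icc_self hs1)) fun he => hs2 ⟨?_, hs3⟩
  exact h s hs1 fun r hr => he ▸ hall r hr

/-! ### Concavity away from the zeros -/

/-- Near `t₀` the signs are frozen, so the sum is differentiable and its derivative strictly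
decreases; vanishing at a minimum, it would be negative just to the right. Concavity is used in
integrated form because `V` is only integrable. -/
theorem not_isLocalMin_sum_abs {N : ℕ} {c lam : ℕ → ℝ} {V : Torus → ℝ} {w : ℕ → C(Torus, ℝ)}
    (hw : ∀ k < N, IsEigenfunction V (lam k) (w k)) {t₀ : ℝ}
    (h0 : ∀ k < N, w k (t₀ : Torus) ≠ 0)
    (hpos : ∀ᶠ t : ℝ in 𝓝 t₀,
      0 < ∑ k ∈ Finset.range N, c k * ((lam k - V (t : Torus)) * |w k (t : Torus)|)) :
    ¬ IsLocalMin (fun t : ℝ => ∑ k ∈ Finset.range N, c k * |w k (t : Torus)|) t₀ := by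
  intro hmin
  have hder : ∀ k, ∃ w' : ℝ → ℝ, k < N →
      (∀ t : ℝ, HasDerivAt (fun s : ℝ => w k (s : Torus)) (w' t) t) ∧ ∀ a b : ℝ,
      IntervalIntegrable (fun t : ℝ => (V (t : Torus) - lam k) * w k (t : Torus)) volume a b ∧
      w' b - w' a = ∫ t in a..b, (V (t : Torus) - lam k) * w k (t : Torus) := by
    intro k
    by_cases hk : k < N
    · obtain ⟨w', h⟩ := (hw k hk).2
      exact ⟨w', fun _ => h⟩
    · exact ⟨0, fun h => absurd h hk⟩
  choose w' hw' using hder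
  set τ : ℕ → ℝ := fun k => SignType.sign (w k (t₀ : Torus)) with hτ
  have habs : ∀ᶠ t : ℝ in 𝓝 t₀, ∀ k < N, |w k (t : Torus)| = τ k * w k (t : Torus) := by
    refine (Set.finite_lt_nat N).eventually_all.2 fun k hk => ?_
    have hc : ContinuousAt (fun t : ℝ => w k (t : Torus)) t₀ := (continuous_coe (w k)).continuousAt
    rcases lt_or_gt_of_ne (h0 k hk) with hlt | hgt
    · filter_upwards [hc.eventually_lt_const hlt] with t ht
      simp [hτ, sign_neg hlt, abs_of_neg ht]
    · filter_upwards [hc.eventually_const_lt hgt] with t ht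
      simp [hτ, sign_pos hgt, abs_of_pos ht]
  set G : ℝ → ℝ := fun t => ∑ k ∈ Finset.range N, c k * (τ k * w k (t : Torus)) with hG
  set G' : ℝ → ℝ := fun t => ∑ k ∈ Finset.range N, c k * (τ k * w' k t) with hG'
  have hGd : ∀ t, HasDerivAt G (G' t) t := fun t => HasDerivAt.fun_sum fun k hk =>
    (((hw' k (Finset.mem_range.1 hk)).1 t).const_mul (τ k)).const_mul (c k)
  have heq : (fun t : ℝ => ∑ k ∈ Finset.range N, c k * |w k (t : Torus)|) =ᶠ[𝓝 t₀] G := by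
    filter_upwards [habs] with t ht
    exact Finset.sum_congr rfl fun k hk => by rw [ht k (Finset.mem_range.1 hk)]
  have hGmin : IsLocalMin G t₀ := hmin.congr heq
  have hG0 : G' t₀ = 0 := hGmin.hasDerivAt_eq_zero (hGd t₀)
  obtain ⟨ρ, hρ, hball⟩ := Metric.eventually_nhds_iff.1 (habs.and (hpos.and hGmin))
  have hneg : ∀ t ∈ Ioo t₀ (t₀ + ρ), G' t < 0 := by
    intro t ht
    have hi : ∀ k ∈ Finset.range N, IntervalIntegrable
        (fun s : ℝ => c k * (τ k * ((V (s : Torus) - lam k) * w k (s : Torus)))) volume t₀ t :=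
      fun k hk => (((hw' k (Finset.mem_range.1 hk)).2 t₀ t).1.const_mul (τ k)).const_mul (c k)
    have e1 : G' t - G' t₀ = ∫ s in t₀..t,
        ∑ k ∈ Finset.range N, c k * (τ k * ((V (s : Torus) - lam k) * w k (s : Torus))) := by
      rw [intervalIntegral.integral_finsetSum hi, hG', ← Finset.sum_sub_distrib]
      refine Finset.sum_congr rfl fun k hk => ?_
      rw [intervalIntegral.integral_const_mul, intervalIntegral.integral_const_mul,
        ← ((hw' k (Finset.mem_range.1 hk)).2 t₀ t).2]
      ring
    have hii : IntervalIntegrable (fun s : ℝ => ∑ k ∈ Finset.range N,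
        c k * (τ k * ((V (s : Torus) - lam k) * w k (s : Torus)))) volume t₀ t := by
      have := IntervalIntegrable.sum (Finset.range N) hi
      simpa only [Finset.sum_fn] using this
    have e2 := intervalIntegral.intervalIntegral_pos_of_pos_on hii.neg (fun s hs => by
      obtain ⟨h1, h2, -⟩ := hball (y := s) (by
        rw [Real.dist_eq, abs_lt]; constructor <;> linarith [hs.1, hs.2, ht.2])
      refine h2.trans_eq ?_
      rw [Pi.neg_apply, ← Finset.sum_neg_distrib]
      refine Finset.sum_congr rfl fun k hk => ?_
      rw [h1 k (Finset.mem_range.1 hk)]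
      ring) ht.1
    have e3 : ∫ s in t₀..t, (-fun s : ℝ => ∑ k ∈ Finset.range N,
        c k * (τ k * ((V (s : Torus) - lam k) * w k (s : Torus)))) s = -(G' t - G' t₀) := by
      rw [e1, ← intervalIntegral.integral_neg]; rfl
    rw [e3] at e2
    linarith
  have hanti : StrictAntiOn G (Icc t₀ (t₀ + ρ / 2)) := by
    refine strictAntiOn_of_deriv_neg (convex_Icc _ _)
      (fun t _ => (hGd t).continuousAt.continuousWithinAt) fun t ht => ?_
    rw [interior_Icc] at ht
    rw [(hGd t).deriv]
    exact hneg t ⟨ht.1, by linarith [ht.2]⟩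
  have h1 := hanti (left_mem_Icc.2 (by linarith)) (right_mem_Icc.2 (by linarith))
    (by linarith : t₀ < t₀ + ρ / 2)
  have h2 := (hball (y := t₀ + ρ / 2) (by
    rw [Real.dist_eq, abs_lt]; constructor <;> linarith)).2.2
  linarith

/-! ### The strict local minimum -/

theorem eigenSum_eq (lam : ℕ → ℝ) (u : ℕ → C(Torus, ℝ)) (N : ℕ) (x : Torus) :
    eigenSum lam u N x = ∑ k ∈ Finset.range N, 1 / √(lam k) * |normalized (u k) x| := by
  refine Finset.sum_congr rfl fun k _ => ?_
  rw [normalized_apply, abs_mul, abs_inv, abs_norm, div_eq_inv_mul |u k x|]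

theorem one_div_sqrt_mem {K x : ℝ} (hK : 1 ≤ K) (hx : 1 / 4 ≤ x) (hxK : x ≤ K) :
    1 / √x ∈ Icc (1 / K) 2 := by
  have h1 : (1 : ℝ) / 2 ≤ √x := Real.le_sqrt_of_sq_le (by linarith)
  have h2 : √x ≤ K := Real.sqrt_le_iff.2 ⟨by linarith, by nlinarith⟩
  constructor
  · exact one_div_le_one_div_of_le (by linarith) h2
  · rw [div_le_iff₀ (by linarith)]
    linarith

theorem exists_strict_min_eigenSum {φ : ℝ → ℝ} (hφ : IntegrableOn φ (Icc 0 1) volume)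
    (hφ_neg : ∀ t ∈ Icc (0 : ℝ) 1, φ t < 0) {N : ℕ} (hN : 3 ≤ N) :
    ∃ ε₀ > 0, ∀ ε, 0 < ε → ε < ε₀ → ∀ (lam : ℕ → ℝ) (u : ℕ → C(Torus, ℝ)),
      IsEigenSystem (bumpPotential φ 0 ε) lam u → (∀ k < N, 0 < lam k) ∧
        ∃ t ∈ Icc 0 ε, ∀ᶠ s : ℝ in 𝓝[≠] t,
          eigenSum lam u N (t : Torus) < eigenSum lam u N (s : Torus) := by
  have hN' : (3 : ℝ) ≤ N := by exact_mod_cast hN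
  set K := levelBound N with hKdef
  have hK : 1 ≤ K := by rw [hKdef, levelBound]; nlinarith
  have hK0 : 0 < K := by linarith
  -- `β` bounds the adverse contribution of each term. The value makes `2 * N * β` equal to `1 / K *
  -- (1 / 8)`, below the dominant gain `1 / K * (1 / 2)` in the monotonicity and `1 / K * (1 / 4)`
  -- in the concavity.
  set β : ℝ := 1 / (16 * K * N) with hβ
  have hβ0 : 0 < β := by positivity
  have hβN : 2 * N * β = 1 / K * (1 / 8) := by rw [hβ]; field_simp; ring
  have hβ1 : β ≤ 1 / 48 := by
    rw [hβ]
    exact one_div_le_one_div_of_le (by norm_num) (by nlinarith)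
  have hKinv : 0 < 1 / K := by positivity
  have hmass := mass_pos hφ hφ_neg
  set η : ℝ := min (1 / 8) (min (mass φ / (2 * π)) (β / 2)) with hηdef
  have hη0 : 0 < η := by
    have := Real.pi_pos
    exact lt_min (by norm_num) (lt_min (by positivity) (by positivity))
  have hη : η ≤ 1 / 8 := min_le_left _ _
  have hηm : 2 * η ≤ mass φ / π := by
    have h1 : η ≤ mass φ / (2 * π) := (min_le_right _ _).trans (min_le_left _ _)
    have h2 : mass φ / π = 2 * (mass φ / (2 * π)) := by field_simp
    linarith
  have hηβ : η ≤ β / 2 := (min_le_right _ _).trans (min_le_right _ _)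
  -- On `[-2δ, 2δ]` a cosine-like function has Lipschitz constant `η + K * (2 * δ) ≤ β`, half from
  -- each term.
  set δ : ℝ := β / (4 * K) with hδdef
  have hδ0 : 0 < δ := by positivity
  have hKδ : K * (2 * δ) = β / 2 := by rw [hδdef]; field_simp; ring
  have hKr : K * (2 * δ) ≤ 1 / 8 := by linarith
  have hr0 : 0 ≤ 2 * δ := by linarith
  obtain ⟨ε₁, hε₁, hsys⟩ := exists_forall_eigenSystem hφ hφ_neg hN hη0 hη hηm
  refine ⟨min ε₁ δ, lt_min hε₁ hδ0, fun ε hε hlt lam u hu => ?_⟩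
  obtain ⟨hA, hB⟩ := hsys ε hε (hlt.trans_le (min_le_left _ _)) lam u hu
  have hεδ : ε ≤ δ := (hlt.trans_le (min_le_right _ _)).le
  refine ⟨fun k hk => (hA k hk).1, ?_⟩
  set w : ℕ → C(Torus, ℝ) := fun k => normalized (u k) with hw
  have hwe : ∀ k, IsEigenfunction (bumpPotential φ 0 ε) (lam k) (w k) :=
    fun k => (hu.eigen k).normalized
  have hw1 : ∀ k x, |w k x| ≤ 1 := fun k x => by
    have := (w k).norm_coe_le_norm x
    rwa [norm_normalized (hu.eigen k).1] at this
  have hwd : ∀ k, ∃ u' : ℝ → ℝ, ∀ t : ℝ, HasDerivAt (fun s : ℝ => w k (s : Torus)) (u' t) t :=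
    fun k => by
      obtain ⟨u', h, -⟩ := (hwe k).2
      exact ⟨u', h⟩
  have hm : ∀ k < N, ∀ s m, IsCloseTo φ ε η (lam k) (w k) s m → (m : ℝ) ^ 2 ≤ K := by
    intro k hk s m h
    have h1 := abs_lt.1 h.abs_sub_lt
    linarith [(hA k hk).2.1]
  have hc : ∀ k < N, 1 / √(lam k) ∈ Icc (1 / K) 2 := by
    intro k hk
    obtain ⟨-, hle, s, m, h, -⟩ := hA k hk
    have h1 := abs_lt.1 h.abs_sub_lt
    exact one_div_sqrt_mem hK (by nlinarith [sq_nonneg (m : ℝ)]) hle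
  have hsin : ∀ k < N, ∀ m, IsCloseTo φ ε η (lam k) (w k) true m →
      ∀ p ∈ Icc (-(2 * δ)) (2 * δ), ∀ q ∈ Icc (-(2 * δ)) (2 * δ), p ≤ q →
        (ε ≤ p → 1 / 2 * (q - p) ≤ |w k (q : Torus)| - |w k (p : Torus)|) ∧
        (q ≤ 0 → 1 / 2 * (q - p) ≤ |w k (p : Torus)| - |w k (q : Torus)|) := by
    intro k hk m h p hp q hq hpq
    obtain ⟨-, -, s', m', h', hz⟩ := hA k hk
    obtain rfl := (h.type_unique hη hηm h').1
    obtain ⟨z, hz, hz0⟩ := hz rfl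
    obtain ⟨σ, hσ, hmono⟩ := h.sub_le_sub (hwd k) hη hK (hm k hk _ _ h) hr0 hKr
    have := abs_sub_abs_ge_of_zero (g := fun t : ℝ => w k (t : Torus)) hσ hmono (z := z)
      ⟨by linarith [hz.1], by linarith [hz.2]⟩
      (by simp only [hw, normalized_apply, hz0, mul_zero]) hp hq hpq
    exact ⟨fun h1 => this.1 (hz.2.trans h1), fun h1 => this.2 (h1.trans hz.1)⟩
  have hall : ∀ k < N, ∀ p ∈ Icc (-(2 * δ)) (2 * δ), ∀ q ∈ Icc (-(2 * δ)) (2 * δ), p ≤ q →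
        (ε ≤ p → -(β * (q - p)) ≤ |w k (q : Torus)| - |w k (p : Torus)|) ∧
        (q ≤ 0 → -(β * (q - p)) ≤ |w k (p : Torus)| - |w k (q : Torus)|) := by
    intro k hk p hp q hq hpq
    obtain ⟨-, -, s, m, h, -⟩ := hA k hk
    have hnn : 0 ≤ β * (q - p) := mul_nonneg hβ0.le (by linarith)
    cases s
    · have h1 := h.abs_sub_le (hwd k) (hm k hk _ _ h) hp hq hpq
      have h2 : (η + K * (2 * δ)) * (q - p) ≤ β * (q - p) :=
        mul_le_mul_of_nonneg_right (by linarith) (by linarith)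
      have h3 := abs_le.1 (abs_abs_sub_abs_le_abs_sub (w k (q : Torus)) (w k (p : Torus)))
      exact ⟨fun _ => by linarith [h3.1], fun _ => by linarith [h3.2]⟩
    · have h1 := hsin k hk m h p hp q hq hpq
      exact ⟨fun h2 => by linarith [h1.1 h2], fun h2 => by linarith [h1.2 h2]⟩
  obtain ⟨k₁, hk₁, hclose₁⟩ := hB true
  obtain ⟨k₂, hk₂, hclose₂⟩ := hB false
  have hgap : ∀ p q : ℝ, p < q → 2 * N * (β * (q - p)) < 1 / K * (1 / 2 * (q - p)) := by
    intro p q hpq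
    have : 2 * N * (β * (q - p)) = 1 / K * (1 / 8 * (q - p)) := by
      rw [← mul_assoc, hβN, mul_assoc]
    rw [this]
    exact mul_lt_mul_of_pos_left (by linarith) hKinv
  have hstrict : ∃ t ∈ Icc 0 ε, ∀ᶠ s : ℝ in 𝓝[≠] t,
      (fun t : ℝ => ∑ k ∈ Finset.range N, 1 / √(lam k) * |w k (t : Torus)|) t <
      (fun t : ℝ => ∑ k ∈ Finset.range N, 1 / √(lam k) * |w k (t : Torus)|) s := by
    refine exists_strict_min hε.le hδ0 ?_ ?_ ?_
      (Z := ⋃ k ∈ Finset.range N, {t : ℝ | t ∈ Icc (-(2 * δ)) (2 * δ) ∧ w k (t : Torus) = 0})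
      ?_ ?_
    · exact continuous_finsetSum _ fun k _ => continuous_const.mul (continuous_coe (w k)).abs
    · intro p hp q hq hpq
      have hp' : p ∈ Icc (-(2 * δ)) (2 * δ) := ⟨by linarith [hp.1], by linarith [hp.2]⟩
      have hq' : q ∈ Icc (-(2 * δ)) (2 * δ) := ⟨by linarith [hq.1], by linarith [hq.2]⟩
      have := sum_pos_of_dominant hk₁ (c := fun k => 1 / √(lam k))
        (a := fun k => |w k (p : Torus)| - |w k (q : Torus)|)
        (mul_nonneg hβ0.le (by linarith)) hKinv.le (by linarith) hc
        (fun k hk => (hall k hk p hp' q hq' hpq.le).2 hq.2)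
        ((hsin k₁ hk₁ 1 hclose₁ p hp' q hq' hpq.le).2 hq.2) (hgap p q hpq)
      simp only [mul_sub, Finset.sum_sub_distrib] at this
      exact sub_pos.1 this
    · intro p hp q hq hpq
      have hp' : p ∈ Icc (-(2 * δ)) (2 * δ) := ⟨by linarith [hp.1], by linarith [hp.2]⟩
      have hq' : q ∈ Icc (-(2 * δ)) (2 * δ) := ⟨by linarith [hq.1], by linarith [hq.2]⟩
      have := sum_pos_of_dominant hk₁ (c := fun k => 1 / √(lam k))
        (a := fun k => |w k (q : Torus)| - |w k (p : Torus)|)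
        (mul_nonneg hβ0.le (by linarith)) hKinv.le (by linarith) hc
        (fun k hk => (hall k hk p hp' q hq' hpq.le).1 hp.1)
        ((hsin k₁ hk₁ 1 hclose₁ p hp' q hq' hpq.le).1 hp.1) (hgap p q hpq)
      simp only [mul_sub, Finset.sum_sub_distrib] at this
      exact sub_pos.1 this
    -- In `[-2δ, 2δ]` a cosine-like function has no zero, and a sine-like one at most one by
    -- monotonicity.
    · refine (Finset.range N).finite_toSet.biUnion fun k hk => ?_
      have hk : k < N := Finset.mem_range.1 hk
      obtain ⟨-, -, s, m, h, -⟩ := hA k hk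
      refine Set.Subsingleton.finite fun p hp q hq => ?_
      cases s
      · have := h.half_lt_abs hη hK (hm k hk _ _ h) hr0 hKr hp.1
        change 1 / 2 < |w k (p : Torus)| at this
        rw [hp.2, abs_zero] at this
        linarith
      · obtain ⟨σ, -, hmono⟩ := h.sub_le_sub (hwd k) hη hK (hm k hk _ _ h) hr0 hKr
        change ∀ a ∈ Icc (-(2 * δ)) (2 * δ), ∀ b ∈ Icc (-(2 * δ)) (2 * δ), a ≤ b → 1 / 2 * (b - a) ≤
          σ * w k (b : Torus) - σ * w k (a : Torus) at hmono
        rcases le_total p q with hpq | hpq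
        · have := hmono p hp.1 q hq.1 hpq
          rw [hp.2, hq.2] at this
          linarith
        · have := hmono q hq.1 p hp.1 hpq
          rw [hp.2, hq.2] at this
          linarith
    · intro t ht hmin
      by_contra hZ
      have ht' : ∀ s ∈ Ioo (-δ) (ε + δ), s ∈ Icc (-(2 * δ)) (2 * δ) :=
        fun s hs => ⟨by linarith [hs.1], by linarith [hs.2]⟩
      have hne : ∀ k < N, w k (t : Torus) ≠ 0 := fun k hk h0 =>
        hZ (mem_biUnion (x := k) (Finset.mem_coe.2 (Finset.mem_range.2 hk)) ⟨ht' t ht, h0⟩)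
      refine not_isLocalMin_sum_abs (fun k _ => hwe k) hne ?_
        (Filter.eventually_of_mem (Ioo_mem_nhds ht.1 ht.2) fun s hs =>
          hmin s (Ioo_subset_Icc_self hs))
      filter_upwards [Ioo_mem_nhds ht.1 ht.2] with s hs
      have hV := bumpPotential_le_one hφ_neg hε 0 (s : Torus)
      -- The dominant term is the cosine of frequency one: its eigenvalue exceeds the potential by
      -- at least `1 / 2` and its modulus exceeds `1 / 2`. The other terms are at least `-η`, since
      -- the potential is at most `1`.
      refine sum_pos_of_dominant hk₂ (b := β) (d := 1 / 4) hβ0.le hKinv.le (by norm_num) hc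
        (fun k hk => ?_) ?_ ?_
      · obtain ⟨-, -, s', m, h, -⟩ := hA k hk
        have h1 := (abs_lt.1 h.abs_sub_lt).1
        have h2 : -η ≤ lam k - bumpPotential φ 0 ε (s : Torus) := by
          nlinarith [sq_nonneg (m : ℝ)]
        have h3 := hw1 k (s : Torus)
        have h4 := abs_nonneg (w k (s : Torus))
        nlinarith
      · have h1 := (abs_lt.1 hclose₂.abs_sub_lt).1
        have h3 : 1 / 2 < |w k₂ (s : Torus)| :=
          hclose₂.half_lt_abs hη hK (hm k₂ hk₂ _ _ hclose₂) hr0 hKr (ht' s hs)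
        have h2 : 1 / 2 ≤ lam k₂ - bumpPotential φ 0 ε (s : Torus) := by
          push_cast at h1
          linarith
        nlinarith
      · rw [hβN]
        exact mul_lt_mul_of_pos_left (by norm_num) hKinv
  obtain ⟨t, ht, h⟩ := hstrict
  refine ⟨t, ht, ?_⟩
  simpa only [eigenSum_eq] using h

/-! ### Translation invariance -/

/-- The translate `x ↦ u (y + x)`. -/
noncomputable def translateFun (y : Torus) : C(Torus, ℝ) ≃ₗ[ℝ] C(Torus, ℝ) where
  toFun u := u.comp ⟨fun x => y + x, by fun_prop⟩
  invFun u := u.comp ⟨fun x => -y + x, by fun_prop⟩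
  map_add' _ _ := rfl
  map_smul' _ _ := rfl
  left_inv u := by ext x; simp
  right_inv u := by ext x; simp

theorem translateFun_apply (y : Torus) (u : C(Torus, ℝ)) (x : Torus) :
    translateFun y u x = u (y + x) := rfl

theorem norm_translate (y : Torus) (u : C(Torus, ℝ)) : ‖translateFun y u‖ = ‖u‖ := by
  refine le_antisymm ?_ ?_ <;> refine (ContinuousMap.norm_le _ (norm_nonneg _)).2 fun x => ?_
  · exact u.norm_coe_le_norm _
  · have := (translateFun y u).norm_coe_le_norm (-y + x)
    rwa [translateFun_apply, add_neg_cancel_left] at this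

theorem IsEigenfunction.translate {V : Torus → ℝ} {μ : ℝ} {u : C(Torus, ℝ)}
    (h : IsEigenfunction V μ u) (y : Torus) :
    IsEigenfunction (fun x => V (y + x)) μ (translateFun y u) := by
  obtain ⟨h0, u', hd, hi⟩ := h
  obtain ⟨y₀, -, rfl⟩ := exists_coe_eq y
  refine ⟨(LinearEquiv.map_ne_zero_iff _).2 h0, fun t => u' (y₀ + t), fun t => ?_, fun a b => ?_⟩
  · have := (hd (y₀ + t)).comp_const_add y₀ t
    simpa only [translateFun_apply, QuotientAddGroup.mk_add] using this
  · have h1 := hi (y₀ + a) (y₀ + b)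
    have e : (fun t : ℝ => (V ((y₀ : Torus) + (t : Torus)) - μ) *
        translateFun (y₀ : Torus) u (t : Torus)) = fun t : ℝ =>
        (fun s : ℝ => (V (s : Torus) - μ) * u (s : Torus)) (y₀ + t) := by
      ext t
      simp only [translateFun_apply, QuotientAddGroup.mk_add]
    rw [e]
    refine ⟨?_, ?_⟩
    · have := h1.1.comp_add_left y₀
      simpa using this
    · rw [h1.2, intervalIntegral.integral_comp_add_left
        (fun s : ℝ => (V (s : Torus) - μ) * u (s : Torus))]

theorem bumpPotential_add (φ : ℝ → ℝ) (y : Torus) (ε : ℝ) (x : Torus) :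
    bumpPotential φ y ε (y + x) = bumpPotential φ 0 ε x := by
  simp only [bumpPotential, displacement, add_sub_cancel_left, sub_zero]

theorem IsEigenSystem.translate {φ : ℝ → ℝ} {ε : ℝ} {y : Torus} {lam : ℕ → ℝ}
    {u : ℕ → C(Torus, ℝ)} (h : IsEigenSystem (bumpPotential φ y ε) lam u) :
    IsEigenSystem (bumpPotential φ 0 ε) lam fun k => translateFun y (u k) where
  monotone := h.monotone
  eigen k := by
    have := (h.eigen k).translate y
    simpa only [bumpPotential_add] using this
  linearIndependent := h.linearIndependent.map' _ (translateFun y).ker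
  complete μ w hw := by
    -- Completeness is used for the original system, so `w` is translated back, expanded there, and
    -- the expansion moved forward.
    have h1 := hw.translate (-y)
    have e1 : (fun x => bumpPotential φ 0 ε (-y + x)) = bumpPotential φ y ε := by
      ext x
      rw [← bumpPotential_add φ y, add_neg_cancel_left]
    rw [e1] at h1
    have h2 := Submodule.mem_map_of_mem (f := (translateFun y).toLinearMap)
      (h.complete μ _ h1)
    have e2 : (translateFun y).toLinearMap (translateFun (-y) w) = w := by
      ext x
      simp [translateFun_apply]
    rw [e2, Submodule.map_span, image_image] at h2
    exact h2

theorem eigenSum_translate (lam : ℕ → ℝ) (u : ℕ → C(Torus, ℝ)) (N : ℕ) (y x : Torus) :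
    eigenSum lam (fun k => translateFun y (u k)) N x = eigenSum lam u N (y + x) := by
  simp only [eigenSum, norm_translate, translateFun_apply]

/-- Neighbourhoods on the circle are images of neighbourhoods on the line, and distinct points of
the circle have distinct lifts. -/
theorem isStrictLocalMin_of_lift {f : Torus → ℝ} {y : Torus} {t : ℝ}
    (h : ∀ᶠ s : ℝ in 𝓝[≠] t, f (y + (t : Torus)) < f (y + (s : Torus))) :
    IsStrictLocalMin f (y + (t : Torus)) := by
  obtain ⟨y₀, -, rfl⟩ := exists_coe_eq y
  simp only [← QuotientAddGroup.mk_add] at h ⊢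
  rw [eventually_nhdsWithin_iff] at h
  have hmap : 𝓝 ((y₀ + t : ℝ) : Torus) = map (fun s : ℝ => ((y₀ + s : ℝ) : Torus)) (𝓝 t) := by
    have h1 := (QuotientAddGroup.isOpenQuotientMap_mk (N := AddSubgroup.zmultiples
      (2 * π))).isOpenMap.map_nhds_eq QuotientAddGroup.continuous_mk.continuousAt (x := y₀ + t)
    have h2 : map (fun s : ℝ => y₀ + s) (𝓝 t) = 𝓝 (y₀ + t) :=
      (Homeomorph.addLeft y₀).map_nhds_eq t
    rw [← h1, ← h2, map_map]
    rfl
  rw [IsStrictLocalMin, eventually_nhdsWithin_iff, hmap, eventually_map]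
  filter_upwards [h] with s hs hne
  exact hs fun he => hne (by rw [mem_singleton_iff] at he ⊢; rw [he])

/-! ### The admissible range of `N` -/

theorem exists_forall_isStrictLocalMin {φ : ℝ → ℝ} (hφ : IntegrableOn φ (Icc 0 1) volume)
    (hφ_neg : ∀ t ∈ Icc (0 : ℝ) 1, φ t < 0) {N : ℕ} (hN : 3 ≤ N) :
    ∃ ε₀ > 0, ∀ ε, 0 < ε → ε < ε₀ → ∀ (y : Torus) (lam : ℕ → ℝ) (u : ℕ → C(Torus, ℝ)),
      IsEigenSystem (bumpPotential φ y ε) lam u → (∀ k < N, 0 < lam k) ∧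
        ∃ s ∈ Icc 0 ε, IsStrictLocalMin (eigenSum lam u N) (y + (s : Torus)) := by
  obtain ⟨ε₀, hε₀, h⟩ := exists_strict_min_eigenSum hφ hφ_neg hN
  refine ⟨ε₀, hε₀, fun ε hε hlt y lam u hu => ?_⟩
  obtain ⟨hpos, t, ht, hmin⟩ := h ε hε hlt lam _ hu.translate
  refine ⟨hpos, t, ht, isStrictLocalMin_of_lift ?_⟩
  simpa only [eigenSum_translate] using hmin

/-- If every property `P N` holds for all small `ε`, then it holds for all `N ≤ n ε`, where
`n ε → ∞`. -/
theorem exists_tendsto_atTop_forall_le {P : ℕ → ℝ → Prop}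
    (h : ∀ N, ∃ ε₀ > 0, ∀ ε, 0 < ε → ε < ε₀ → P N ε) :
    ∃ n : ℝ → ℝ, (∀ ε, 0 < ε → ∀ N : ℕ, N ≠ 0 → (N : ℝ) ≤ n ε → P N ε) ∧
      Tendsto n (𝓝[>] 0) atTop := by
  classical
  -- The search for the largest admissible `n` is capped at `⌈1 / ε⌉₊`, which itself tends to
  -- infinity. Excluding `N = 0` makes the default value `0` of the search satisfy the predicate.
  refine ⟨fun ε => (Nat.findGreatest (fun n => ∀ N ≤ n, N ≠ 0 → P N ε) ⌈1 / ε⌉₊ : ℕ),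
    fun ε hε N hN0 hN => ?_, ?_⟩
  · have h0 : (fun n => ∀ N ≤ n, N ≠ 0 → P N ε) 0 := fun N h1 h2 => absurd (Nat.le_zero.1 h1) h2
    exact Nat.findGreatest_spec (P := fun n => ∀ N ≤ n, N ≠ 0 → P N ε) (Nat.zero_le _) h0 N
      (Nat.cast_le.1 hN) hN0
  · refine tendsto_natCast_atTop_atTop.comp (tendsto_atTop.2 fun n => ?_)
    have h1 : ∀ᶠ ε : ℝ in 𝓝[>] 0, ∀ N ≤ n, P N ε := by
      refine (Set.finite_le_nat n).eventually_all.2 fun N _ => ?_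
      obtain ⟨ε₀, hε₀, hP⟩ := h N
      filter_upwards [Ioo_mem_nhdsGT hε₀] with ε hε
      exact hP ε hε.1 hε.2
    have h2 : ∀ᶠ ε : ℝ in 𝓝[>] 0, (n : ℝ) ≤ 1 / ε := by
      simp only [one_div]
      exact tendsto_inv_nhdsGT_zero.eventually_ge_atTop _
    filter_upwards [h1, h2] with ε hε1 hε2
    refine Nat.le_findGreatest ?_ fun N hN _ => hε1 N hN
    exact_mod_cast hε2.trans (Nat.le_ceil _)

theorem theorem3 (φ : ℝ → ℝ) (hφ_int : IntegrableOn φ (Icc 0 1) volume)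
    (hφ_neg : ∀ t ∈ Icc (0 : ℝ) 1, φ t < 0) :
    ∃ Nε : ℝ → ℝ,
      (∀ ε : ℝ, 0 < ε → ∀ y : Torus, ∀ (lam : ℕ → ℝ) (u : ℕ → C(Torus, ℝ)),
        IsEigenSystem (bumpPotential φ y ε) lam u →
        ∀ N : ℕ, 3 ≤ N → (N : ℝ) ≤ Nε ε →
          (∀ k < N, 0 < lam k) ∧
          ∃ s ∈ Icc (0 : ℝ) ε, IsStrictLocalMin (eigenSum lam u N) (y + (s : Torus))) ∧
      Tendsto Nε (𝓝[>] 0) atTop := by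
  obtain ⟨n, hn, ht⟩ := exists_tendsto_atTop_forall_le
    (P := fun N ε => 3 ≤ N → ∀ (y : Torus) (lam : ℕ → ℝ) (u : ℕ → C(Torus, ℝ)),
      IsEigenSystem (bumpPotential φ y ε) lam u → (∀ k < N, 0 < lam k) ∧
        ∃ s ∈ Icc 0 ε, IsStrictLocalMin (eigenSum lam u N) (y + (s : Torus))) (fun N => by
      by_cases hN : 3 ≤ N
      · obtain ⟨ε₀, hε₀, h⟩ := exists_forall_isStrictLocalMin hφ_int hφ_neg hN
        exact ⟨ε₀, hε₀, fun ε h1 h2 _ => h ε h1 h2⟩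
      · exact ⟨1, one_pos, fun _ _ _ h => absurd h hN⟩)
  exact ⟨n, fun ε hε y lam u hu N hN hle => hn ε hε N (by omega) hle hN y lam u hu, ht⟩
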